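/- Let $n\ge 1$. For $a_1<\dots<a_n$ and $b_1<\dots<b_n$ consider $n$ independent Brownian bridges on $[0,1]$ with diffusion parameter $n^{-1/2}$, the $j$-th one going from $a_j$ at time $0$ to $b_j$ at time $1$ (so with mean $(1-t)a_j+tb_j$ and covariance $\frac1n(\min(s,t)-st)$), conditioned on the event that $x_1(t)<\dots<x_n(t)$ for all $t\in[0,1]$. Let $Q_a$ be the weak limit, on the space of continuous paths, of the laws of these conditioned bridges as $b_1<\dots<b_n$ all tend to $0$ (nonintersecting Brownian paths started at $a$, with confluent ending point $0$). Let $\mathbf X(t)=(x_1(t),\dots,x_n(t))$, $t\in[0,1]$, be a random continuous path whose initial configuration satisfies $x_1(0)<\dots<x_n(0)$ almost surely and whose conditional law given $\mathbf X(0)=a$ is $Q_a$. Let $M$ be a (deterministic or random) Hermitian $n\times n$ matrix whose eigenvalues, in increasing order, have the same distribution as $\mathbf X(0)$ (in particular they are almost surely distinct), and let $H$ be an $n\times n$ GUE matrix independent of $M$, with distribution $\frac1{Z_n}e^{-\frac n2\operatorname{Tr}H^2}\,dH$ on Hermitian matrices, $dH=\prod_j dH_{jj}\prod_{i<j}d\operatorname{Re}H_{ij}\,d\operatorname{Im}H_{ij}$.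 Then for every $t\in[0,1)$ the vector $\mathbf X(t)$ has the same joint distribution as the increasingly ordered eigenvalues of $(1-t)M+\sqrt{t(1-t)}\,H$. For $t\in(0,1)$ both have a joint probability density with respect to Lebesgue measure on $\mathbb R^n$, and these densities coincide. -/

import Mathlib

open MeasureTheory ProbabilityTheory Filter Topology
open scoped BoundedContinuousFunction ENNReal

namespace NIBM

/-! ### Continuous paths of `n` particles on the line, over the time interval `[0, 1]` -/

/-- The space of continuous paths `[0,1] → ℝⁿ`, with the topology of uniform convergence. -/
abbrev PathSpace (n : ℕ) : Type := C(unitInterval, Fin n → ℝ)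

/-- The path space carries its Borel `σ`-algebra. -/
instance instMeasurableSpacePathSpace (n : ℕ) : MeasurableSpace (PathSpace n) :=
  borel (PathSpace n)

instance instBorelSpacePathSpace (n : ℕ) : BorelSpace (PathSpace n) := ⟨rfl⟩

/-- The law `μ` on path space is the joint law of `n` independent Brownian bridges over `[0,1]`
with diffusion parameter `σ`, the `j`-th one going from `a j` to `b j`: the coordinate processes are
independent, and each is a (continuous) Gaussian process with the mean and the covariance of
`t ↦ (1 - t) a j + t b j + σ β(t)`, where `β` is a standard Brownian bridge. -/
structure IsBrownianBridgesLaw {n : ℕ} (σ : ℝ) (a b : Fin n → ℝ) (μ : Measure (PathSpace n)) :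
    Prop where
  isProbabilityMeasure : IsProbabilityMeasure μ
  indep : iIndepFun (fun (j : Fin n) (f : PathSpace n) (t : unitInterval) => f t j) μ
  gaussian : ∀ j : Fin n, IsGaussianProcess (fun (t : unitInterval) (f : PathSpace n) => f t j) μ
  mean : ∀ (j : Fin n) (t : unitInterval), ∫ f, f t j ∂μ = (1 - (t : ℝ)) * a j + (t : ℝ) * b j
  covariance : ∀ (j : Fin n) (s t : unitInterval),
    cov[fun f : PathSpace n => f s j, fun f : PathSpace n => f t j; μ]
      = σ ^ 2 * (min (s : ℝ) (t : ℝ) - (s : ℝ) * (t : ℝ))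

/-- The event that the paths do not intersect: `x₁(t) < ⋯ < xₙ(t)` for all `t ∈ [0,1]`. -/
def nonintersecting (n : ℕ) : Set (PathSpace n) :=
  {f | ∀ t : unitInterval, StrictMono (f t)}

/-- `Q` is the law of `n` nonintersecting Brownian paths with diffusion parameter `σ`, started at
`a₁ < ⋯ < aₙ` at time `0`, with confluent ending point `0` at time `1`: it is the weak limit, as
the ending points `b₁ < ⋯ < bₙ` all tend to `0`, of the law of `n` independent Brownian bridges from
`a` to `b` conditioned on the event that they do not intersect. -/
def IsConfluentLaw {n : ℕ} (σ : ℝ) (a : Fin n → ℝ) (Q : Measure (PathSpace n)) : Prop :=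
  IsProbabilityMeasure Q ∧
  ∃ R : (Fin n → ℝ) → Measure (PathSpace n),
    (∀ b : Fin n → ℝ, StrictMono b → IsBrownianBridgesLaw σ a b (R b)) ∧
    ∀ g : PathSpace n →ᵇ ℝ,
      Tendsto (fun b : Fin n → ℝ => ∫ f, g f ∂(ProbabilityTheory.cond (R b) (nonintersecting n)))
        (𝓝[{b : Fin n → ℝ | StrictMono b}] 0) (𝓝 (∫ f, g f ∂Q))

/-- The random continuous path `X` consists of `n` nonintersecting Brownian paths with diffusion
parameter `σ`, with confluent ending point `0` at time `1` and with a (possibly random) starting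
configuration `x₁(0) < ⋯ < xₙ(0)`: conditionally on the starting configuration being `a`, the law of
`X` is the confluent law started at `a`. -/
structure IsConfluentPaths {n : ℕ} {Ω : Type*} [MeasurableSpace Ω] (σ : ℝ)
    (X : Ω → PathSpace n) (P : Measure Ω) : Prop where
  aemeasurable : AEMeasurable X P
  strictMono_start : ∀ᵐ ω ∂P, StrictMono (X ω 0)
  law : ∃ κ : Kernel (Fin n → ℝ) (PathSpace n),
    (∀ a : Fin n → ℝ, StrictMono a → IsConfluentLaw σ a (κ a)) ∧
    P.map X = (P.map (fun ω => X ω 0)).bind κ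

/-! ### Random Hermitian matrices -/

/-- Complex matrices carry the product of the Borel `σ`-algebras of their entries. -/
noncomputable instance instMeasurableSpaceMatrix (n : ℕ) : MeasurableSpace (Matrix (Fin n) (Fin n) ℂ) :=
  inferInstanceAs (MeasurableSpace (Fin n → Fin n → ℂ))

/-- The Hermitian matrix `H` with the real coordinates `p`: `H j j = p j j`, and for `i < j`,
`Re (H i j) = p i j` and `Im (H i j) = p j i`. -/
noncomputable def hermitianOfCoords {n : ℕ} (p : Fin n → Fin n → ℝ) :
    Matrix (Fin n) (Fin n) ℂ :=
  Matrix.of fun i j =>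
    if i = j then (p i i : ℂ)
    else if i < j then (p i j : ℂ) + (p j i : ℂ) * Complex.I
    else (p j i : ℂ) - (p i j : ℂ) * Complex.I

/-- The unnormalized weight `exp (-(n/2) Tr H²) dH` in real coordinates, where
`dH = ∏ dH_jj ∏_{i<j} d(Re H_ij) d(Im H_ij)`. -/
noncomputable def gueWeight (n : ℕ) : Measure (Fin n → Fin n → ℝ) :=
  volume.withDensity fun p =>
    ENNReal.ofReal
      (Real.exp (-((n : ℝ) / 2) * (hermitianOfCoords p * hermitianOfCoords p).trace.re))

/-- The Gaussian unitary ensemble: the probability distribution `Z⁻¹ exp (-(n/2) Tr H²) dH` on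
Hermitian `n × n` matrices. -/
noncomputable def gue (n : ℕ) : Measure (Matrix (Fin n) (Fin n) ℂ) :=
  ((gueWeight n Set.univ)⁻¹ • gueWeight n).map hermitianOfCoords

open Classical in
/-- The eigenvalues of a Hermitian matrix with multiplicity, in increasing order (and `0` if the
matrix is not Hermitian). Mathlib's `eigenvalues₀` lists them in decreasing order. -/
noncomputable def orderedEigenvalues {n : ℕ} (A : Matrix (Fin n) (Fin n) ℂ) : Fin n → ℝ :=
  if h : A.IsHermitian then
    fun i => h.eigenvalues₀ (Fin.cast (Fintype.card_fin n).symm (Fin.rev i))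
  else 0

end NIBM

namespace NIBM

/-! ### Gaussian expectations of polynomials and the heat flow -/

section Moments

open scoped NNReal

/-! For a fixed start `a`, both laws at time `t` satisfy the same formula. Write `Δ` for the
Vandermonde product, `m = (1 - t) a` and `s = t (1 - t) / n`. Then for suitable symmetric `f` the
expectation of `f` times `Δ(m)` is the integral of `f Δ` against independent Gaussians with means
`m_j` and variance `s`. Both laws live on weakly increasing vectors, so symmetric test functions
determine them, and `Δ(m) ≠ 0` because the starting points are distinct. A random start is then
handled by disintegration.

Matrix side. The Gaussian expectation of a polynomial is `exp (L / 2)` applied to it, evaluated at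
the mean, with `L` the weighted Laplacian (`hasSum_gaussExp`). On trace polynomials of a Hermitian
matrix the Laplacian acts as `Δ⁻¹ L Δ` acts on the corresponding symmetric polynomials of the
eigenvalues (`exists_radial`): since `Δ` is harmonic, both obey the product rule of a second-order
operator, and they agree on power sums and have the same carré du champ. Iterating gives the formula
for symmetric polynomials (`integral_symmetric_eigenvalues`), and a power series expansion carries
it to the symmetrized characters `symChar` (`integral_symChar_eigenvalues`). No integration over the
unitary group is needed.

Path side. Divided by `1 - t` and run on the clock `t / (1 - t)`, a bridge becomes Brownian motion
whose drift is its end point. For end points `σ² θ j` the probability of never colliding is the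
explicit product `noncross`. Up to the exponential tilt that removes the drift it is the Vandermonde
determinant of `exp (θ x_i)`. Hence it is harmonic (`integral_noncross`), and by antisymmetry its
integral against a symmetric function vanishes for starts with two equal coordinates
(`integral_noncross_eq_zero`). Optional stopping, carried out on finite grids with quantitative
bounds near collisions, shows that colliding paths contribute nothing
(`IsBrownianBridgesLaw.setIntegral_collision`). As time tends to `1` the weight tends to `1` on
noncolliding paths, so conditioning is the h-transform by `noncross`
(`IsBrownianBridgesLaw.integral_cond`). Letting `θ` decrease to `0` turns `noncross`, divided by the
right power of `θ`, into `Δ` (`IsConfluentLaw.integral_symm`). This one family of end points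
suffices, because the confluent law is the limit along all ordered end points tending to `0`.

Density. Splitting `Δ` into positive and negative parts in the formula bounds a positive multiple of
the law by a symmetrized Gaussian measure with density. -/

lemma iteratedDeriv_mgf_gaussianReal_succ (x : ℝ) (w : ℝ≥0) (k : ℕ) (t : ℝ) :
    iteratedDeriv (k + 1) (mgf id (gaussianReal x w)) t =
      (x + w * t) * iteratedDeriv k (mgf id (gaussianReal x w)) t
        + k * w * iteratedDeriv (k - 1) (mgf id (gaussianReal x w)) t := by
  have hint : ∀ s : ℝ, s ∈ interior (integrableExpSet id (gaussianReal x w)) := by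
    simp [integrableExpSet_id_gaussianReal]
  have hder : ∀ (m : ℕ) (s : ℝ), HasDerivAt (iteratedDeriv m (mgf id (gaussianReal x w)))
      (iteratedDeriv (m + 1) (mgf id (gaussianReal x w)) s) s := by
    intro m s
    rw [iteratedDeriv_mgf (hint s)]
    exact hasDerivAt_iteratedDeriv_mgf (hint s) m
  have hlin : ∀ s : ℝ, HasDerivAt (fun s : ℝ => x + w * s) (w : ℝ) s := fun s => by
    simpa using ((hasDerivAt_id s).const_mul (w : ℝ)).const_add x
  induction k generalizing t with
  | zero =>
    have h1 : HasDerivAt (mgf id (gaussianReal x w))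
        (Real.exp (x * t + w * t ^ 2 / 2) * (x + w * t)) t := by
      rw [mgf_id_gaussianReal]
      have : HasDerivAt (fun t : ℝ => x * t + w * t ^ 2 / 2) (x + w * t) t := by
        have h := ((hasDerivAt_id t).const_mul x).add
          ((((hasDerivAt_id t).pow 2).const_mul (w : ℝ)).div_const 2)
        exact h.congr_deriv (by simp; ring)
      exact this.exp
    simp only [zero_add, iteratedDeriv_one, iteratedDeriv_zero]
    rw [h1.deriv, mgf_id_gaussianReal]
    simp [mul_comm]
  | succ k ih =>
    have hfun : iteratedDeriv (k + 1) (mgf id (gaussianReal x w)) = fun t =>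
        (x + w * t) * iteratedDeriv k (mgf id (gaussianReal x w)) t
        + k * w * iteratedDeriv (k - 1) (mgf id (gaussianReal x w)) t := funext ih
    have h1 := hder (k + 1) t
    have h2 := ((hlin t).mul (hder k t)).add ((hder (k - 1) t).const_mul ((k : ℝ) * w))
    have h3 := h1.unique (by rw [hfun]; exact h2)
    rw [h3]
    -- The order `k - 1 + 1` equals `k` only for `k ≥ 1`; for `k = 0` that term has coefficient
    -- zero.
    rcases k with _ | k
    · simp; ring
    · simp; ring

/-- The recursion for the moments of a Gaussian law. -/
lemma integral_pow_succ_gaussianReal (x : ℝ) (w : ℝ≥0) (k : ℕ) :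
    ∫ y, y ^ (k + 1) ∂gaussianReal x w
      = x * ∫ y, y ^ k ∂gaussianReal x w + k * w * ∫ y, y ^ (k - 1) ∂gaussianReal x w := by
  have hint : (0 : ℝ) ∈ interior (integrableExpSet id (gaussianReal x w)) := by
    simp [integrableExpSet_id_gaussianReal]
  have h := iteratedDeriv_mgf_gaussianReal_succ x w k 0
  simp only [iteratedDeriv_mgf_zero hint] at h
  simpa using h

lemma integrable_pow_gaussianReal (x : ℝ) (w : ℝ≥0) (k : ℕ) :
    Integrable (fun y : ℝ => y ^ k) (gaussianReal x w) := by
  have hint : (0 : ℝ) ∈ interior (integrableExpSet id (gaussianReal x w)) := by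
    simp [integrableExpSet_id_gaussianReal]
  simpa using integrable_pow_of_mem_interior_integrableExpSet hint k

/-- The law of a family of independent Gaussian variables with means `m` and variances `w`. -/
noncomputable def gaussPi {ι : Type*} [Fintype ι] (m : ι → ℝ) (w : ι → ℝ≥0) : Measure (ι → ℝ) :=
  Measure.pi fun i => gaussianReal (m i) (w i)

instance {ι : Type*} [Fintype ι] (m : ι → ℝ) (w : ι → ℝ≥0) :
    IsProbabilityMeasure (gaussPi m w) := by
  unfold gaussPi; infer_instance

end Moments

/-! ### Polynomial expectations as the heat series of the weighted Laplacian -/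

section Heat

open scoped NNReal
open MvPolynomial

variable {ι : Type*} [Fintype ι]

/-- Evaluation of a complex polynomial at a real point. -/
noncomputable def evalR (y : ι → ℝ) (F : MvPolynomial ι ℂ) : ℂ := eval (fun i => (y i : ℂ)) F

lemma evalR_monomial (y : ι → ℝ) (s : ι →₀ ℕ) :
    evalR y (monomial s 1) = ∏ i, ((y i ^ s i : ℝ) : ℂ) := by
  simp [evalR, eval_monomial, Finsupp.prod_fintype]

lemma integrable_evalR (m : ι → ℝ) (w : ι → ℝ≥0) (F : MvPolynomial ι ℂ) :
    Integrable (fun y => evalR y F) (gaussPi m w) := by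
  induction F using MvPolynomial.induction_on' with
  | monomial s c =>
    have : (monomial s c : MvPolynomial ι ℂ) = C c * monomial s 1 := by simp [C_mul_monomial]
    have h : Integrable (fun y : ι → ℝ => ∏ i, ((y i ^ s i : ℝ) : ℂ)) (gaussPi m w) :=
      Integrable.fintype_prod (f := fun i (y : ℝ) => ((y ^ s i : ℝ) : ℂ))
        fun i => (integrable_pow_gaussianReal (m i) (w i) (s i)).ofReal
    simp_rw [this]
    simp only [evalR, map_mul, eval_C]
    refine Integrable.const_mul ?_ c
    simpa only [← evalR_monomial, evalR] using h
  | add p q hp hq =>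
    refine (hp.add hq).congr (Eventually.of_forall fun y => ?_)
    simp [evalR]

/-- The expectation of a polynomial in independent Gaussian variables. -/
noncomputable def gaussExp (m : ι → ℝ) (w : ι → ℝ≥0) : MvPolynomial ι ℂ →ₗ[ℂ] ℂ where
  toFun F := ∫ y, evalR y F ∂gaussPi m w
  map_add' p q := by
    rw [← integral_add (integrable_evalR m w p) (integrable_evalR m w q)]
    simp [evalR]
  map_smul' c p := by
    simp only [evalR, smul_eval, RingHom.id_apply, smul_eq_mul]
    exact integral_const_mul c _

lemma gaussExp_monomial (m : ι → ℝ) (w : ι → ℝ≥0) (s : ι →₀ ℕ) :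
    gaussExp m w (monomial s 1) = ∏ i, ((∫ y, y ^ s i ∂gaussianReal (m i) (w i) : ℝ) : ℂ) := by
  change ∫ y, evalR y (monomial s 1) ∂gaussPi m w = _
  simp_rw [evalR_monomial]
  rw [gaussPi, integral_fintype_prod_eq_prod
    (f := fun i (y : ℝ) => ((y ^ s i : ℝ) : ℂ))]
  simp only [integral_complex_ofReal]

/-- Gaussian integration by parts for monomials. -/
lemma gaussExp_X_mul_monomial (m : ι → ℝ) (w : ι → ℝ≥0) (i : ι) (s : ι →₀ ℕ) :
    gaussExp m w (X i * monomial s 1)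
      = m i * gaussExp m w (monomial s 1)
        + (w i : ℂ) * gaussExp m w (pderiv i (monomial s 1)) := by
  classical
  have h1 : (X i * monomial s 1 : MvPolynomial ι ℂ) = monomial (Finsupp.single i 1 + s) 1 := by
    rw [X, monomial_mul, one_mul]
  have h2 : pderiv i (monomial s (1 : ℂ)) = (s i : ℂ) • monomial (s - Finsupp.single i 1) 1 := by
    rw [pderiv_monomial, smul_monomial]; simp
  have hsplit : ∀ u : ι →₀ ℕ, gaussExp m w (monomial u 1)
      = ((∫ y, y ^ u i ∂gaussianReal (m i) (w i) : ℝ) : ℂ)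
        * ∏ j ∈ Finset.univ.erase i, ((∫ y, y ^ u j ∂gaussianReal (m j) (w j) : ℝ) : ℂ) := by
    intro u
    rw [gaussExp_monomial, ← Finset.mul_prod_erase _ _ (Finset.mem_univ i)]
  rw [h1, h2, map_smul, hsplit, hsplit, hsplit]
  have e1 : ∀ j ∈ Finset.univ.erase i, (Finsupp.single i 1 + s : ι →₀ ℕ) j = s j := by
    intro j hj
    simp [(Finset.ne_of_mem_erase hj).symm]
  have e2 : ∀ j ∈ Finset.univ.erase i, (s - Finsupp.single i 1 : ι →₀ ℕ) j = s j := by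
    intro j hj
    simp [(Finset.ne_of_mem_erase hj).symm]
  have hpr : ∀ u : ι →₀ ℕ, (∀ j ∈ Finset.univ.erase i, u j = s j) →
      ∏ j ∈ Finset.univ.erase i, ((∫ y, y ^ u j ∂gaussianReal (m j) (w j) : ℝ) : ℂ)
        = ∏ j ∈ Finset.univ.erase i, ((∫ y, y ^ s j ∂gaussianReal (m j) (w j) : ℝ) : ℂ) :=
    fun u hu => Finset.prod_congr rfl fun j hj => by rw [hu j hj]
  rw [hpr _ e1, hpr _ e2]
  have e3 : (Finsupp.single i 1 + s : ι →₀ ℕ) i = s i + 1 := by simp [add_comm]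
  have e4 : (s - Finsupp.single i 1 : ι →₀ ℕ) i = s i - 1 := by simp
  rw [e3, e4, integral_pow_succ_gaussianReal]
  push_cast
  simp only [smul_eq_mul]
  ring

/-- The Laplacian with weights `w`. -/
noncomputable def lap (w : ι → ℂ) : MvPolynomial ι ℂ →ₗ[ℂ] MvPolynomial ι ℂ :=
  ∑ i, w i • ((pderiv i).toLinearMap ∘ₗ (pderiv i).toLinearMap)

lemma lap_apply (w : ι → ℂ) (F : MvPolynomial ι ℂ) :
    lap w F = ∑ i, w i • pderiv i (pderiv i F) := by
  simp [lap]

lemma lap_mul (w : ι → ℂ) (F G : MvPolynomial ι ℂ) :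
    lap w (F * G) = lap w F * G + F * lap w G + 2 * ∑ i, w i • (pderiv i F * pderiv i G) := by
  simp only [lap_apply, Finset.sum_mul, Finset.mul_sum, ← Finset.sum_add_distrib]
  refine Finset.sum_congr rfl fun i _ => ?_
  simp only [Derivation.leibniz, map_add, smul_eq_mul, smul_eq_C_mul]
  ring

lemma lap_X_mul (w : ι → ℂ) (i : ι) (F : MvPolynomial ι ℂ) :
    lap w (X i * F) = X i * lap w F + (2 * w i) • pderiv i F := by
  classical
  have h : lap w (X i : MvPolynomial ι ℂ) = 0 := by
    simp [lap_apply, pderiv_X, Pi.single_apply, apply_ite]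
  rw [lap_mul, h, Finset.sum_eq_single i]
  · simp only [smul_eq_C_mul, pderiv_X_self, zero_mul, zero_add, map_mul, one_mul, map_ofNat]
    ring
  · intro j _ hj
    simp [pderiv_X_of_ne hj.symm]
  · simp

lemma lap_pderiv (w : ι → ℂ) (i : ι) (F : MvPolynomial ι ℂ) :
    lap w (pderiv i F) = pderiv i (lap w F) := by
  have hc : ∀ (j : ι) (G : MvPolynomial ι ℂ), pderiv j (pderiv i G) = pderiv i (pderiv j G) := by
    intro j G
    have : ⁅pderiv (R := ℂ) j, pderiv (R := ℂ) i⁆ = 0 := by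
      classical
      refine derivation_ext fun k => ?_
      simp [Derivation.commutator_apply, pderiv_X, Pi.single_apply, apply_ite]
    have h2 := congrArg (fun D => D G) this
    simpa [Derivation.commutator_apply, sub_eq_zero] using h2
  simp only [lap_apply, map_sum, Derivation.map_smul, hc]

/-- The commutator of `L` with multiplication by `X i` is `2 w_i ∂_i`, which commutes with `L`, so
iterating only multiplies it by the number of factors. In the heat series this is the counterpart of
Gaussian integration by parts. -/
lemma lap_pow_succ_X_mul (w : ι → ℂ) (i : ι) (F : MvPolynomial ι ℂ) (k : ℕ) :
    (lap w ^ (k + 1)) (X i * F)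
      = X i * (lap w ^ (k + 1)) F + (2 * (k + 1) * w i) • (lap w ^ k) (pderiv i F) := by
  have hcomm : ∀ (k : ℕ), pderiv i ((lap w ^ k) F) = (lap w ^ k) (pderiv i F) := by
    intro k
    induction k with
    | zero => simp
    | succ k ih => rw [pow_succ', Module.End.mul_apply, ← lap_pderiv, ih, ← Module.End.mul_apply]
  induction k with
  | zero => simp [lap_X_mul]
  | succ k ih =>
    rw [pow_succ', Module.End.mul_apply, ih, map_add, lap_X_mul, hcomm, map_smul,
      ← Module.End.mul_apply, ← pow_succ', ← Module.End.mul_apply, ← pow_succ', add_assoc,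
      ← add_smul]
    congr 2
    push_cast
    ring

/-- The Gaussian expectation of a polynomial is given by the heat flow. -/
theorem hasSum_gaussExp (m : ι → ℝ) (w : ι → ℝ≥0) (F : MvPolynomial ι ℂ) :
    HasSum (fun k : ℕ => ((1 / 2 : ℂ) ^ k / (k.factorial : ℂ))
      * evalR m ((lap (fun i => (w i : ℂ)) ^ k) F)) (gaussExp m w F) := by
  classical
  set L := lap (fun i => (w i : ℂ)) with hL
  have hlin : ∀ (c : ℂ) (F : MvPolynomial ι ℂ),
      HasSum (fun k : ℕ => ((1 / 2 : ℂ) ^ k / (k.factorial : ℂ)) * evalR m ((L ^ k) F))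
        (gaussExp m w F) →
      HasSum (fun k : ℕ => ((1 / 2 : ℂ) ^ k / (k.factorial : ℂ)) * evalR m ((L ^ k) (c • F)))
        (gaussExp m w (c • F)) := by
    intro c F h
    have := h.mul_left c
    rw [map_smul, smul_eq_mul]
    refine this.congr_fun fun k => ?_
    rw [map_smul]
    simp only [evalR, smul_eval]
    ring
  have hmon : ∀ (d : ℕ) (s : ι →₀ ℕ), s.degree = d →
      HasSum (fun k : ℕ => ((1 / 2 : ℂ) ^ k / (k.factorial : ℂ)) * evalR m ((L ^ k) (monomial s 1)))
        (gaussExp m w (monomial s 1)) := by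
    intro d
    induction d using Nat.strong_induction_on with
    | _ d ih =>
      intro s hs
      by_cases h0 : s = 0
      · subst h0
        have h1 : (monomial 0 1 : MvPolynomial ι ℂ) = 1 := rfl
        have hL1 : L 1 = 0 := by
          rw [hL, lap_apply]; simp
        have : gaussExp m w (monomial 0 1) = 1 := by rw [gaussExp_monomial]; simp
        rw [this, h1]
        convert hasSum_single (0 : ℕ) ?_ using 1
        · simp [evalR]
        · intro k hk
          obtain ⟨k, rfl⟩ := Nat.exists_eq_succ_of_ne_zero hk
          rw [Nat.succ_eq_add_one, pow_succ L, Module.End.mul_apply, hL1]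
          simp [evalR]
      · obtain ⟨i, hi⟩ : ∃ i, s i ≠ 0 := by
          by_contra! h
          exact h0 (Finsupp.ext h)
        set s' := s - Finsupp.single i 1 with hs'
        have hss : Finsupp.single i 1 + s' = s := by
          rw [hs', add_comm]
          exact tsub_add_cancel_of_le (by
            rw [Finsupp.single_le_iff]; exact Nat.one_le_iff_ne_zero.2 hi)
        have hdeg : s'.degree + 1 = d := by
          rw [← hs, ← hss]; simp [add_comm]
        have hmul : (monomial s 1 : MvPolynomial ι ℂ) = X i * monomial s' 1 := by
          rw [X, monomial_mul, one_mul, hss]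
        have hpd : pderiv i (monomial s' (1 : ℂ))
            = (s' i : ℂ) • monomial (s' - Finsupp.single i 1) 1 := by
          rw [pderiv_monomial, smul_monomial]; simp
        have A1 := ih s'.degree (by omega) s' rfl
        have A2 : HasSum (fun k : ℕ => ((1 / 2 : ℂ) ^ k / (k.factorial : ℂ))
            * evalR m ((L ^ k) (pderiv i (monomial s' 1))))
            (gaussExp m w (pderiv i (monomial s' 1))) := by
          rw [hpd]
          refine hlin _ _ (ih _ ?_ _ rfl)
          have : (s' - Finsupp.single i 1).degree ≤ s'.degree :=
            Finsupp.degree_mono tsub_le_self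
          omega
        rw [hmul, gaussExp_X_mul_monomial]
        have B1 := A1.mul_left (m i : ℂ)
        have B2 := A2.mul_left (w i : ℂ)
        -- Removing the zeroth term aligns index `k + 1` of the series for `X i * F` with index `k`
        -- of the series for the derivative: the factor `2 (k + 1)` absorbs the change of `(1/2)^k /
        -- k!`.
        rw [← hasSum_nat_add_iff' 1] at B1 ⊢
        have B3 := B1.add B2
        convert B3 using 1
        · funext k
          rw [hL, lap_pow_succ_X_mul]
          simp only [evalR, map_add, map_mul, eval_X, smul_eval]
          rw [pow_succ, Nat.factorial_succ]
          have hk : (k.factorial : ℂ) ≠ 0 := by exact_mod_cast k.factorial_ne_zero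
          have hk' : (k + 1 : ℂ) ≠ 0 := by exact_mod_cast k.succ_ne_zero
          push_cast
          field_simp
        · simp [evalR]
          ring
  induction F using MvPolynomial.induction_on' with
  | monomial s c =>
    have : (monomial s c : MvPolynomial ι ℂ) = c • monomial s 1 := by simp [smul_monomial]
    rw [this]
    exact hlin c _ (hmon _ s rfl)
  | add p q hp hq =>
    rw [map_add]
    convert hp.add hq using 2 with k
    simp only [map_add, evalR, mul_add]

end Heat

/-! ### The radial part of the Laplacian, on polynomials -/

section Radial

open MvPolynomial Matrix

/-- A chain rule that only has to be checked on the variables. It transports the carré du champ to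
polynomials in abstract power sums. -/
lemma derivation_aeval {σ B : Type*} [CommRing B] [Algebra ℂ B] (f : MvPolynomial σ ℂ →ₐ[ℂ] B)
    (d : Derivation ℂ B B) (D : Derivation ℂ (MvPolynomial σ ℂ) (MvPolynomial σ ℂ))
    (h : ∀ l, d (f (X l)) = f (D (X l))) (q : MvPolynomial σ ℂ) : d (f q) = f (D q) := by
  induction q using MvPolynomial.induction_on with
  | C a =>
    have : f (C a) = algebraMap ℂ B a := f.commutes a
    have h2 : (C a : MvPolynomial σ ℂ) = algebraMap ℂ _ a := rfl
    rw [this, Derivation.map_algebraMap, h2, Derivation.map_algebraMap, map_zero]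
  | add p q hp hq => simp [hp, hq]
  | mul_X p i hp => simp [hp, h]

lemma derivation_sum_apply {κ B : Type*} [CommRing B] [Algebra ℂ B] (s : Finset κ)
    (d : κ → Derivation ℂ B B) (x : B) : (∑ k ∈ s, d k) x = ∑ k ∈ s, d k x := by
  classical
  induction s using Finset.induction_on with
  | empty => simp
  | insert k s hk ih => rw [Finset.sum_insert hk, Finset.sum_insert hk, Derivation.add_apply, ih]

/-- The Vandermonde determinant in the variables `X i`. -/
noncomputable def vand (n : ℕ) : MvPolynomial (Fin n) ℂ :=
  (vandermonde (fun i => (X i : MvPolynomial (Fin n) ℂ))).det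

lemma pderiv_prod_X_pow {n : ℕ} (i : Fin n) (u : Fin n → ℕ) :
    pderiv i (∏ j, (X j : MvPolynomial (Fin n) ℂ) ^ u j)
      = (u i : ℂ) • ∏ j, X j ^ (Function.update u i (u i - 1) j) := by
  have h1 : ∀ v : Fin n → ℕ, ∏ j, (X j : MvPolynomial (Fin n) ℂ) ^ v j
      = monomial (Finsupp.equivFunOnFinite.symm v) 1 := by
    intro v
    rw [monomial_eq, Finsupp.prod_fintype _ _ (by simp)]
    simp
  have hu : Finsupp.equivFunOnFinite.symm u - Finsupp.single i 1
      = Finsupp.equivFunOnFinite.symm (Function.update u i (u i - 1)) := by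
    ext j
    by_cases h : j = i
    · subst h; simp
    · simp [h]
  rw [h1, h1, pderiv_monomial, smul_monomial, hu]
  simp

/-- Differentiating column `k` twice lowers its exponent to `k - 2`. For `k ≥ 2` the determinant
then has two equal columns, and for `k < 2` the coefficient `k (k - 1)` vanishes. -/
lemma lap_vand (n : ℕ) (c : ℂ) : lap (fun _ => c) (vand n) = 0 := by
  have hterm : ∀ σ : Equiv.Perm (Fin n),
      lap (fun _ => c) (∏ k : Fin n, (X (σ k) : MvPolynomial (Fin n) ℂ) ^ (k : ℕ))
        = ∑ k : Fin n, (c * ((k : ℕ) * ((k : ℕ) - 1 : ℕ) : ℕ)) • ∏ l : Fin n,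
          (X (σ l) : MvPolynomial (Fin n) ℂ)
            ^ (Function.update (fun l : Fin n => (l : ℕ)) k ((k : ℕ) - 2) l) := by
    intro σ
    have hre : ∀ u : Fin n → ℕ, ∏ k : Fin n, (X (σ k) : MvPolynomial (Fin n) ℂ) ^ u k
        = ∏ j, X j ^ u (σ.symm j) := fun u => by
      rw [← Equiv.prod_comp σ (fun j => (X j : MvPolynomial (Fin n) ℂ) ^ u (σ.symm j))]
      simp
    rw [hre (fun k => (k : ℕ)), lap_apply, ← Equiv.sum_comp σ]
    refine Finset.sum_congr rfl fun k _ => ?_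
    rw [pderiv_prod_X_pow, Derivation.map_smul, pderiv_prod_X_pow, smul_smul, smul_smul, hre]
    simp only [Equiv.symm_apply_apply, Function.update_self, Function.update_idem]
    congr 1
    · push_cast; ring
    · refine Finset.prod_congr rfl fun j _ => ?_
      congr 1
      by_cases h : j = σ k
      · subst h; simp [Nat.sub_sub]
      · have : σ.symm j ≠ k := fun h' => h (by rw [← h']; simp)
        rw [Function.update_of_ne h, Function.update_of_ne this]
  have hdet : vand n = ∑ σ : Equiv.Perm (Fin n), (Equiv.Perm.sign σ : ℤ) •
      ∏ k : Fin n, (X (σ k) : MvPolynomial (Fin n) ℂ) ^ (k : ℕ) := by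
    rw [vand, det_apply]
    simp [vandermonde_apply, Units.smul_def]
  rw [hdet, map_sum]
  simp only [map_zsmul, hterm, Finset.smul_sum]
  rw [Finset.sum_comm]
  refine Finset.sum_eq_zero fun k _ => ?_
  have hcol : ∑ σ : Equiv.Perm (Fin n), (Equiv.Perm.sign σ : ℤ) • ∏ l : Fin n,
      (X (σ l) : MvPolynomial (Fin n) ℂ)
        ^ (Function.update (fun l : Fin n => (l : ℕ)) k ((k : ℕ) - 2) l)
      = (Matrix.of fun i l : Fin n => (X i : MvPolynomial (Fin n) ℂ)
        ^ (Function.update (fun l : Fin n => (l : ℕ)) k ((k : ℕ) - 2) l)).det := by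
    rw [det_apply]
    simp [Units.smul_def]
  simp_rw [smul_comm _ (c * _)]
  rw [← Finset.smul_sum, hcol]
  by_cases hk : 2 ≤ (k : ℕ)
  · have hne : k ≠ ⟨k - 2, by omega⟩ := by
      intro h
      have := congrArg Fin.val h
      simp at this
      omega
    rw [det_zero_of_column_eq hne, smul_zero]
    intro i
    simp [Function.update_of_ne hne.symm]
  · have : (k : ℕ) * ((k : ℕ) - 1) = 0 := by
      interval_cases (k : ℕ) <;> simp
    rw [this]; simp

/-- The complete homogeneous polynomial of degree `k` in `x, y`, shifted by one:
`(x ^ k - y ^ k) / (x - y)`. -/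
def homog {B : Type*} [CommRing B] (k : ℕ) (x y : B) : B :=
  ∑ a ∈ Finset.range k, x ^ a * y ^ (k - 1 - a)

/-- Logarithmic differentiation: the vector field `∑ X_i^k ∂_i` multiplies the factor `X_j - X_i` by
the divided difference of the `k`-th powers. -/
lemma derivation_vand (n k : ℕ) :
    ∑ i, X i ^ k * pderiv i (vand n)
      = vand n * ∑ i : Fin n, ∑ j ∈ Finset.Ioi i, homog k (X j) (X i) := by
  set d : Derivation ℂ (MvPolynomial (Fin n) ℂ) (MvPolynomial (Fin n) ℂ) :=
    ∑ i, (X i ^ k : MvPolynomial (Fin n) ℂ) • pderiv i with hd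
  have hdX : ∀ j, d (X j) = X j ^ k := by
    intro j
    rw [hd, derivation_sum_apply, Finset.sum_eq_single j]
    · simp
    · intro i _ hij
      simp [pderiv_X_of_ne hij.symm]
    · simp
  have hprod : ∀ {κ : Type} (s : Finset κ) (f g : κ → MvPolynomial (Fin n) ℂ),
      (∀ e ∈ s, d (f e) = f e * g e) → d (∏ e ∈ s, f e) = (∏ e ∈ s, f e) * ∑ e ∈ s, g e := by
    classical
    intro κ s f g
    induction s using Finset.induction_on with
    | empty => simp
    | insert e s he ih =>
      intro h
      rw [Finset.prod_insert he, Finset.sum_insert he, Derivation.leibniz,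
        ih fun x hx => h x (Finset.mem_insert_of_mem hx), h e (Finset.mem_insert_self e s)]
      simp only [smul_eq_mul]
      ring
  have h1 : ∑ i, X i ^ k * pderiv i (vand n) = d (vand n) := by
    rw [hd, derivation_sum_apply]; rfl
  rw [h1, vand, det_vandermonde]
  refine hprod _ _ _ fun i _ => hprod _ _ _ fun j _ => ?_
  rw [map_sub, hdX, hdX, homog, mul_comm, (Commute.all _ _).geom_sum₂_mul]

lemma lap_psum (n k : ℕ) (c : ℂ) :
    lap (fun _ => c) (psum (Fin n) ℂ k) = (c * (k * (k - 1 : ℕ))) • psum (Fin n) ℂ (k - 2) := by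
  have h : ∀ i j : Fin n, pderiv i (pderiv i ((X j : MvPolynomial (Fin n) ℂ) ^ k))
      = if i = j then ((k * (k - 1 : ℕ) : ℂ)) • X j ^ (k - 2) else 0 := by
    intro i j
    by_cases h : i = j
    · subst h
      simp only [Derivation.leibniz_pow, pderiv_X_self, if_true, smul_eq_mul, mul_one,
        map_nsmul, Nat.sub_sub]
      rw [smul_smul, ← Nat.cast_mul, Nat.cast_smul_eq_nsmul]
    · simp [Derivation.leibniz_pow, pderiv_X_of_ne (Ne.symm h), h]
  rw [lap_apply, psum, psum, Finset.smul_sum]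
  simp only [map_sum, h, Finset.sum_ite_eq, Finset.mem_univ, if_true, smul_smul]

lemma pderiv_psum (n k : ℕ) (i : Fin n) :
    pderiv i (psum (Fin n) ℂ k) = (k : ℂ) • X i ^ (k - 1) := by
  rw [psum, map_sum, Finset.sum_eq_single i]
  · simp [Derivation.leibniz_pow, Nat.cast_smul_eq_nsmul]
  · intro j _ hj
    simp [Derivation.leibniz_pow, pderiv_X_of_ne hj]
  · simp

/-- The double sum of `homog` over all ordered pairs factors into products of power sums. It splits
into the diagonal and two off-diagonal halves that are equal by symmetry. -/
lemma sum_homog_add (n k : ℕ) :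
    (k : ℂ) • psum (Fin n) ℂ (k - 1)
        + 2 * ∑ i : Fin n, ∑ j ∈ Finset.Ioi i, homog k (X j : MvPolynomial (Fin n) ℂ) (X i)
      = ∑ a ∈ Finset.range k, psum (Fin n) ℂ a * psum (Fin n) ℂ (k - 1 - a) := by
  have hsymm : ∀ x y : MvPolynomial (Fin n) ℂ, homog k x y = homog k y x := by
    intro x y
    unfold homog
    rw [← Finset.sum_range_reflect]
    refine Finset.sum_congr rfl fun a ha => ?_
    rw [Finset.mem_range] at ha
    rw [show k - 1 - (k - 1 - a) = a by omega, mul_comm]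
  have hdiag : ∀ i : Fin n, homog k (X i : MvPolynomial (Fin n) ℂ) (X i)
      = (k : ℂ) • X i ^ (k - 1) := by
    intro i
    unfold homog
    rw [Finset.sum_congr rfl (g := fun _ => (X i : MvPolynomial (Fin n) ℂ) ^ (k - 1))]
    · simp [smul_eq_C_mul]
    · intro a ha
      rw [Finset.mem_range] at ha
      rw [← pow_add]; congr 1; omega
  have hR : ∑ a ∈ Finset.range k, psum (Fin n) ℂ a * psum (Fin n) ℂ (k - 1 - a)
      = ∑ i, ∑ j, homog k (X j : MvPolynomial (Fin n) ℂ) (X i) := by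
    unfold homog
    rw [Finset.sum_comm' (t' := Finset.univ) (s' := fun _ => Finset.univ) (by simp)]
    simp_rw [Finset.sum_comm (t := Finset.range k)]
    refine Finset.sum_congr rfl fun a _ => ?_
    rw [psum, psum, Finset.sum_mul_sum]
  have hsplit : ∀ i : Fin n, ∑ j, homog k (X j : MvPolynomial (Fin n) ℂ) (X i)
      = ∑ j ∈ Finset.Ioi i, homog k (X j : MvPolynomial (Fin n) ℂ) (X i)
        + (k : ℂ) • X i ^ (k - 1)
        + ∑ j ∈ Finset.Iio i, homog k (X j : MvPolynomial (Fin n) ℂ) (X i) := by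
    intro i
    have h1 : (Finset.univ : Finset (Fin n))
        = Finset.Ioi i ∪ ({i} ∪ Finset.Iio i) := by
      ext j
      simp only [Finset.mem_univ, Finset.mem_union, Finset.mem_Ioi, Finset.mem_singleton,
        Finset.mem_Iio, true_iff]
      rcases lt_trichotomy i j with h | h | h
      · exact Or.inl h
      · exact Or.inr (Or.inl h.symm)
      · exact Or.inr (Or.inr h)
    rw [h1, Finset.sum_union, Finset.sum_union, Finset.sum_singleton, hdiag, add_assoc]
    · simp
    · rw [Finset.disjoint_left]
      intro j hj
      have := Finset.mem_Ioi.1 hj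
      simp only [Finset.mem_union, Finset.mem_singleton, Finset.mem_Iio, not_or]
      exact ⟨this.ne', this.not_gt⟩
  have hswap : ∑ i : Fin n, ∑ j ∈ Finset.Iio i, homog k (X j : MvPolynomial (Fin n) ℂ) (X i)
      = ∑ i : Fin n, ∑ j ∈ Finset.Ioi i, homog k (X j : MvPolynomial (Fin n) ℂ) (X i) := by
    rw [Finset.sum_comm' (t' := Finset.univ) (s' := fun j => Finset.Ioi j) (by simp)]
    exact Finset.sum_congr rfl fun i _ => Finset.sum_congr rfl fun j _ => hsymm _ _
  rw [hR]
  simp_rw [hsplit]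
  rw [Finset.sum_add_distrib, Finset.sum_add_distrib, hswap, psum, Finset.smul_sum]
  ring

/-- `Δ⁻¹ L Δ` applied to a power sum. -/
lemma lap_vand_mul_psum (n k : ℕ) (c : ℂ) :
    lap (fun _ => c) (vand n * psum (Fin n) ℂ k) = vand n *
      ((c * k) • ∑ a ∈ Finset.range (k - 1), psum (Fin n) ℂ a * psum (Fin n) ℂ (k - 2 - a)) := by
  have h1 : ∑ i, c • (pderiv i (vand n) * pderiv i (psum (Fin n) ℂ k))
      = (c * k) • ∑ i, X i ^ (k - 1) * pderiv i (vand n) := by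
    rw [Finset.smul_sum]
    refine Finset.sum_congr rfl fun i _ => ?_
    rw [pderiv_psum]
    simp only [smul_eq_C_mul, map_mul]
    ring
  rw [lap_mul, lap_vand, lap_psum, h1, derivation_vand]
  -- The Laplacian of the power sum supplies exactly the diagonal terms missing from the sum over `i
  -- < j`.
  have h2 := sum_homog_add n (k - 1)
  rw [show k - 1 - 1 = k - 2 by omega] at h2
  rw [← h2]
  simp only [smul_eq_C_mul, map_mul]
  ring

end Radial

/-! ### The Laplacian on invariant polynomials of a Hermitian matrix -/

section MatrixRadial

open MvPolynomial Matrix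

/-- The derivative of `hermitianOfCoords` in the direction of the coordinate `α`. -/
noncomputable def hermDir {n : ℕ} (α : Fin n × Fin n) : Matrix (Fin n) (Fin n) ℂ :=
  Matrix.of fun i j =>
    if i = j then (if α = (i, i) then 1 else 0)
    else if i < j then (if α = (i, j) then 1 else 0) + (if α = (j, i) then Complex.I else 0)
    else (if α = (j, i) then 1 else 0) - (if α = (i, j) then Complex.I else 0)

/-- The generic Hermitian matrix. -/
noncomputable def genHerm (n : ℕ) :
    Matrix (Fin n) (Fin n) (MvPolynomial (Fin n × Fin n) ℂ) :=
  Matrix.of fun i j =>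
    if i = j then X (i, i)
    else if i < j then X (i, j) + C Complex.I * X (j, i)
    else X (j, i) - C Complex.I * X (i, j)

/-- The variances of the coordinates of a GUE matrix, up to the factor `c`. -/
noncomputable def hermWeight {n : ℕ} (c : ℂ) (α : Fin n × Fin n) : ℂ :=
  if α.1 = α.2 then c else c / 2

lemma sum_mul_hermDir {n : ℕ} (f : Fin n × Fin n → ℂ) (i j : Fin n) :
    ∑ α, f α * hermDir α i j =
      if i = j then f (i, i) else if i < j then f (i, j) + f (j, i) * Complex.I
        else f (j, i) - f (i, j) * Complex.I := by
  unfold hermDir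
  simp only [of_apply]
  split_ifs with h1 h2
  · simp
  · simp [mul_add, Finset.sum_add_distrib]
  · simp [mul_sub, Finset.sum_sub_distrib]

/-- The GUE covariance: real and imaginary parts of an off-diagonal entry have equal weight, so an
entry is correlated only with its transpose. All the trace identities below rest on this. -/
lemma sum_hermWeight {n : ℕ} (c : ℂ) (i j k l : Fin n) :
    ∑ α, hermWeight c α * hermDir α k l * hermDir α i j = if i = l ∧ j = k then c else 0 := by
  rw [sum_mul_hermDir]
  have hI : Complex.I * Complex.I = -1 := Complex.I_mul_I
  by_cases hij : i = j
  · subst hij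
    rw [if_pos rfl]
    simp only [hermWeight, hermDir, of_apply, Prod.mk.injEq, if_true]
    by_cases hkl : k = l
    · subst hkl; by_cases h : i = k <;> simp [h]
    · have : ¬ (i = l ∧ i = k) := fun h => hkl (h.2.symm.trans h.1)
      have h2 : ¬ (i = k ∧ i = l) := fun h => hkl (h.1.symm.trans h.2)
      simp [hkl, this, h2]
  · have hji : ¬ j = i := fun h => hij h.symm
    simp only [hij, if_false, hermWeight, hji, hermDir, of_apply, Prod.mk.injEq]
    by_cases hkl : k = l
    · subst hkl
      have h1 : ¬ (i = k ∧ j = k) := fun h => hij (h.1.trans h.2.symm)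
      have h2 : ¬ (j = k ∧ i = k) := fun h => hij (h.2.trans h.1.symm)
      simp [h1, h2]
    · simp only [hkl, if_false]
      by_cases h1 : i = k ∧ j = l
      · obtain ⟨rfl, rfl⟩ := h1
        have h3 : ¬ (i = j ∧ j = i) := fun h => hij h.1
        have h4 : ¬ (j = i ∧ i = j) := fun h => hij h.2
        rcases lt_or_gt_of_ne hij with h | h
        · simp [h, h3, h4]
          linear_combination (c / 2) * hI
        · simp [h.not_gt, h3, h4]
          linear_combination (c / 2) * hI
      · by_cases h2 : i = l ∧ j = k
        · obtain ⟨rfl, rfl⟩ := h2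
          have h3 : ¬ (i = j ∧ j = i) := fun h => hij h.1
          have h4 : ¬ (j = i ∧ i = j) := fun h => hij h.2
          rcases lt_or_gt_of_ne hij with h | h
          · simp [h, h.not_gt, h3, h4]
            linear_combination (-c / 2) * hI
          · simp [h, h.not_gt, h3, h4]
            linear_combination (-c / 2) * hI
        · have h3 : ¬ (j = k ∧ i = l) := fun h => h2 h.symm
          have h4 : ¬ (j = l ∧ i = k) := fun h => h1 h.symm
          simp [h1, h2, h3, h4]

lemma pderiv_genHerm {n : ℕ} (α : Fin n × Fin n) (i j : Fin n) :
    pderiv α (genHerm n i j) = C (hermDir α i j) := by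
  unfold genHerm hermDir
  simp only [of_apply]
  split_ifs with h1 h2 <;>
    simp_all [pderiv_X, eq_comm]

variable {n : ℕ}

/-- Constant matrices as polynomial matrices. -/
noncomputable def hermDirC (α : Fin n × Fin n) : Matrix (Fin n) (Fin n) (MvPolynomial (Fin n × Fin n) ℂ) := (hermDir α).map C

lemma map_derivation_mul {B : Type*} [CommRing B] [Algebra ℂ B] 
    (d : Derivation ℂ B B) (M N : Matrix (Fin n) (Fin n) B) :
    (M * N).map d = M.map d * N + M * N.map d := by
  ext1 i j
  simp only [map_apply, mul_apply, Matrix.add_apply, map_sum, Derivation.leibniz, smul_eq_mul,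
    ← Finset.sum_add_distrib]
  exact Finset.sum_congr rfl fun _ _ => by ring

lemma map_derivation_pow {B : Type*} [CommRing B] [Algebra ℂ B] 
    (d : Derivation ℂ B B) (M : Matrix (Fin n) (Fin n) B) (k : ℕ) :
    (M ^ k).map d = ∑ a ∈ Finset.range k, M ^ a * M.map d * M ^ (k - 1 - a) := by
  induction k with
  | zero =>
    ext1 i j
    by_cases h : i = j <;> simp [one_apply, h]
  | succ k ih =>
    rw [pow_succ, map_derivation_mul, ih, Finset.sum_range_succ, Finset.sum_mul]
    have e : ∀ a ∈ Finset.range k, M ^ a * M.map d * M ^ (k - 1 - a) * M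
        = M ^ a * M.map d * M ^ (k + 1 - 1 - a) := by
      intro a ha
      rw [Finset.mem_range] at ha
      rw [mul_assoc, ← pow_succ, show k - 1 - a + 1 = k + 1 - 1 - a by omega]
    rw [Finset.sum_congr rfl e, show k + 1 - 1 - k = 0 by omega, pow_zero, mul_one]

lemma derivation_trace {B : Type*} [CommRing B] [Algebra ℂ B] 
    (d : Derivation ℂ B B) (M : Matrix (Fin n) (Fin n) B) :
    d M.trace = (M.map d).trace := by
  simp [trace, map_sum]

lemma derivation_trace_pow {B : Type*} [CommRing B] [Algebra ℂ B] 
    (d : Derivation ℂ B B) (M : Matrix (Fin n) (Fin n) B) (k : ℕ) :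
    d (M ^ k).trace = (k : ℂ) • (M ^ (k - 1) * M.map d).trace := by
  rw [derivation_trace, map_derivation_pow, trace_sum,
    Finset.sum_congr rfl (g := fun _ => (M ^ (k - 1) * M.map d).trace)]
  · simp [Nat.cast_smul_eq_nsmul]
  · intro a ha
    rw [Finset.mem_range] at ha
    rw [trace_mul_comm, ← mul_assoc, ← pow_add]
    rw [show k - 1 - a + a = k - 1 by omega]

lemma genHerm_map_pderiv (α : Fin n × Fin n) :
    (genHerm n).map (pderiv α) = hermDirC α := by
  ext1 i j
  simp [pderiv_genHerm, hermDirC]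

lemma sum_hermDirC (c : ℂ) (i j k l : Fin n) :
    ∑ α, hermWeight c α • (hermDirC α k l * hermDirC α i j : MvPolynomial (Fin n × Fin n) ℂ)
      = if i = l ∧ j = k then C c else 0 := by
  have h := congrArg (C (σ := Fin n × Fin n)) (sum_hermWeight c i j k l)
  rw [map_sum] at h
  simp only [map_mul] at h
  rw [apply_ite C, map_zero] at h
  rw [← h]
  refine Finset.sum_congr rfl fun α _ => ?_
  simp only [hermDirC, map_apply, smul_eq_C_mul]
  ring

/-- Contracting the two directions with the GUE covariance glues the two traces into one. -/
lemma sum_trace_mul_trace (c : ℂ) (M N : Matrix (Fin n) (Fin n) (MvPolynomial (Fin n × Fin n) ℂ)) :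
    ∑ α, hermWeight c α • ((M * hermDirC α).trace * (N * hermDirC α).trace)
      = c • (M * N).trace := by
  have h1 : ∀ α, hermWeight c α • ((M * hermDirC α).trace * (N * hermDirC α).trace)
      = ∑ i, ∑ j, ∑ k, ∑ l, M i j * N k l *
        hermWeight c α • (hermDirC α j i * hermDirC α l k) := by
    intro α
    simp only [trace, diag_apply, mul_apply, Finset.sum_mul_sum, Finset.smul_sum]
    refine Finset.sum_congr rfl fun i _ => ?_
    rw [Finset.sum_comm]
    refine Finset.sum_congr rfl fun j _ => Finset.sum_congr rfl fun k _ =>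
      Finset.sum_congr rfl fun l _ => ?_
    simp only [smul_eq_C_mul]
    ring
  simp_rw [h1]
  rw [Finset.sum_comm]
  simp_rw [Finset.sum_comm (s := (Finset.univ : Finset (Fin n × Fin n))), ← Finset.mul_sum,
    sum_hermDirC]
  simp only [trace, diag_apply, mul_apply, Finset.smul_sum]
  refine Finset.sum_congr rfl fun i _ => Finset.sum_congr rfl fun j _ => ?_
  rw [Finset.sum_eq_single j, Finset.sum_eq_single i]
  · simp [smul_eq_C_mul, mul_comm]
  · intro l _ hl; simp [hl]
  · simp
  · intro k _ hk
    exact Finset.sum_eq_zero fun l _ => by simp [hk]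
  · simp

/-- Contracting two directions inside a single trace cuts it into two. -/
lemma sum_trace_mul_mul_mul (c : ℂ) (M N : Matrix (Fin n) (Fin n) (MvPolynomial (Fin n × Fin n) ℂ)) :
    ∑ α, hermWeight c α • (M * hermDirC α * N * hermDirC α).trace
      = c • (M.trace * N.trace) := by
  have h1 : ∀ α, hermWeight c α • (M * hermDirC α * N * hermDirC α).trace
      = ∑ i, ∑ l, ∑ k, ∑ j, M i j * N k l *
        hermWeight c α • (hermDirC α j k * hermDirC α l i) := by
    intro α
    simp only [trace, diag_apply, mul_apply, Finset.sum_mul, Finset.smul_sum]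
    refine Finset.sum_congr rfl fun i _ => Finset.sum_congr rfl fun l _ =>
      Finset.sum_congr rfl fun k _ => Finset.sum_congr rfl fun j _ => ?_
    simp only [smul_eq_C_mul]
    ring
  simp_rw [h1]
  rw [Finset.sum_comm]
  simp_rw [Finset.sum_comm (s := (Finset.univ : Finset (Fin n × Fin n))), ← Finset.mul_sum,
    sum_hermDirC]
  simp only [trace, diag_apply, Finset.sum_mul_sum, Finset.smul_sum]
  refine Finset.sum_congr rfl fun i _ => Finset.sum_congr rfl fun l _ => ?_
  rw [Finset.sum_eq_single l, Finset.sum_eq_single i]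
  · simp [smul_eq_C_mul, mul_comm]
  · intro j _ hj; simp [hj.symm]
  · simp
  · intro k _ hk
    exact Finset.sum_eq_zero fun j _ => by simp [hk.symm]
  · simp

/-- The algebra map from abstract power sums to traces of powers of the generic matrix. -/
noncomputable def traceHom (n : ℕ) : MvPolynomial ℕ ℂ →ₐ[ℂ] MvPolynomial (Fin n × Fin n) ℂ :=
  aeval fun k => (genHerm n ^ k).trace

/-- The algebra map from abstract power sums to power sums. -/
noncomputable def psumHom (n : ℕ) : MvPolynomial ℕ ℂ →ₐ[ℂ] MvPolynomial (Fin n) ℂ :=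
  aeval fun k => psum (Fin n) ℂ k

/-- By cyclicity the first derivative is `k tr (H^(k-1) D)`; differentiating the power again and
contracting cuts the trace. The result has the same shape as in `lap_vand_mul_psum`. -/
lemma lap_trace_pow (c : ℂ) (k : ℕ) :
    lap (hermWeight c) (genHerm n ^ k).trace
      = (c * k) • ∑ a ∈ Finset.range (k - 1),
        (genHerm n ^ a).trace * (genHerm n ^ (k - 2 - a)).trace := by
  have h : ∀ α, pderiv α (pderiv α (genHerm n ^ k).trace)
      = (k : ℂ) • ∑ a ∈ Finset.range (k - 1),
        (genHerm n ^ a * hermDirC α * genHerm n ^ (k - 2 - a) * hermDirC α).trace := by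
    intro α
    have h0 : (hermDirC α : Matrix (Fin n) (Fin n) (MvPolynomial (Fin n × Fin n) ℂ)).map (pderiv α) = 0 := by
      ext1 i j; simp [hermDirC]
    rw [derivation_trace_pow, Derivation.map_smul, genHerm_map_pderiv, derivation_trace,
      map_derivation_mul, h0, mul_zero, add_zero, map_derivation_pow, genHerm_map_pderiv,
      Finset.sum_mul, trace_sum]
    simp only [Nat.sub_sub]
  rw [lap_apply]
  simp_rw [h, Finset.smul_sum]
  rw [Finset.sum_comm]
  refine Finset.sum_congr rfl fun a _ => ?_
  simp_rw [smul_comm _ (k : ℂ)]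
  rw [← Finset.smul_sum, sum_trace_mul_mul_mul, smul_smul, mul_comm (k : ℂ)]

/-- The carré du champ with a power sum, on abstract power sums. -/
noncomputable def gammaDer (c : ℂ) (k : ℕ) :
    Derivation ℂ (MvPolynomial ℕ ℂ) (MvPolynomial ℕ ℂ) :=
  mkDerivation ℂ fun l => (c * k * l) • X (k - 1 + (l - 1))

/-- Both sides are derivations in `q`, so variables suffice, and there the traces glue to one of
exponent `k + l - 2`. The truncated exponent is harmless: the coefficient `k * l` is zero when `k`
or `l` is. -/
lemma sum_pderiv_traceHom (c : ℂ) (k : ℕ) (q : MvPolynomial ℕ ℂ) :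
    ∑ α, hermWeight c α • (pderiv α (genHerm n ^ k).trace * pderiv α (traceHom n q))
      = traceHom n (gammaDer c k q) := by
  have h := derivation_aeval (traceHom n)
    (∑ α, (hermWeight c α • pderiv α (genHerm n ^ k).trace) • pderiv α) (gammaDer c k) ?_ q
  · rw [← h, derivation_sum_apply]
    refine Finset.sum_congr rfl fun α _ => ?_
    simp
  · intro l
    rw [derivation_sum_apply, gammaDer, mkDerivation_X, map_smul]
    simp only [traceHom, aeval_X, Derivation.smul_apply]
    simp only [derivation_trace_pow, genHerm_map_pderiv]
    have := sum_trace_mul_trace c (genHerm n ^ (k - 1)) (genHerm n ^ (l - 1))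
    rw [pow_add, show c * k * l = (k * l) * c by ring, ← smul_smul, ← this, Finset.smul_sum]
    refine Finset.sum_congr rfl fun α _ => ?_
    simp only [smul_eq_mul, smul_eq_C_mul, map_mul]
    ring

lemma sum_pderiv_psumHom (c : ℂ) (k : ℕ) (q : MvPolynomial ℕ ℂ) :
    ∑ i, c • (pderiv i (psum (Fin n) ℂ k) * pderiv i (psumHom n q))
      = psumHom n (gammaDer c k q) := by
  have h := derivation_aeval (psumHom n)
    (∑ i, (c • pderiv i (psum (Fin n) ℂ k)) • pderiv i) (gammaDer c k) ?_ q
  · rw [← h, derivation_sum_apply]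
    refine Finset.sum_congr rfl fun i _ => ?_
    simp
  · intro l
    rw [derivation_sum_apply, gammaDer, mkDerivation_X, map_smul]
    simp only [psumHom, aeval_X, Derivation.smul_apply]
    simp only [pderiv_psum]
    rw [psum, Finset.smul_sum]
    refine Finset.sum_congr rfl fun i _ => ?_
    simp only [smul_eq_mul, smul_eq_C_mul, map_mul, pow_add]
    ring

/-- The Laplacian on invariant polynomials of a Hermitian matrix is `Δ⁻¹ L Δ` on the
corresponding symmetric polynomials. -/
theorem exists_radial (n : ℕ) (c : ℂ) (q : MvPolynomial ℕ ℂ) :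
    ∃ q' : MvPolynomial ℕ ℂ,
      lap (hermWeight c) (traceHom n q) = traceHom n q' ∧
      lap (fun _ => c) (vand n * psumHom n q) = vand n * psumHom n q' := by
  induction q using MvPolynomial.induction_on with
  | C a =>
    refine ⟨0, ?_, ?_⟩
    · have : traceHom n (C a) = C a := (traceHom n).commutes a
      rw [this, lap_apply]; simp
    · have : psumHom n (C a) = C a := (psumHom n).commutes a
      rw [this, mul_comm, ← smul_eq_C_mul, map_smul, lap_vand]; simp
  | add p q hp hq =>
    obtain ⟨p', hp1, hp2⟩ := hp
    obtain ⟨q', hq1, hq2⟩ := hq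
    exact ⟨p' + q', by simp [hp1, hq1], by simp [mul_add, hp2, hq2]⟩
  | mul_X p k hp =>
    obtain ⟨p', hp1, hp2⟩ := hp
    -- The product rule for second-order operators, written in abstract power sums. One common
    -- witness serves both sides, so the algebraic relations among power sums never matter.
    refine ⟨p' * X k + p * ((c * k) • ∑ a ∈ Finset.range (k - 1), X a * X (k - 2 - a))
      + 2 * gammaDer c k p, ?_, ?_⟩
    · have hX : ∀ l, traceHom n (X l) = (genHerm n ^ l).trace := fun l => by simp [traceHom]
      rw [map_mul, lap_mul, hp1, hX, lap_trace_pow]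
      simp only [map_add, map_mul, map_smul, map_sum, hX, map_ofNat]
      rw [← sum_pderiv_traceHom]
      simp only [mul_comm (pderiv _ (traceHom n p))]
    · have hX : ∀ l, psumHom n (X l) = psum (Fin n) ℂ l := fun l => by simp [psumHom]
      have h1 := lap_vand_mul_psum n k c
      -- Since `Δ` is harmonic, conjugation by it adds only a first-order cross term, which obeys
      -- the Leibniz rule. Keeping `Δ` as a factor avoids dividing by it.
      rw [lap_mul, lap_vand, zero_mul, zero_add] at h1 hp2
      have h2 := sum_pderiv_psumHom (n := n) c k p
      simp only [map_add, map_mul, map_smul, map_sum, hX, map_ofNat]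
      rw [← h2, lap_mul, lap_vand, lap_mul, zero_mul, zero_add]
      have h3 : ∑ i, c • (pderiv i (vand n) * pderiv i (psumHom n p * psum (Fin n) ℂ k))
          = (∑ i, c • (pderiv i (vand n) * pderiv i (psumHom n p))) * psum (Fin n) ℂ k
            + psumHom n p * ∑ i, c • (pderiv i (vand n) * pderiv i (psum (Fin n) ℂ k)) := by
        rw [Finset.sum_mul, Finset.mul_sum, ← Finset.sum_add_distrib]
        refine Finset.sum_congr rfl fun i _ => ?_
        simp only [Derivation.leibniz, smul_eq_mul, smul_eq_C_mul]
        ring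
      have h4 : ∑ i, c • (pderiv i (psumHom n p) * pderiv i (psum (Fin n) ℂ k))
          = ∑ i, c • (pderiv i (psum (Fin n) ℂ k) * pderiv i (psumHom n p)) :=
        Finset.sum_congr rfl fun i _ => by rw [mul_comm]
      rw [h3, h4]
      linear_combination (psum (Fin n) ℂ k) * hp2 + psumHom n p * h1

end MatrixRadial

/-! ### Product Gaussian laws and the Gaussian unitary ensemble -/

section GaussPi

open scoped NNReal

/-- Finite product measures are determined by boxes, on which the product density factors by Fubini.
-/
lemma pi_withDensity_ofReal {ι : Type*} [Fintype ι] {E : ι → Type*} [∀ i, MeasurableSpace (E i)]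
    (ν : ∀ i, Measure (E i)) [∀ i, SigmaFinite (ν i)] (g : ∀ i, E i → ℝ)
    (hg0 : ∀ i x, 0 ≤ g i x) (hg : ∀ i, Integrable (g i) (ν i)) :
    Measure.pi (fun i => (ν i).withDensity fun x => ENNReal.ofReal (g i x))
      = (Measure.pi ν).withDensity fun x => ENNReal.ofReal (∏ i, g i (x i)) := by
  have : ∀ i, IsFiniteMeasure ((ν i).withDensity fun x => ENNReal.ofReal (g i x)) := fun i =>
    isFiniteMeasure_withDensity_ofReal (hg i).2
  refine Measure.pi_eq fun s hs => ?_
  have hgs : ∀ i, Integrable (g i) ((ν i).restrict (s i)) := fun i => (hg i).restrict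
  rw [withDensity_apply _ (MeasurableSet.univ_pi hs), Measure.restrict_pi_pi,
    ← ofReal_integral_eq_lintegral_ofReal (Integrable.fintype_prod_dep hgs)
      (Eventually.of_forall fun x => Finset.prod_nonneg fun i _ => hg0 i _),
    integral_fintype_prod_eq_prod, ENNReal.ofReal_prod_of_nonneg
      fun i _ => integral_nonneg (hg0 i)]
  refine Finset.prod_congr rfl fun i _ => ?_
  rw [withDensity_apply _ (hs i), ofReal_integral_eq_lintegral_ofReal (hgs i)
    (Eventually.of_forall (hg0 i))]

variable {ι : Type*} [Fintype ι]

lemma gaussPi_map_affine (m x : ι → ℝ) (w : ι → ℝ≥0) (r : ℝ) :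
    (gaussPi m w).map (fun p i => x i + r * p i)
      = gaussPi (fun i => x i + r * m i) (fun i => .mk (r ^ 2) (sq_nonneg r) * w i) := by
  have hmeas : ∀ i : ι, Measurable fun y : ℝ => x i + r * y := fun i => by fun_prop
  have h : ∀ i, (gaussianReal (m i) (w i)).map (fun y => x i + r * y)
      = gaussianReal (x i + r * m i) (.mk (r ^ 2) (sq_nonneg r) * w i) := by
    intro i
    have := Measure.map_map (μ := gaussianReal (m i) (w i)) (g := fun y => x i + y)
      (f := fun y => r * y) (by fun_prop) (by fun_prop)
    rw [gaussianReal_map_const_mul, gaussianReal_map_const_add] at this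
    rw [add_comm (x i)]
    exact this.symm
  unfold gaussPi
  have := fun i => Measure.isProbabilityMeasure_map (μ := gaussianReal (m i) (w i))
    (hmeas i).aemeasurable
  rw [Measure.pi_map_pi (f := fun i y => x i + r * y) fun i => (hmeas i).aemeasurable]
  simp_rw [h]

lemma gaussPi_absolutelyContinuous (m : ι → ℝ) (w : ι → ℝ≥0) (hw : ∀ i, w i ≠ 0) :
    gaussPi m w ≪ volume := by
  have h : gaussPi m w = (Measure.pi fun _ : ι => (volume : Measure ℝ)).withDensity
      fun x => ENNReal.ofReal (∏ i, gaussianPDFReal (m i) (w i) (x i)) := by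
    rw [← pi_withDensity_ofReal (fun _ : ι => (volume : Measure ℝ))
      (fun i => gaussianPDFReal (m i) (w i)) (fun i x => gaussianPDFReal_nonneg _ _ _)
      (fun i => integrable_gaussianPDFReal _ _), gaussPi]
    congr 1
    funext i
    rw [gaussianReal_of_var_ne_zero _ (hw i)]
    rfl
  rw [h]
  exact withDensity_absolutelyContinuous _ _

/-- Exponentials of multiples of the `ℓ¹` norm are integrable for Gaussian laws. -/
lemma integrable_exp_l1_gaussPi (m : ι → ℝ) (w : ι → ℝ≥0) (c : ℝ) :
    Integrable (fun y : ι → ℝ => Real.exp (c * ∑ i, |y i|)) (gaussPi m w) := by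
  have h1 : ∀ i, Integrable (fun y : ℝ => Real.exp (c * |y|)) (gaussianReal (m i) (w i)) := by
    intro i
    refine ((integrable_exp_mul_gaussianReal c).add
      (integrable_exp_mul_gaussianReal (-c))).mono' (by fun_prop) (Eventually.of_forall fun y => ?_)
    rw [Real.norm_eq_abs, Real.abs_exp]
    rcases abs_choice y with h | h
    · rw [h]; exact le_add_of_nonneg_right (Real.exp_nonneg _)
    · rw [h, mul_neg, ← neg_mul]; exact le_add_of_nonneg_left (Real.exp_nonneg _)
  have := Integrable.fintype_prod (f := fun (_ : ι) (y : ℝ) => Real.exp (c * |y|)) h1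
  refine this.congr (Eventually.of_forall fun y => ?_)
  simp only [Finset.mul_sum, Real.exp_sum]

/-- Monomials are bounded through `|u|^k / k! ≤ exp |u|`. The exponential form combines with
`integrable_exp_l1_gaussPi` to dominate the Vandermonde factor. -/
lemma exists_norm_evalR_le (F : MvPolynomial ι ℂ) :
    ∃ K : ℝ, 0 ≤ K ∧ ∀ y : ι → ℝ, ‖evalR y F‖ ≤ K * Real.exp (∑ i, |y i|) := by
  induction F using MvPolynomial.induction_on' with
  | monomial s c =>
    refine ⟨‖c‖ * ∏ i, ((s i).factorial : ℝ), by positivity, fun y => ?_⟩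
    have : (MvPolynomial.monomial s c : MvPolynomial ι ℂ) = c • MvPolynomial.monomial s 1 := by
      simp [MvPolynomial.smul_monomial]
    have h2 : evalR y (MvPolynomial.monomial s c) = c * ∏ i, ((y i ^ s i : ℝ) : ℂ) := by
      rw [← evalR_monomial, this, evalR, MvPolynomial.smul_eval, evalR]
    rw [h2, norm_mul, norm_prod, Real.exp_sum, mul_assoc, ← Finset.prod_mul_distrib]
    refine mul_le_mul_of_nonneg_left (Finset.prod_le_prod (fun i _ => norm_nonneg _)
      fun i _ => ?_) (norm_nonneg c)
    rw [Complex.norm_real, norm_pow, Real.norm_eq_abs]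
    have := Real.pow_div_factorial_le_exp (|y i|) (abs_nonneg _) (s i)
    rwa [div_le_iff₀' (by positivity)] at this
  | add p q hp hq =>
    obtain ⟨K, hK, h1⟩ := hp
    obtain ⟨K', hK', h2⟩ := hq
    refine ⟨K + K', add_nonneg hK hK', fun y => ?_⟩
    have : evalR y (p + q) = evalR y p + evalR y q := by simp [evalR]
    rw [this, add_mul]
    exact (norm_add_le _ _).trans (add_le_add (h1 y) (h2 y))

lemma measurable_evalR (F : MvPolynomial ι ℂ) : Measurable fun y : ι → ℝ => evalR y F := by
  have h : Continuous fun y : ι → ℝ => evalR y F :=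
    (MvPolynomial.continuous_eval F).comp (by fun_prop)
  exact h.measurable

end GaussPi

/-! ### The Gaussian unitary ensemble in independent real coordinates -/

section GUE

open scoped NNReal

/-- Variances of the coordinates of a GUE matrix. -/
noncomputable def coordVar {n : ℕ} (c : ℝ≥0) (α : Fin n × Fin n) : ℝ≥0 :=
  if α.1 = α.2 then c else c / 2

/-- The Hermitian matrix with real coordinates `p`, indexed by pairs. -/
noncomputable def hermOf {n : ℕ} (p : Fin n × Fin n → ℝ) : Matrix (Fin n) (Fin n) ℂ :=
  hermitianOfCoords fun i j => p (i, j)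

lemma trace_sq_hermitianOfCoords {n : ℕ} (p : Fin n → Fin n → ℝ) :
    (hermitianOfCoords p * hermitianOfCoords p).trace
      = ((∑ i, ∑ j, (if i = j then 1 else 2) * p i j ^ 2 : ℝ) : ℂ) := by
  -- Halving the diagonal makes `g i j + g j i` equal to `H i j * H j i` in every case.
  set g : Fin n → Fin n → ℝ := fun i j => if i = j then p i j ^ 2 / 2 else p i j ^ 2 with hg
  have h1 : ∀ i j, hermitianOfCoords p i j * hermitianOfCoords p j i = ((g i j + g j i : ℝ) : ℂ) := by
    intro i j
    simp only [hermitianOfCoords, Matrix.of_apply, hg]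
    rcases lt_trichotomy i j with h | h | h
    · simp only [h.ne, h.ne', if_false, h, if_true, h.not_gt]
      push_cast
      linear_combination (-(p j i : ℂ) ^ 2) * Complex.I_sq
    · subst h
      simp only [if_true]
      push_cast
      ring
    · simp only [h.ne, h.ne', if_false, h, if_true, h.not_gt]
      push_cast
      linear_combination (-(p i j : ℂ) ^ 2) * Complex.I_sq
  have h2 : ∑ i, ∑ j, (g i j + g j i) = ∑ i, ∑ j, (if i = j then 1 else 2) * p i j ^ 2 := by
    simp_rw [Finset.sum_add_distrib]
    rw [Finset.sum_comm (f := fun i j => g j i), ← Finset.sum_add_distrib]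
    refine Finset.sum_congr rfl fun i _ => ?_
    rw [← Finset.sum_add_distrib]
    refine Finset.sum_congr rfl fun j _ => ?_
    simp only [hg]
    split_ifs <;> ring
  rw [← h2]
  simp only [Matrix.trace, Matrix.diag_apply, Matrix.mul_apply, h1]
  push_cast
  rfl

lemma measurable_hermitianOfCoords (n : ℕ) :
    Measurable (hermitianOfCoords : (Fin n → Fin n → ℝ) → Matrix (Fin n) (Fin n) ℂ) := by
  refine measurable_pi_lambda _ fun i => measurable_pi_lambda _ fun j => ?_
  simp only [hermitianOfCoords, Matrix.of_apply]
  split_ifs <;> fun_prop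

lemma measurable_hermOf (n : ℕ) :
    Measurable (hermOf : (Fin n × Fin n → ℝ) → Matrix (Fin n) (Fin n) ℂ) :=
  (measurable_hermitianOfCoords n).comp
    (measurable_pi_lambda _ fun i => measurable_pi_lambda _ fun j => by fun_prop)

lemma gueWeight_eq {n : ℕ} (hn : 0 < n) :
    ∃ K : ℝ, 0 < K ∧ Measure.pi (fun i : Fin n => Measure.pi fun j : Fin n =>
        gaussianReal 0 (coordVar ((n : ℝ≥0)⁻¹) (i, j))) = ENNReal.ofReal K • gueWeight n := by
  have hn' : (n : ℝ) ≠ 0 := by positivity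
  set w : Fin n → Fin n → ℝ≥0 := fun i j => coordVar ((n : ℝ≥0)⁻¹) (i, j) with hw
  have hw0 : ∀ i j, w i j ≠ 0 := by
    intro i j
    simp only [hw, coordVar]
    have : (n : ℝ≥0) ≠ 0 := by positivity
    split_ifs <;> positivity
  have h1 : ∀ i, Measure.pi (fun j : Fin n => gaussianReal 0 (w i j))
      = (volume : Measure (Fin n → ℝ)).withDensity
        fun x => ENNReal.ofReal (∏ j, gaussianPDFReal 0 (w i j) (x j)) := by
    intro i
    rw [volume_pi, ← pi_withDensity_ofReal (fun _ : Fin n => (volume : Measure ℝ))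
      (fun j => gaussianPDFReal 0 (w i j)) (fun j x => gaussianPDFReal_nonneg _ _ _)
      (fun j => integrable_gaussianPDFReal _ _)]
    congr 1
    funext j
    rw [gaussianReal_of_var_ne_zero _ (hw0 i j)]
    rfl
  have h2 : Measure.pi (fun i : Fin n => Measure.pi fun j : Fin n => gaussianReal 0 (w i j))
      = (volume : Measure (Fin n → Fin n → ℝ)).withDensity
        fun x => ENNReal.ofReal (∏ i, ∏ j, gaussianPDFReal 0 (w i j) (x i j)) := by
    simp_rw [h1]
    exact pi_withDensity_ofReal (fun _ : Fin n => (volume : Measure (Fin n → ℝ)))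
      (fun i x => ∏ j, gaussianPDFReal 0 (w i j) (x j))
      (fun i x => Finset.prod_nonneg fun j _ => gaussianPDFReal_nonneg _ _ _)
      (fun i => Integrable.fintype_prod fun j => integrable_gaussianPDFReal _ _)
  refine ⟨∏ i, ∏ j, (√(2 * Real.pi * w i j))⁻¹, ?_, ?_⟩
  · refine Finset.prod_pos fun i _ => Finset.prod_pos fun j _ => ?_
    have : 0 < (w i j : ℝ) := by
      have := hw0 i j; positivity
    positivity
  · rw [h2, gueWeight, ← withDensity_smul]
    · congr 1
      funext x
      rw [Pi.smul_apply, smul_eq_mul, ← ENNReal.ofReal_mul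
        (Finset.prod_nonneg fun i _ => Finset.prod_nonneg fun j _ => by positivity)]
      congr 1
      rw [trace_sq_hermitianOfCoords, Complex.ofReal_re, Finset.mul_sum, Real.exp_sum,
        ← Finset.prod_mul_distrib]
      refine Finset.prod_congr rfl fun i _ => ?_
      rw [Finset.mul_sum, Real.exp_sum, ← Finset.prod_mul_distrib]
      refine Finset.prod_congr rfl fun j _ => ?_
      rw [gaussianPDFReal]
      congr 2
      simp only [hw, coordVar]
      split_ifs <;> push_cast <;> field_simp <;> ring
    · refine (Real.measurable_exp.comp (Measurable.const_mul ?_ _)).ennreal_ofReal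
      simp_rw [trace_sq_hermitianOfCoords, Complex.ofReal_re]
      fun_prop

/-- The GUE has independent Gaussian coordinates. -/
lemma gue_eq_map {n : ℕ} (hn : 0 < n) :
    gue n = (gaussPi 0 (coordVar ((n : ℝ≥0)⁻¹))).map (hermOf (n := n)) := by
  obtain ⟨K, hK, h⟩ := gueWeight_eq hn
  have hK0 : ENNReal.ofReal K ≠ 0 := by simpa using hK
  -- The Gaussian product has mass one, which identifies `K` with the normalization without
  -- evaluating it.
  have huniv : ENNReal.ofReal K * gueWeight n Set.univ = 1 := by
    have := congrArg (fun μ => μ Set.univ) h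
    simpa using this.symm
  have hinv : (gueWeight n Set.univ)⁻¹ = ENNReal.ofReal K := by
    rw [ENNReal.eq_inv_of_mul_eq_one_left huniv]
  have hcurry : (gaussPi 0 (coordVar ((n : ℝ≥0)⁻¹))).map
      (MeasurableEquiv.curry (Fin n) (Fin n) ℝ)
      = Measure.pi (fun i : Fin n => Measure.pi fun j : Fin n =>
        gaussianReal 0 (coordVar ((n : ℝ≥0)⁻¹) (i, j))) := by
    have := Measure.infinitePi_map_curry (X := ℝ)
      (fun i j : Fin n => gaussianReal 0 (coordVar ((n : ℝ≥0)⁻¹) (i, j)))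
    simp only [Measure.infinitePi_eq_pi] at this
    exact this
  rw [gue, hinv, ← h, ← hcurry, Measure.map_map (measurable_hermitianOfCoords n)
    (MeasurableEquiv.measurable _)]
  rfl

end GUE

/-! ### Ordered eigenvalues -/

section Eigenvalues

variable {n : ℕ}

lemma monotone_orderedEigenvalues (A : Matrix (Fin n) (Fin n) ℂ) :
    Monotone (orderedEigenvalues A) := by
  unfold orderedEigenvalues
  split_ifs with h
  · intro i j hij
    refine h.eigenvalues₀_antitone ?_
    simp only [Fin.cast_le_cast, Fin.rev_le_rev] at *
    exact hij
  · exact monotone_const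

lemma exists_perm_orderedEigenvalues {A : Matrix (Fin n) (Fin n) ℂ} (h : A.IsHermitian) :
    ∃ e : Equiv.Perm (Fin n), ∀ i, orderedEigenvalues A i = h.eigenvalues (e i) := by
  refine ⟨(Fin.revPerm.trans (finCongr (Fintype.card_fin n).symm)).trans
    (Fintype.equivOfCardEq (Fintype.card_fin _)), fun i => ?_⟩
  simp [orderedEigenvalues, h, Matrix.IsHermitian.eigenvalues]

lemma det_sub_eq_prod {A : Matrix (Fin n) (Fin n) ℂ} (h : A.IsHermitian) (z : ℂ) :
    (Matrix.scalar (Fin n) z - A).det = ∏ i, (z - (orderedEigenvalues A i : ℂ)) := by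
  obtain ⟨e, he⟩ := exists_perm_orderedEigenvalues h
  rw [← Matrix.eval_charpoly, h.charpoly_eq, Polynomial.eval_prod, ← Equiv.prod_comp e]
  simp [he]

lemma trace_pow_eq_sum {A : Matrix (Fin n) (Fin n) ℂ} (h : A.IsHermitian) (k : ℕ) :
    (A ^ k).trace = ∑ i, (orderedEigenvalues A i : ℂ) ^ k := by
  obtain ⟨e, he⟩ := exists_perm_orderedEigenvalues h
  simp_rw [he]
  rw [Equiv.sum_comp e fun i => (h.eigenvalues i : ℂ) ^ k]
  conv_lhs => rw [h.spectral_theorem, ← map_pow, Unitary.conjStarAlgAut_apply,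
    Matrix.trace_mul_cycle, Unitary.coe_star_mul_self, one_mul, Matrix.diagonal_pow]
  simp [Matrix.trace_diagonal]

/-- Monic polynomials that agree at all natural numbers coincide, so their root multisets do, and a
multiset has one sorted enumeration. Countably many test points are what the measurability proof
needs. -/
lemma eq_of_monotone_of_prod_eq {x y : Fin n → ℝ} (hx : Monotone x) (hy : Monotone y)
    (h : ∀ z : ℕ, ∏ i, ((z : ℝ) - x i) = ∏ i, ((z : ℝ) - y i)) : x = y := by
  have hpoly : ∏ i, (Polynomial.X - Polynomial.C (x i))
      = ∏ i, (Polynomial.X - Polynomial.C (y i)) := by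
    refine Polynomial.eq_of_infinite_eval_eq _ _ (Set.Infinite.mono ?_
      (Set.infinite_range_of_injective (Nat.cast_injective (R := ℝ))))
    rintro _ ⟨z, rfl⟩
    simpa [Polynomial.eval_prod] using h z
  have hroots := congrArg Polynomial.roots hpoly
  have hr : ∀ u : Fin n → ℝ, (∏ i, (Polynomial.X - Polynomial.C (u i))).roots
      = (List.ofFn u : Multiset ℝ) := by
    intro u
    rw [Polynomial.roots_prod _ _ (Finset.prod_ne_zero_iff.2
      fun i _ => Polynomial.X_sub_C_ne_zero _)]
    simp [Polynomial.roots_X_sub_C, Multiset.bind_singleton, List.ofFn_eq_map]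
  rw [hr, hr, Multiset.coe_eq_coe] at hroots
  exact List.ofFn_injective (hroots.eq_of_sortedLE hx.sortedLE_ofFn hy.sortedLE_ofFn)

/-- The values of the characteristic polynomial at the natural numbers are measurable in the matrix.
They determine the sorted roots by an injective measurable map on a standard Borel space, which is a
measurable embedding and can be undone. -/
lemma measurable_orderedEigenvalues :
    Measurable (orderedEigenvalues : Matrix (Fin n) (Fin n) ℂ → Fin n → ℝ) := by
  classical
  have hclosed : IsClosed {x : Fin n → ℝ | Monotone x} := isClosed_monotone
  have : StandardBorelSpace {x : Fin n → ℝ | Monotone x} := hclosed.measurableSet.standardBorel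
  set f : {x : Fin n → ℝ | Monotone x} → ℕ → ℝ := fun x z => ∏ i, ((z : ℝ) - x.1 i) with hf
  have hfm : Measurable f := measurable_pi_lambda _ fun z => by
    refine Finset.measurable_prod _ fun i _ => ?_
    exact measurable_const.sub ((measurable_pi_apply i).comp measurable_subtype_coe)
  have hfe : MeasurableEmbedding f := hfm.measurableEmbedding fun x y hxy =>
    Subtype.ext (eq_of_monotone_of_prod_eq x.2 y.2 fun z => congrFun hxy z)
  set E : Matrix (Fin n) (Fin n) ℂ → {x : Fin n → ℝ | Monotone x} :=
    fun A => ⟨orderedEigenvalues A, monotone_orderedEigenvalues A⟩ with hE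
  have hcoord : ∀ i j, Measurable fun A : Matrix (Fin n) (Fin n) ℂ => A i j := fun i j =>
    (measurable_pi_apply j).comp (measurable_pi_apply (X := fun _ : Fin n => Fin n → ℂ) i)
  have hherm : MeasurableSet {A : Matrix (Fin n) (Fin n) ℂ | A.IsHermitian} := by
    have : {A : Matrix (Fin n) (Fin n) ℂ | A.IsHermitian}
        = ⋂ i, ⋂ j, {A | star (A j i) = A i j} := by
      ext A
      simp [Matrix.IsHermitian.ext_iff]
    rw [this]
    exact MeasurableSet.iInter fun i => MeasurableSet.iInter fun j =>
      measurableSet_eq_fun (continuous_star.measurable.comp (hcoord j i)) (hcoord i j)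
  have hfE : Measurable (f ∘ E) := by
    refine measurable_pi_lambda _ fun z => ?_
    -- Off the Hermitian matrices the eigenvalue vector is `0` by convention, hence the value `z ^
    -- n`.
    have : (fun A => (f ∘ E) A z) = fun A : Matrix (Fin n) (Fin n) ℂ =>
        if A.IsHermitian then ((Matrix.scalar (Fin n) (z : ℂ) - A).det).re else (z : ℝ) ^ n := by
      funext A
      split_ifs with h
      · rw [det_sub_eq_prod h]
        have : ∏ i, ((z : ℂ) - (orderedEigenvalues A i : ℂ))
            = ((∏ i, ((z : ℝ) - orderedEigenvalues A i) : ℝ) : ℂ) := by push_cast; rfl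
        rw [this, Complex.ofReal_re]
        rfl
      · simp [hf, hE, orderedEigenvalues, h]
    rw [this]
    refine Measurable.ite hherm (Complex.measurable_re.comp ?_) measurable_const
    simp_rw [Matrix.det_apply]
    refine Finset.measurable_sum _ fun σ _ => Measurable.const_smul
      (Finset.measurable_prod _ fun i _ => ?_) _
    exact measurable_const.sub (hcoord _ _)
  exact measurable_subtype_coe.comp ((hfe.measurable_comp_iff).1 hfE)

lemma orderedEigenvalues_smul {A : Matrix (Fin n) (Fin n) ℂ} (h : A.IsHermitian) {c : ℝ}
    (hc : 0 < c) : orderedEigenvalues (c • A) = c • orderedEigenvalues A := by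
  have hcA : (c • A).IsHermitian := by
    rw [Matrix.IsHermitian, Matrix.conjTranspose_smul, h.eq]; simp
  refine eq_of_monotone_of_prod_eq (monotone_orderedEigenvalues _)
    (fun i j hij => mul_le_mul_of_nonneg_left (monotone_orderedEigenvalues A hij) hc.le)
    fun z => ?_
  have hc' : (c : ℂ) ≠ 0 := by exact_mod_cast hc.ne'
  have h1 := det_sub_eq_prod hcA (z : ℂ)
  have h2 : Matrix.scalar (Fin n) (z : ℂ) - c • A
      = (c : ℂ) • (Matrix.scalar (Fin n) ((z : ℂ) / c) - A) := by
    ext i j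
    by_cases hij : i = j
    · subst hij
      simp only [Matrix.scalar_apply, Matrix.sub_apply, Matrix.smul_apply,
        Matrix.diagonal_apply_eq, smul_eq_mul, Complex.real_smul]
      rw [mul_sub, mul_div_cancel₀ _ hc']
    · simp only [Matrix.scalar_apply, Matrix.sub_apply, Matrix.smul_apply,
        Matrix.diagonal_apply_ne _ hij, smul_eq_mul, Complex.real_smul]
      ring
  rw [h2, Matrix.det_smul, det_sub_eq_prod h, ← Finset.card_univ, ← Finset.prod_const,
    ← Finset.prod_mul_distrib] at h1
  have h3 : ∏ i, ((z : ℂ) - (orderedEigenvalues (c • A) i : ℂ))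
      = ∏ i, ((z : ℂ) - ((c • orderedEigenvalues A) i : ℝ)) := by
    rw [← h1]
    refine Finset.prod_congr rfl fun i _ => ?_
    rw [mul_sub, mul_div_cancel₀ _ hc']
    simp
  exact_mod_cast h3

lemma isHermitian_hermitianOfCoords (p : Fin n → Fin n → ℝ) :
    (hermitianOfCoords p).IsHermitian := by
  ext i j
  simp only [hermitianOfCoords, Matrix.conjTranspose_apply, Matrix.of_apply]
  rcases lt_trichotomy i j with h | h | h
  · simp [h.ne, h.ne', h, h.not_gt, sub_eq_add_neg]
  · subst h; simp
  · simp [h.ne, h.ne', h, h.not_gt, sub_eq_add_neg]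

/-- The real coordinates of a Hermitian matrix. -/
noncomputable def coordsOf (A : Matrix (Fin n) (Fin n) ℂ) (α : Fin n × Fin n) : ℝ :=
  if α.1 ≤ α.2 then (A α.1 α.2).re else (A α.2 α.1).im

lemma hermOf_coordsOf {A : Matrix (Fin n) (Fin n) ℂ} (h : A.IsHermitian) :
    hermOf (coordsOf A) = A := by
  ext i j
  have hij : star (A j i) = A i j := h.apply i j
  simp only [hermOf, hermitianOfCoords, coordsOf, Matrix.of_apply]
  rcases lt_trichotomy i j with h1 | h1 | h1
  · simp [h1.ne, h1, h1.le, h1.not_ge, Complex.re_add_im]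
  · subst h1
    have h2 := congrArg Complex.im hij
    simp only [RCLike.star_def, Complex.conj_im] at h2
    apply Complex.ext
    · simp
    · simp; linarith
  · rw [← hij]
    apply Complex.ext <;> simp [h1.ne', h1.not_gt, h1.le, h1.not_ge]

lemma hermOf_add_smul (p q : Fin n × Fin n → ℝ) (r : ℝ) :
    hermOf (fun α => p α + r * q α) = hermOf p + r • hermOf q := by
  ext i j
  simp only [hermOf, hermitianOfCoords, Matrix.of_apply, Matrix.add_apply, Matrix.smul_apply]
  split_ifs <;> push_cast <;> simp <;> ring

/-- Each eigenvalue is bounded by the Hilbert–Schmidt norm. The bound makes exponentials of the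
eigenvalues integrable under Gaussian coordinates. -/
lemma sum_abs_orderedEigenvalues_le (p : Fin n × Fin n → ℝ) :
    ∑ i, |orderedEigenvalues (hermOf p) i| ≤ n * 2 * ∑ α, |p α| := by
  have htr : ∑ i, orderedEigenvalues (hermOf p) i ^ 2
      = ∑ i, ∑ j, (if i = j then 1 else 2) * p (i, j) ^ 2 := by
    have h1 := trace_pow_eq_sum (isHermitian_hermitianOfCoords fun i j => p (i, j)) 2
    rw [pow_two, trace_sq_hermitianOfCoords] at h1
    exact_mod_cast h1.symm
  have hle : ∑ i, orderedEigenvalues (hermOf p) i ^ 2 ≤ (2 * ∑ α, |p α|) ^ 2 := by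
    rw [htr, ← Fintype.sum_prod_type' (f := fun i j => (if i = j then (1 : ℝ) else 2) * p (i, j) ^ 2)]
    calc _ ≤ ∑ α : Fin n × Fin n, 2 * |p α| ^ 2 := by
          refine Finset.sum_le_sum fun α _ => ?_
          rw [sq_abs]
          refine mul_le_mul_of_nonneg_right ?_ (sq_nonneg _)
          split_ifs <;> norm_num
      _ = 2 * ∑ α, |p α| ^ 2 := by rw [Finset.mul_sum]
      _ ≤ 2 * (∑ α, |p α|) ^ 2 := by
          gcongr
          exact Finset.sum_sq_le_sq_sum_of_nonneg fun α _ => abs_nonneg _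
      _ ≤ _ := by nlinarith [sq_nonneg (∑ α, |p α|)]
  have h0 : 0 ≤ 2 * ∑ α, |p α| := by positivity
  have hi : ∀ i ∈ Finset.univ, |orderedEigenvalues (hermOf p) i| ≤ 2 * ∑ α, |p α| := by
    intro i _
    refine abs_le_of_sq_le_sq ?_ h0
    exact (Finset.single_le_sum (f := fun i => orderedEigenvalues (hermOf p) i ^ 2)
      (fun j _ => sq_nonneg _) (Finset.mem_univ i)).trans hle
  calc _ ≤ ∑ _i : Fin n, 2 * ∑ α, |p α| := Finset.sum_le_sum hi
    _ = _ := by simp [mul_assoc]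

end Eigenvalues

/-! ### Expectations of symmetric functions of the eigenvalues -/

section Symmetric

open MvPolynomial

variable {n : ℕ}

/-- Elementary symmetric polynomials generate, and Newton's identities express them through power
sums because `k` is invertible in `ℂ`. -/
lemma mem_range_psumHom_of_isSymmetric {p : MvPolynomial (Fin n) ℂ} (hp : p.IsSymmetric) :
    ∃ q, psumHom n q = p := by
  have hps : ∀ k, psum (Fin n) ℂ k ∈ (psumHom n).range := fun k => ⟨X k, by simp [psumHom]⟩
  have hes : ∀ k, esymm (Fin n) ℂ k ∈ (psumHom n).range := by
    intro k
    induction k using Nat.strong_induction_on with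
    | _ k ih =>
      rcases Nat.eq_zero_or_pos k with rfl | hk
      · rw [esymm_zero]; exact one_mem _
      · have h := mul_esymm_eq_sum (Fin n) ℂ k
        have h2 : esymm (Fin n) ℂ k = (k : ℂ)⁻¹ • ((-1) ^ (k + 1) *
            ∑ a ∈ Finset.HasAntidiagonal.antidiagonal k with a.1 < k,
              (-1) ^ a.1 * esymm (Fin n) ℂ a.1 * psum (Fin n) ℂ a.2) := by
          rw [← h, ← nsmul_eq_mul, ← Nat.cast_smul_eq_nsmul ℂ, smul_smul, inv_mul_cancel₀, one_smul]
          exact_mod_cast hk.ne'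
        rw [h2]
        have hneg : ∀ m : ℕ, (-1 : MvPolynomial (Fin n) ℂ) ^ m ∈ (psumHom n).range := fun m =>
          pow_mem (neg_mem (one_mem _)) m
        refine Subalgebra.smul_mem _ (mul_mem (hneg _) (sum_mem fun a ha => ?_)) _
        exact mul_mem (mul_mem (hneg _) (ih _ (Finset.mem_filter.1 ha).2)) (hps _)
  obtain ⟨r, hr⟩ := esymmAlgHom_surjective (σ := Fin n) ℂ (n := n) (by simp) ⟨p, hp⟩
  have h3 := congrArg Subtype.val hr
  rw [esymmAlgHom_apply] at h3
  choose g hg using fun i : Fin n => hes (i + 1)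
  refine ⟨aeval g r, ?_⟩
  rw [comp_aeval_apply]
  exact (congrArg (fun f => aeval f r) (funext hg)).trans h3

end Symmetric

/-! ### Eigenvalues of a Gaussian perturbation of a Hermitian matrix -/

section MatrixLaw

open MvPolynomial
open scoped NNReal

variable {n : ℕ}

lemma evalR_aeval {σ : Type*} (y : σ → ℝ) (f : ℕ → MvPolynomial σ ℂ) (q : MvPolynomial ℕ ℂ) :
    evalR y (aeval f q) = aeval (fun k => evalR y (f k)) q :=
  comp_aeval_apply (f := f) (aeval fun i => (y i : ℂ)) q

lemma isHermitian_hermOf (p : Fin n × Fin n → ℝ) : (hermOf p).IsHermitian :=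
  isHermitian_hermitianOfCoords _

lemma evalR_traceHom (p : Fin n × Fin n → ℝ) (q : MvPolynomial ℕ ℂ) :
    evalR p (traceHom n q) = evalR (orderedEigenvalues (hermOf p)) (psumHom n q) := by
  have hmat : (genHerm n).map (eval fun α => (p α : ℂ)) = hermOf p := by
    ext i j
    simp only [genHerm, hermOf, hermitianOfCoords, Matrix.map_apply, Matrix.of_apply]
    split_ifs <;> simp [mul_comm]
  have htr : ∀ k, evalR p ((genHerm n ^ k).trace)
      = evalR (orderedEigenvalues (hermOf p)) (psum (Fin n) ℂ k) := by
    intro k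
    have h1 : evalR p ((genHerm n ^ k).trace) = (hermOf p ^ k).trace := by
      rw [evalR, ← hmat, AddMonoidHom.map_trace (eval fun α => (p α : ℂ)) (genHerm n ^ k)]
      congr 1
      exact map_pow (RingHom.mapMatrix (eval fun α => (p α : ℂ))) (genHerm n) k
    rw [h1, trace_pow_eq_sum (isHermitian_hermOf p)]
    simp [evalR, psum]
  rw [traceHom, psumHom, evalR_aeval, evalR_aeval]
  simp_rw [htr]

/-- Expectations of symmetric polynomials of the eigenvalues of a Gaussian perturbation of a
Hermitian matrix. -/
theorem integral_symmetric_eigenvalues (p : Fin n × Fin n → ℝ) (c : ℝ≥0) (q : MvPolynomial ℕ ℂ) :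
    evalR (orderedEigenvalues (hermOf p)) (vand n)
        * ∫ x, evalR (orderedEigenvalues (hermOf x)) (psumHom n q) ∂gaussPi p (coordVar c)
      = ∫ y, evalR y (vand n * psumHom n q)
          ∂gaussPi (orderedEigenvalues (hermOf p)) (fun _ => c) := by
  have hw : (fun α : Fin n × Fin n => ((coordVar c α : ℝ≥0) : ℂ)) = hermWeight (c : ℂ) := by
    funext α
    simp only [coordVar, hermWeight]
    split_ifs <;> push_cast <;> rfl
  have hiter : ∀ k : ℕ, ∃ q' : MvPolynomial ℕ ℂ,
      (lap (hermWeight (c : ℂ)) ^ k) (traceHom n q) = traceHom n q' ∧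
      (lap (fun _ => (c : ℂ)) ^ k) (vand n * psumHom n q) = vand n * psumHom n q' := by
    intro k
    induction k with
    | zero => exact ⟨q, by simp, by simp⟩
    | succ k ih =>
      obtain ⟨q₁, h1, h2⟩ := ih
      obtain ⟨q₂, h3, h4⟩ := exists_radial n (c : ℂ) q₁
      refine ⟨q₂, ?_, ?_⟩
      · rw [pow_succ', Module.End.mul_apply, h1, h3]
      · rw [pow_succ', Module.End.mul_apply, h2, h4]
  have H1 := (hasSum_gaussExp p (coordVar c) (traceHom n q)).mul_left
    (evalR (orderedEigenvalues (hermOf p)) (vand n))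
  have H2 := hasSum_gaussExp (orderedEigenvalues (hermOf p)) (fun _ => c) (vand n * psumHom n q)
  rw [hw] at H1
  -- The two heat series agree term by term, since every power of the Laplacian keeps a common
  -- abstract witness `q'`.
  have h := H1.unique (H2.congr_fun fun k => ?_)
  · rw [show gaussExp (orderedEigenvalues (hermOf p)) (fun _ => c) (vand n * psumHom n q)
      = ∫ y, evalR y (vand n * psumHom n q)
          ∂gaussPi (orderedEigenvalues (hermOf p)) (fun _ => c) from rfl] at h
    rw [← h]
    congr 1
    change _ = ∫ x, evalR x (traceHom n q) ∂gaussPi p (coordVar c)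
    simp_rw [evalR_traceHom]
  · obtain ⟨q', h1, h2⟩ := hiter k
    rw [h1, h2, evalR_traceHom]
    simp only [evalR, map_mul]
    ring

/-- The symmetrized character `∑_σ exp (i ∑ ξ_j x_{σ j})`. -/
noncomputable def symChar (ξ x : Fin n → ℝ) : ℂ :=
  ∑ σ : Equiv.Perm (Fin n), Complex.exp (Complex.I * ((∑ j, ξ j * x (σ j) : ℝ) : ℂ))

/-- The symmetrized powers of a linear form. -/
noncomputable def symPow (ξ : Fin n → ℝ) (k : ℕ) : MvPolynomial (Fin n) ℂ :=
  ∑ σ : Equiv.Perm (Fin n), (∑ j, C (ξ j : ℂ) * X (σ j)) ^ k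

lemma isSymmetric_symPow (ξ : Fin n → ℝ) (k : ℕ) : (symPow ξ k).IsSymmetric := by
  intro τ
  simp only [symPow, map_sum, map_pow, map_mul, rename_C, rename_X]
  exact Fintype.sum_equiv (Equiv.mulLeft τ) _ _ fun σ => rfl

lemma evalR_symPow (ξ x : Fin n → ℝ) (k : ℕ) :
    evalR x (symPow ξ k) = ∑ σ : Equiv.Perm (Fin n), ((∑ j, ξ j * x (σ j) : ℝ) : ℂ) ^ k := by
  simp [evalR, symPow]

lemma hasSum_symChar (ξ x : Fin n → ℝ) :
    HasSum (fun k : ℕ => Complex.I ^ k / (k.factorial : ℂ) * evalR x (symPow ξ k))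
      (symChar ξ x) := by
  have h : ∀ σ : Equiv.Perm (Fin n),
      HasSum (fun k : ℕ => Complex.I ^ k / (k.factorial : ℂ) * ((∑ j, ξ j * x (σ j) : ℝ) : ℂ) ^ k)
        (Complex.exp (Complex.I * ((∑ j, ξ j * x (σ j) : ℝ) : ℂ))) := by
    intro σ
    rw [Complex.exp_eq_exp_ℂ]
    refine (NormedSpace.expSeries_div_hasSum_exp _).congr_fun fun k => ?_
    rw [mul_pow]; ring
  refine (hasSum_sum fun σ (_ : σ ∈ Finset.univ) => h σ).congr_fun fun k => ?_
  rw [evalR_symPow, Finset.mul_sum]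

lemma abs_linear_perm_le (ξ x : Fin n → ℝ) (σ : Equiv.Perm (Fin n)) :
    |∑ j, ξ j * x (σ j)| ≤ (∑ j, |ξ j|) * ∑ j, |x j| := by
  rw [← Equiv.sum_comp σ (fun j => |x j|), Finset.sum_mul_sum]
  refine (Finset.abs_sum_le_sum_abs _ _).trans (Finset.sum_le_sum fun i _ => ?_)
  rw [abs_mul]
  exact Finset.single_le_sum (f := fun j => |ξ i| * |x (σ j)|)
    (fun j _ => by positivity) (Finset.mem_univ i)

lemma norm_evalR_symPow_le (ξ x : Fin n → ℝ) (k : ℕ) :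
    ‖evalR x (symPow ξ k)‖ ≤ (n.factorial : ℝ) * ((∑ j, |ξ j|) * ∑ j, |x j|) ^ k := by
  rw [evalR_symPow]
  refine (norm_sum_le _ _).trans ?_
  calc _ ≤ ∑ _σ : Equiv.Perm (Fin n), ((∑ j, |ξ j|) * ∑ j, |x j|) ^ k := by
        refine Finset.sum_le_sum fun σ _ => ?_
        rw [norm_pow, Complex.norm_real]
        exact pow_le_pow_left₀ (norm_nonneg _) (abs_linear_perm_le ξ x σ) k
    _ = _ := by simp [Fintype.card_perm]

/-- Dominated convergence for the exponential series. This passes from identities for symmetric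
polynomials to identities for bounded test functions, without solving a moment problem. -/
lemma hasSum_integral_symChar {α : Type*} [MeasurableSpace α] {μ : Measure α} (ξ : Fin n → ℝ)
    {Y : α → Fin n → ℝ} (hY : Measurable Y) {G : α → ℂ} (hG : Measurable G)
    (hint : Integrable (fun a => ‖G a‖ * Real.exp ((∑ j, |ξ j|) * ∑ j, |Y a j|)) μ) :
    HasSum (fun k : ℕ => Complex.I ^ k / (k.factorial : ℂ)
        * ∫ a, G a * evalR (Y a) (symPow ξ k) ∂μ)
      (∫ a, G a * symChar ξ (Y a) ∂μ) := by
  set u : α → ℝ := fun a => (∑ j, |ξ j|) * ∑ j, |Y a j| with hu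
  have hs : ∀ a, HasSum (fun k : ℕ => ‖G a‖ * (n.factorial : ℝ) * (u a ^ k / (k.factorial : ℝ)))
      (‖G a‖ * (n.factorial : ℝ) * Real.exp (u a)) := fun a => by
    have h : HasSum (fun k : ℕ => u a ^ k / (k.factorial : ℝ)) (Real.exp (u a)) := by
      rw [Real.exp_eq_exp_ℝ]
      exact NormedSpace.expSeries_div_hasSum_exp (u a)
    exact h.mul_left _
  suffices h : HasSum (fun k : ℕ => ∫ a, Complex.I ^ k / (k.factorial : ℂ)
      * (G a * evalR (Y a) (symPow ξ k)) ∂μ) (∫ a, G a * symChar ξ (Y a) ∂μ) from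
    h.congr_fun fun k => (integral_const_mul _ _).symm
  refine hasSum_integral_of_dominated_convergence
    (fun k a => ‖G a‖ * (n.factorial : ℝ) * (u a ^ k / (k.factorial : ℝ))) ?_ ?_ ?_ ?_ ?_
  · intro k
    have h1 : Measurable fun a => evalR (Y a) (symPow ξ k) := (measurable_evalR (symPow ξ k)).comp hY
    have h2 : Measurable fun a => G a * evalR (Y a) (symPow ξ k) := hG.mul h1
    exact (measurable_const.mul h2).aestronglyMeasurable
  · intro k
    refine Eventually.of_forall fun a => ?_
    rw [norm_mul, norm_div, norm_pow, Complex.norm_I, one_pow, norm_mul, Complex.norm_natCast]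
    have := norm_evalR_symPow_le ξ (Y a) k
    calc _ ≤ 1 / (k.factorial : ℝ) * (‖G a‖ * ((n.factorial : ℝ) * u a ^ k)) := by gcongr
      _ = _ := by ring
  · exact Eventually.of_forall fun a => (hs a).summable
  · simp_rw [fun a => (hs a).tsum_eq]
    refine (hint.const_mul (n.factorial : ℝ)).congr (Eventually.of_forall fun a => ?_)
    simp only [hu]
    ring
  · refine Eventually.of_forall fun a => ?_
    refine ((hasSum_symChar ξ (Y a)).mul_left (G a)).congr_fun fun k => ?_
    ring

/-- The symmetrized characteristic function of the eigenvalues of a Gaussian perturbation of a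
Hermitian matrix. -/
theorem integral_symChar_eigenvalues (ξ : Fin n → ℝ) (p : Fin n × Fin n → ℝ) (c : ℝ≥0) :
    evalR (orderedEigenvalues (hermOf p)) (vand n)
        * ∫ x, symChar ξ (orderedEigenvalues (hermOf x)) ∂gaussPi p (coordVar c)
      = ∫ y, evalR y (vand n) * symChar ξ y
          ∂gaussPi (orderedEigenvalues (hermOf p)) (fun _ => c) := by
  set L := ∑ j, |ξ j| with hL
  have hL0 : 0 ≤ L := Finset.sum_nonneg fun _ _ => abs_nonneg _
  have hYm : Measurable fun x : Fin n × Fin n → ℝ => orderedEigenvalues (hermOf x) :=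
    measurable_orderedEigenvalues.comp (measurable_hermOf n)
  have hI1 : Integrable (fun x : Fin n × Fin n → ℝ => ‖(1 : ℂ)‖
      * Real.exp (L * ∑ j, |orderedEigenvalues (hermOf x) j|)) (gaussPi p (coordVar c)) := by
    refine (integrable_exp_l1_gaussPi p (coordVar c) (L * (n * 2))).mono' ?_
      (Eventually.of_forall fun x => ?_)
    · refine Measurable.aestronglyMeasurable ?_
      have : ∀ j, Measurable fun x : Fin n × Fin n → ℝ => |orderedEigenvalues (hermOf x) j| :=
        fun j => ((measurable_pi_apply j).comp hYm).abs
      fun_prop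
    · rw [norm_one, one_mul, Real.norm_eq_abs, Real.abs_exp, mul_assoc]
      exact Real.exp_le_exp.2 (mul_le_mul_of_nonneg_left (sum_abs_orderedEigenvalues_le x) hL0)
  have hI2 : Integrable (fun y : Fin n → ℝ => ‖evalR y (vand n)‖ * Real.exp (L * ∑ j, |y j|))
      (gaussPi (orderedEigenvalues (hermOf p)) (fun _ => c)) := by
    obtain ⟨K, hK, hKb⟩ := exists_norm_evalR_le (vand n)
    refine ((integrable_exp_l1_gaussPi _ _ (1 + L)).const_mul K).mono' ?_
      (Eventually.of_forall fun y => ?_)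
    · exact ((measurable_evalR _).norm.mul (by fun_prop)).aestronglyMeasurable
    · rw [norm_mul, norm_norm, Real.norm_eq_abs, Real.abs_exp, add_mul, Real.exp_add, one_mul,
        ← mul_assoc]
      exact mul_le_mul_of_nonneg_right (hKb y) (Real.exp_nonneg _)
  have H1 := (hasSum_integral_symChar ξ hYm (G := fun _ => 1) measurable_const hI1).mul_left
    (evalR (orderedEigenvalues (hermOf p)) (vand n))
  have H2 := hasSum_integral_symChar ξ (Y := fun y => y) measurable_id
    (measurable_evalR (vand n)) hI2
  simp only [one_mul] at H1
  refine H1.unique (H2.congr_fun fun k => ?_)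
  obtain ⟨q, hq⟩ := mem_range_psumHom_of_isSymmetric (isSymmetric_symPow ξ k)
  have h := integral_symmetric_eigenvalues p c q
  rw [hq] at h
  simp only [evalR, map_mul] at h ⊢
  rw [← h]
  ring

end MatrixLaw

/-! ### Brownian bridges as time-changed Brownian motions with drift -/

section Bridge

open scoped NNReal

variable {n : ℕ}

lemma measurable_eval_path (t : unitInterval) : Measurable fun f : PathSpace n => f t :=
  (continuous_eval_const t).measurable

lemma measurable_eval_path_apply (t : unitInterval) (j : Fin n) : Measurable fun f : PathSpace n => f t j :=
  (measurable_pi_apply j).comp (measurable_eval_path t)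

/-- The rescaled path `x(t) / (1 - t)`. -/
noncomputable def scaled (t : unitInterval) (f : PathSpace n) (j : Fin n) : ℝ := f t j / (1 - t)

/-- The clock `t / (1 - t)` of the rescaled path. -/
noncomputable def clock (t : unitInterval) : ℝ := t / (1 - t)

lemma measurable_scaled (t : unitInterval) : Measurable (scaled t : PathSpace n → Fin n → ℝ) :=
  measurable_pi_lambda _ fun j => (measurable_eval_path_apply t j).div_const _

lemma one_sub_pos_of_lt {t : unitInterval} (ht : t < 1) : 0 < 1 - (t : ℝ) := by
  have : (t : ℝ) < 1 := by exact_mod_cast ht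
  linarith

lemma clock_mono {t t' : unitInterval} (h : t ≤ t') (ht' : t' < 1) : clock t ≤ clock t' := by
  have h1 := one_sub_pos_of_lt ht'
  have h2 : (t : ℝ) ≤ t' := h
  have h3 : 0 ≤ (t : ℝ) := t.2.1
  exact div_le_div₀ (h3.trans h2) h2 h1 (by linarith)

lemma clock_nonneg (t : unitInterval) : 0 ≤ clock t := div_nonneg t.2.1 (sub_nonneg.2 t.2.2)

variable {σ : ℝ} {a b : Fin n → ℝ} {μ : Measure (PathSpace n)}

/-- The coordinates of all the bridges form a Gaussian process. -/
lemma IsBrownianBridgesLaw.jointly_gaussian (h : IsBrownianBridgesLaw σ a b μ) :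
    IsGaussianProcess (fun (p : Fin n × unitInterval) (f : PathSpace n) => f p.2 p.1) μ where
  hasGaussianLaw J := by
    classical
    -- The index set is enlarged to all particles at all times occurring in `J`, so that
    -- independence of the coordinates gives joint Gaussianity; then one projects back.
    set T := J.image Prod.snd with hT
    have h1 : ∀ j, HasGaussianLaw (fun f : PathSpace n => T.restrict fun t => f t j) μ := fun j =>
      (h.gaussian j).hasGaussianLaw T
    have h2 : iIndepFun (fun j (f : PathSpace n) => T.restrict fun t => f t j) μ :=
      h.indep.comp (fun _ (g : unitInterval → ℝ) => T.restrict g) fun _ => by fun_prop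
    have h3 := iIndepFun.hasGaussianLaw h1 h2
    let L : (Fin n → T → ℝ) →L[ℝ] (J → ℝ) :=
      { toFun x p := x p.1.1 ⟨p.1.2, Finset.mem_image_of_mem _ p.2⟩
        map_add' x y := by ext; simp
        map_smul' c x := by ext; simp }
    exact h3.map L

lemma IsBrownianBridgesLaw.memLp (h : IsBrownianBridgesLaw σ a b μ) (t : unitInterval) (j : Fin n) :
    MemLp (fun f : PathSpace n => f t j) 2 μ :=
  (h.jointly_gaussian.hasGaussianLaw_eval (j, t)).memLp_two

lemma IsBrownianBridgesLaw.covariance_ne (h : IsBrownianBridgesLaw σ a b μ) {i j : Fin n}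
    (hij : i ≠ j) (s t : unitInterval) :
    cov[fun f : PathSpace n => f s i, fun f : PathSpace n => f t j; μ] = 0 := by
  have := h.indep.indepFun hij
  exact (this.comp (measurable_pi_apply s) (measurable_pi_apply t)).covariance_eq_zero
    (h.memLp s i) (h.memLp t j)

/-- The path up to time `t`. -/
def pastMap (t : unitInterval) (f : PathSpace n) (p : Fin n × {u : unitInterval // u ≤ t}) : ℝ := f p.2.1 p.1

lemma measurable_pastMap (t : unitInterval) : Measurable (pastMap t : PathSpace n → _) :=
  measurable_pi_lambda _ fun p => measurable_eval_path_apply p.2.1 p.1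

lemma IsBrownianBridgesLaw.memLp_scaled (h : IsBrownianBridgesLaw σ a b μ) (t : unitInterval) (j : Fin n) :
    MemLp (fun f : PathSpace n => scaled t f j) 2 μ := by
  simp only [scaled, div_eq_inv_mul]
  exact (h.memLp t j).const_mul _

/-- For `u ≤ t` the covariance of `x(u)` with `x(t) / (1 - t)` is `σ² u`, which does not depend on
`t`. The increment is thus uncorrelated with the past, hence independent by joint Gaussianity. -/
lemma IsBrownianBridgesLaw.indepFun_past (h : IsBrownianBridgesLaw σ a b μ) {t t' : unitInterval}
    (htt' : t ≤ t') (ht' : t' < 1) :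
    IndepFun (pastMap t : PathSpace n → _) (fun f j => scaled t' f j - scaled t f j) μ := by
  classical
  have := h.isProbabilityMeasure
  have h0' := one_sub_pos_of_lt ht'
  have h0 := one_sub_pos_of_lt (htt'.trans_lt ht')
  refine IsGaussianProcess.indepFun_of_covariance_eq_zero
    (X := fun (p : Fin n × {u : unitInterval // u ≤ t}) (f : PathSpace n) => f p.2.1 p.1)
    (Y := fun (j : Fin n) (f : PathSpace n) => scaled t' f j - scaled t f j) ?_ ?_ ?_ ?_
  · refine IsGaussianProcess.of_isGaussianProcess h.jointly_gaussian fun s => ?_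
    rcases s with p | j
    · exact ⟨{(p.1, p.2.1)},
        { toFun x := x ⟨(p.1, p.2.1), by simp⟩
          map_add' := by simp
          map_smul' := by simp }, fun f => by simp⟩
    · exact ⟨{(j, t'), (j, t)},
        { toFun x := x ⟨(j, t'), by simp⟩ / (1 - t') - x ⟨(j, t), by simp⟩ / (1 - t)
          map_add' x y := by simp; ring
          map_smul' c x := by simp; ring }, fun f => by simp [scaled]⟩
  · exact fun p => (measurable_eval_path_apply _ _).aemeasurable
  · exact fun j => (((measurable_pi_apply j).comp (measurable_scaled t')).sub
      ((measurable_pi_apply j).comp (measurable_scaled t))).aemeasurable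
  · rintro ⟨i, u, hu⟩ j
    rw [covariance_fun_sub_right (h.memLp u i) (h.memLp_scaled t' j) (h.memLp_scaled t j)]
    simp only [scaled]
    rw [covariance_fun_div_right, covariance_fun_div_right]
    by_cases hij : i = j
    · subst hij
      rw [h.covariance, h.covariance]
      have hu' : (u : ℝ) ≤ t := hu
      have htt'' : (t : ℝ) ≤ t' := htt'
      rw [min_eq_left hu', min_eq_left (hu'.trans htt'')]
      field_simp
      ring
    · rw [h.covariance_ne hij, h.covariance_ne hij]
      simp

/-- The law of an increment over a clock time `δ` of Brownian motion with drift `b` and diffusion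
parameter `σ`. -/
noncomputable def stepLaw (σ : ℝ) (b : Fin n → ℝ) (δ : ℝ≥0) : Measure (Fin n → ℝ) :=
  gaussPi (fun j => b j * δ) fun _ => .mk (σ ^ 2) (sq_nonneg σ) * δ

instance (σ : ℝ) (b : Fin n → ℝ) (δ : ℝ≥0) : IsProbabilityMeasure (stepLaw σ b δ) := by
  unfold stepLaw; infer_instance

/-- The rescaled bridge at time `t` has mean `a + b t / (1 - t)` and variance `σ² t / (1 - t)`: in
the new clock the end point has become the drift. -/
lemma IsBrownianBridgesLaw.map_increment (h : IsBrownianBridgesLaw σ a b μ) {t t' : unitInterval}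
    (htt' : t ≤ t') (ht' : t' < 1) :
    μ.map (fun f j => scaled t' f j - scaled t f j)
      = stepLaw σ b (Real.toNNReal (clock t' - clock t)) := by
  have := h.isProbabilityMeasure
  have h0' := one_sub_pos_of_lt ht'
  have h0 := one_sub_pos_of_lt (htt'.trans_lt ht')
  have hmeas : ∀ j, Measurable fun f : PathSpace n => scaled t' f j - scaled t f j := fun j =>
    ((measurable_pi_apply j).comp (measurable_scaled t')).sub
      ((measurable_pi_apply j).comp (measurable_scaled t))
  have hind : iIndepFun (fun j (f : PathSpace n) => scaled t' f j - scaled t f j) μ :=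
    h.indep.comp (fun _ (g : unitInterval → ℝ) => g t' / (1 - t') - g t / (1 - t)) fun _ => by fun_prop
  rw [(iIndepFun_iff_map_fun_eq_pi_map fun j => (hmeas j).aemeasurable).1 hind, stepLaw, gaussPi]
  congr 1
  funext j
  have hG : HasGaussianLaw (fun f : PathSpace n => scaled t' f j - scaled t f j) μ := by
    have : IsGaussianProcess (fun (t : unitInterval) (f : PathSpace n) => scaled t f j) μ := by
      have h2 := IsGaussianProcess.smul (X := fun (t : unitInterval) (f : PathSpace n) => f t j)
        (fun t => (1 - (t : ℝ))⁻¹) (h.gaussian j)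
      simpa only [scaled, smul_eq_mul, ← div_eq_inv_mul] using h2
    exact this.hasGaussianLaw_fun_sub
  rw [hG.map_eq_gaussianReal]
  have hint : ∀ s : unitInterval, Integrable (fun f : PathSpace n => f s j) μ := fun s =>
    (h.memLp s j).integrable (by norm_num)
  congr 1
  · rw [integral_sub ((h.memLp_scaled t' j).integrable (by norm_num))
      ((h.memLp_scaled t j).integrable (by norm_num))]
    simp only [scaled]
    rw [integral_div, integral_div, h.mean, h.mean,
      Real.coe_toNNReal _ (sub_nonneg.2 (clock_mono htt' ht')), clock, clock]
    field_simp
    ring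
  · have hvar : Var[fun f : PathSpace n => scaled t' f j - scaled t f j; μ]
        = σ ^ 2 * (clock t' - clock t) := by
      have hmin : min (t : ℝ) t' = t := min_eq_left htt'
      rw [← covariance_self (hmeas j).aemeasurable,
        covariance_fun_sub_fun_sub (h.memLp_scaled t' j) (h.memLp_scaled t j)
          (h.memLp_scaled t' j) (h.memLp_scaled t j)]
      simp only [scaled]
      simp only [covariance_fun_div_right, covariance_fun_div_left, h.covariance, min_self, hmin,
        min_comm (t' : ℝ) t, clock]
      field_simp
      ring
    rw [hvar]
    ext
    simp [Real.coe_toNNReal _ (mul_nonneg (sq_nonneg σ) (sub_nonneg.2 (clock_mono htt' ht'))),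
      Real.coe_toNNReal _ (sub_nonneg.2 (clock_mono htt' ht'))]

/-- The Markov property of the rescaled path. -/
lemma IsBrownianBridgesLaw.markov (h : IsBrownianBridgesLaw σ a b μ) {t t' : unitInterval}
    (htt' : t ≤ t') (ht' : t' < 1) {ζ : (Fin n × {u : unitInterval // u ≤ t} → ℝ) → ℝ} (hζ : Measurable ζ)
    {g : (Fin n → ℝ) → ℝ} (hg : Measurable g)
    (hint : Integrable (fun f => ζ (pastMap t f) * g (scaled t' f)) μ) :
    ∫ f, ζ (pastMap t f) * g (scaled t' f) ∂μ
      = ∫ f, ζ (pastMap t f) * ∫ y, g (scaled t f + y)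
          ∂stepLaw σ b (Real.toNNReal (clock t' - clock t)) ∂μ := by
  have := h.isProbabilityMeasure
  set inc : PathSpace n → Fin n → ℝ := fun f j => scaled t' f j - scaled t f j with hinc
  have hincm : Measurable inc := measurable_pi_lambda _ fun j =>
    ((measurable_pi_apply j).comp (measurable_scaled t')).sub
      ((measurable_pi_apply j).comp (measurable_scaled t))
  set Yp : (Fin n × {u : unitInterval // u ≤ t} → ℝ) → Fin n → ℝ := fun x j => x (j, ⟨t, le_rfl⟩) / (1 - t)
    with hYp
  have hYpm : Measurable Yp := by fun_prop
  have hYeq : ∀ f, Yp (pastMap t f) = scaled t f := fun f => rfl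
  have hprod := (indepFun_iff_map_prod_eq_prod_map_map (measurable_pastMap t).aemeasurable
    hincm.aemeasurable).1 (h.indepFun_past htt' ht')
  rw [h.map_increment htt' ht'] at hprod
  set F : (Fin n × {u : unitInterval // u ≤ t} → ℝ) × (Fin n → ℝ) → ℝ := fun z => ζ z.1 * g (Yp z.1 + z.2)
    with hF
  have hFm : Measurable F := by fun_prop
  have hFeq : ∀ f, ζ (pastMap t f) * g (scaled t' f) = F (pastMap t f, inc f) := by
    intro f
    simp only [hF, hYeq]
    congr 2
    funext j
    simp [hinc]
  have hpm : Measurable fun f => (pastMap t f, inc f) := (measurable_pastMap t).prodMk hincm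
  have := Measure.isProbabilityMeasure_map (μ := μ) (measurable_pastMap (n := n) t).aemeasurable
  simp_rw [hFeq] at hint ⊢
  have hint' : Integrable F ((μ.map (pastMap t)).prod
      (stepLaw σ b (Real.toNNReal (clock t' - clock t)))) := by
    rw [← hprod, integrable_map_measure hFm.aestronglyMeasurable hpm.aemeasurable]
    exact hint
  rw [← integral_map (f := F) hpm.aemeasurable hFm.aestronglyMeasurable, hprod,
    integral_prod _ hint', integral_map (measurable_pastMap t).aemeasurable
      hint'.1.integral_prod_right']
  refine integral_congr_ae (Eventually.of_forall fun f => ?_)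
  simp only [hF, hYeq, integral_const_mul]

/-- The variance condition holds at `t = 0` and `t = 1`; a Gaussian variable without variance equals
its mean almost surely. -/
lemma IsBrownianBridgesLaw.ae_eq_of_variance (h : IsBrownianBridgesLaw σ a b μ) {t : unitInterval} {c : Fin n → ℝ}
    (ht : (t : ℝ) - t * t = 0) (hc : ∀ j, (1 - (t : ℝ)) * a j + t * b j = c j) :
    ∀ᵐ f ∂μ, f t = c := by
  have := h.isProbabilityMeasure
  have h1 : ∀ j, ∀ᵐ f ∂μ, f t j = c j := by
    intro j
    have hG : HasGaussianLaw (fun f : PathSpace n => f t j) μ :=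
      (h.gaussian j).hasGaussianLaw_eval t
    have hm := (measurable_eval_path_apply (n := n) t j).aemeasurable (μ := μ)
    have hlaw := hG.map_eq_gaussianReal
    rw [← covariance_self hm, h.covariance, min_self, ht, mul_zero, Real.toNNReal_zero,
      gaussianReal_zero_var, h.mean, hc] at hlaw
    have : ∀ᵐ y ∂(μ.map fun f : PathSpace n => f t j), y = c j := by
      rw [hlaw, ae_dirac_eq]; rfl
    exact ae_of_ae_map hm this
  filter_upwards [ae_all_iff.2 h1] with f hf using funext hf

lemma IsBrownianBridgesLaw.ae_start (h : IsBrownianBridgesLaw σ a b μ) : ∀ᵐ f ∂μ, f 0 = a :=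
  h.ae_eq_of_variance (by simp) (by simp)

lemma IsBrownianBridgesLaw.ae_end (h : IsBrownianBridgesLaw σ a b μ) : ∀ᵐ f ∂μ, f 1 = b :=
  h.ae_eq_of_variance (by simp) (by simp)

end Bridge

/-! ### The noncrossing weight of Brownian motions with linearly increasing drifts -/

section Weight

open scoped NNReal

variable {n : ℕ}

/-- The pairs of indices `i < j`. -/
def ltPairs (n : ℕ) : Finset (Fin n × Fin n) := Finset.univ.filter fun p => p.1 < p.2

lemma mem_ltPairs {p : Fin n × Fin n} : p ∈ ltPairs n ↔ p.1 < p.2 := by simp [ltPairs]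

lemma prod_ltPairs {M : Type*} [CommMonoid M] (g : Fin n → Fin n → M) :
    ∏ p ∈ ltPairs n, g p.1 p.2 = ∏ i, ∏ j ∈ Finset.Ioi i, g i j :=
  Finset.prod_finset_product' _ _ _ fun p => by simp [mem_ltPairs]

/-- `∏_{i<j} (1 - exp (-θ (x j - x i)))`, the probability that Brownian motions started at `x` with
drifts proportional to `θ j` never collide. -/
noncomputable def noncross (θ : ℝ) (x : Fin n → ℝ) : ℝ :=
  ∏ p ∈ ltPairs n, (1 - Real.exp (-(θ * (x p.2 - x p.1))))

/-- `∑_j j x_j`. -/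
def levelSum (x : Fin n → ℝ) : ℝ := ∑ j : Fin n, (j : ℝ) * x j

lemma levelSum_add (x y : Fin n → ℝ) : levelSum (x + y) = levelSum x + levelSum y := by
  simp [levelSum, mul_add, Finset.sum_add_distrib]

lemma sum_ltPairs_snd (x : Fin n → ℝ) : ∑ p ∈ ltPairs n, x p.2 = levelSum x := by
  have h : ∑ p ∈ ltPairs n, x p.2 = ∑ j : Fin n, ∑ i ∈ Finset.Iio j, x j :=
    Finset.sum_finset_product_right' (f := fun _ j => x j) _ _ _ fun p => by
      simp [mem_ltPairs]
  simp [h, levelSum]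

/-- Multiply the factor of the pair `i < j` by `exp (θ x_j)`. The index `j` is the larger one in
exactly `j` pairs, whence `levelSum`. -/
lemma noncross_mul_exp (θ : ℝ) (x : Fin n → ℝ) :
    noncross θ x * Real.exp (θ * levelSum x)
      = (Matrix.vandermonde fun i => Real.exp (θ * x i)).det := by
  rw [Matrix.det_vandermonde,
    ← prod_ltPairs fun i j => Real.exp (θ * x j) - Real.exp (θ * x i),
    ← sum_ltPairs_snd, Finset.mul_sum, Real.exp_sum, noncross, ← Finset.prod_mul_distrib]
  refine Finset.prod_congr rfl fun p _ => ?_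
  rw [sub_mul, one_mul, ← Real.exp_add]
  ring_nf

lemma vandermonde_exp_swap (θ : ℝ) (x : Fin n → ℝ) {i j : Fin n} (hij : i ≠ j) :
    (Matrix.vandermonde fun k => Real.exp (θ * x (Equiv.swap i j k))).det
      = -(Matrix.vandermonde fun k => Real.exp (θ * x k)).det := by
  have := Matrix.det_permute (Equiv.swap i j) (Matrix.vandermonde fun k => Real.exp (θ * x k))
  rw [Equiv.Perm.sign_swap hij] at this
  simpa [Matrix.submatrix, Matrix.vandermonde] using this

/-- The drift vector `(θ j)_j` times the diffusivity. -/
noncomputable def levelDrift (σ θ : ℝ) (j : Fin n) : ℝ := σ ^ 2 * θ * j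

/-- The Cameron–Martin formula in dimension one. Variance zero is allowed, since steps of clock
length zero occur; both sides are then the point mass at `0`. -/
lemma gaussianReal_eq_withDensity (c : ℝ) (w : ℝ≥0) :
    gaussianReal (w * c) w = (gaussianReal 0 w).withDensity
      fun y => ENNReal.ofReal (Real.exp (c * y - w * c ^ 2 / 2)) := by
  by_cases hw : w = 0
  · subst hw
    simp only [NNReal.coe_zero, zero_mul, gaussianReal_zero_var, zero_div, sub_zero]
    ext s hs
    rw [withDensity_apply _ hs, ← lintegral_indicator hs,
      lintegral_dirac' _ (Measurable.indicator (by fun_prop) hs)]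
    by_cases h0 : (0 : ℝ) ∈ s <;> simp [Measure.dirac_apply' _ hs, h0]
  · rw [gaussianReal_of_var_ne_zero _ hw, gaussianReal_of_var_ne_zero _ hw,
      ← withDensity_mul _ (measurable_gaussianPDF _ _) (by fun_prop)]
    congr 1
    funext y
    have hw' : (w : ℝ) ≠ 0 := by exact_mod_cast hw
    simp only [Pi.mul_apply, gaussianPDF]
    rw [← ENNReal.ofReal_mul (gaussianPDFReal_nonneg _ _ _), gaussianPDFReal, gaussianPDFReal,
      mul_assoc _ (Real.exp _) (Real.exp _), ← Real.exp_add]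
    congr 3
    field_simp
    ring

/-- The variance of a step. -/
noncomputable def stepVar (σ : ℝ) (δ : ℝ≥0) : ℝ≥0 := .mk (σ ^ 2) (sq_nonneg σ) * δ

lemma coe_stepVar (σ : ℝ) (δ : ℝ≥0) : (stepVar σ δ : ℝ) = σ ^ 2 * δ := by simp [stepVar]

lemma stepLaw_eq_withDensity (σ θ : ℝ) (δ : ℝ≥0) :
    stepLaw σ (levelDrift (n := n) σ θ) δ
      = (gaussPi 0 fun _ => stepVar σ δ).withDensity fun y => ENNReal.ofReal
          (∏ j : Fin n, Real.exp (θ * j * y j - stepVar σ δ * (θ * j) ^ 2 / 2)) := by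
  have hint : ∀ c : ℝ, Integrable (fun y => Real.exp (c * y - stepVar σ δ * c ^ 2 / 2))
      (gaussianReal 0 (stepVar σ δ)) := fun c => by
    simp only [Real.exp_sub]
    exact (integrable_exp_mul_gaussianReal c).div_const _
  have h := pi_withDensity_ofReal (fun _ : Fin n => gaussianReal 0 (stepVar σ δ))
    (fun j y => Real.exp (θ * j * y - stepVar σ δ * (θ * j) ^ 2 / 2))
    (fun _ _ => (Real.exp_pos _).le) (fun j => hint _)
  simp only [gaussPi, Pi.zero_apply]
  rw [← h, stepLaw, gaussPi]
  congr 1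
  funext j
  rw [← gaussianReal_eq_withDensity]
  congr 1
  rw [coe_stepVar, levelDrift]
  ring

/-- The normalizing exponent in the Cameron–Martin formula. -/
noncomputable def cmConst (n : ℕ) (σ θ : ℝ) (δ : ℝ≥0) : ℝ :=
  stepVar σ δ * θ ^ 2 / 2 * ∑ j : Fin n, (j : ℝ) ^ 2

lemma integral_stepLaw (σ θ : ℝ) (δ : ℝ≥0) (h : (Fin n → ℝ) → ℝ) :
    ∫ y, h y ∂stepLaw σ (levelDrift σ θ) δ
      = Real.exp (-cmConst n σ θ δ)
        * ∫ y, h y * Real.exp (θ * levelSum y) ∂gaussPi 0 fun _ => stepVar σ δ := by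
  rw [stepLaw_eq_withDensity, integral_withDensity_eq_integral_toReal_smul (by fun_prop)
    (Eventually.of_forall fun _ => ENNReal.ofReal_lt_top), ← integral_const_mul]
  refine integral_congr_ae (Eventually.of_forall fun y => ?_)
  simp only
  rw [ENNReal.toReal_ofReal (Finset.prod_nonneg fun _ _ => (Real.exp_pos _).le), ← Real.exp_sum,
    smul_eq_mul, mul_comm (h y), ← mul_assoc, ← Real.exp_add]
  congr 2
  rw [Finset.sum_sub_distrib, cmConst, levelSum, Finset.mul_sum, Finset.mul_sum, neg_add_eq_sub]
  congr 1 <;> exact Finset.sum_congr rfl fun _ _ => by ring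

/-- The tilt that removes the drift is the one that turns `noncross` into a Vandermonde determinant.
What remains is an antisymmetric function under an exchangeable Gaussian law. -/
lemma integral_mul_noncross (σ θ : ℝ) (δ : ℝ≥0) (f : (Fin n → ℝ) → ℝ) (x : Fin n → ℝ) :
    (∫ y, f (x + y) * noncross θ (x + y) ∂stepLaw σ (levelDrift σ θ) δ)
        * Real.exp (θ * levelSum x)
      = Real.exp (-cmConst n σ θ δ)
        * ∫ y, f (x + y) * (Matrix.vandermonde fun i => Real.exp (θ * (x i + y i))).det
            ∂gaussPi 0 fun _ => stepVar σ δ := by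
  rw [integral_stepLaw, mul_assoc, ← integral_mul_const]
  congr 1
  refine integral_congr_ae (Eventually.of_forall fun y => ?_)
  have := noncross_mul_exp θ (x + y)
  rw [levelSum_add, mul_add, Real.exp_add] at this
  simp only [Pi.add_apply] at this
  simp only [← this]
  ring

lemma measurePreserving_comp_perm (w : ℝ≥0) (τ : Equiv.Perm (Fin n)) :
    MeasurePreserving (fun y : Fin n → ℝ => y ∘ τ) (gaussPi 0 fun _ => w) (gaussPi 0 fun _ => w) := by
  have h := measurePreserving_piCongrLeft (fun _ : Fin n => gaussianReal 0 w) τ.symm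
  convert h using 1
  swap; · rfl
  swap; · rfl
  funext y
  funext i
  have := Equiv.piCongrLeft_apply_apply (fun _ : Fin n => ℝ) τ.symm y (τ i)
  simpa [MeasurableEquiv.coe_piCongrLeft] using this.symm

/-- Swapping the coordinates `i` and `j` fixes `x`, preserves `f` and the driftless Gaussian, and
changes the sign of the determinant. So the integral equals its negative. -/
lemma integral_noncross_eq_zero (σ θ : ℝ) (δ : ℝ≥0) {f : (Fin n → ℝ) → ℝ}
    (hf : ∀ x (τ : Equiv.Perm (Fin n)), f (x ∘ τ) = f x) {x : Fin n → ℝ} {i j : Fin n}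
    (hij : i ≠ j) (hx : x i = x j) :
    ∫ y, f (x + y) * noncross θ (x + y) ∂stepLaw σ (levelDrift σ θ) δ = 0 := by
  have h := integral_mul_noncross σ θ δ f x
  set τ := Equiv.swap i j with hτ
  have hxτ : ∀ k, x (τ k) = x k := by
    intro k
    rw [hτ, Equiv.swap_apply_def]
    split_ifs with h1 h2
    · rw [h1, hx]
    · rw [h2, hx]
    · rfl
  have hmp := measurePreserving_comp_perm (stepVar σ δ) τ
  have hemb : MeasurableEmbedding fun y : Fin n → ℝ => y ∘ τ :=
    hmp.measurable.measurableEmbedding fun y z hyz => by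
      funext k
      have := congrFun hyz (τ.symm k)
      simpa using this
  have h2 := hmp.integral_comp hemb fun y =>
    f (x + y) * (Matrix.vandermonde fun i => Real.exp (θ * (x i + y i))).det
  have h3 : ∀ y : Fin n → ℝ, f (x + y ∘ τ)
        * (Matrix.vandermonde fun i => Real.exp (θ * (x i + (y ∘ τ) i))).det
      = -(f (x + y) * (Matrix.vandermonde fun i => Real.exp (θ * (x i + y i))).det) := by
    intro y
    have e1 : x + y ∘ τ = (x + y) ∘ τ := by
      funext k; simp [hxτ]
    have e2 := vandermonde_exp_swap θ (x + y) hij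
    rw [← hτ] at e2
    rw [e1, hf, ← mul_neg]
    simp only [Pi.add_apply, hxτ] at e2
    rw [← e2]
    rfl
  simp only [h3, integral_neg] at h2
  have h4 : (∫ y, f (x + y) * (Matrix.vandermonde fun i => Real.exp (θ * (x i + y i))).det
      ∂gaussPi 0 fun _ => stepVar σ δ) = 0 := by linarith
  rw [h4, mul_zero] at h
  exact (mul_eq_zero.1 h).resolve_right (Real.exp_pos _).ne'

/-- The noncrossing weight is harmonic. -/
lemma integral_noncross (σ θ : ℝ) (δ : ℝ≥0) (x : Fin n → ℝ) :
    ∫ y, noncross θ (x + y) ∂stepLaw σ (levelDrift σ θ) δ = noncross θ x := by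
  have h := integral_mul_noncross σ θ δ (fun _ => 1) x
  simp only [one_mul] at h
  refine mul_right_cancel₀ (Real.exp_pos (θ * levelSum x)).ne' ?_
  rw [h, noncross_mul_exp, ← Matrix.det_transpose, Matrix.det_apply]
  have hdet : ∀ y : Fin n → ℝ, (Matrix.vandermonde fun i => Real.exp (θ * (x i + y i))).det
      = ∑ τ : Equiv.Perm (Fin n), (τ.sign : ℝ) * (∏ i, Real.exp (θ * x i) ^ (τ i : ℕ))
          * ∏ i, Real.exp (θ * (τ i : ℕ) * y i) := by
    intro y
    rw [← Matrix.det_transpose, Matrix.det_apply']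
    refine Finset.sum_congr rfl fun τ _ => ?_
    rw [mul_assoc, ← Finset.prod_mul_distrib]
    congr 1
    refine Finset.prod_congr rfl fun i _ => ?_
    simp only [Matrix.transpose_apply, Matrix.vandermonde_apply]
    rw [← Real.exp_nat_mul, ← Real.exp_nat_mul, ← Real.exp_add]
    ring_nf
  -- All terms of the determinant grow by the same factor, because the sum of `τ(i)²` is independent
  -- of `τ`. That factor cancels the Cameron–Martin constant.
  have hI : ∀ τ : Equiv.Perm (Fin n), ∫ y : Fin n → ℝ, ∏ i, Real.exp (θ * (τ i : ℕ) * y i)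
      ∂gaussPi 0 (fun _ => stepVar σ δ) = Real.exp (cmConst n σ θ δ) := by
    intro τ
    simp only [gaussPi, Pi.zero_apply]
    rw [integral_fintype_prod_eq_prod (μ := fun _ : Fin n => gaussianReal 0 (stepVar σ δ))
      (f := fun (i : Fin n) (y : ℝ) => Real.exp (θ * (τ i : ℕ) * y))]
    have : ∀ c : ℝ, ∫ y, Real.exp (c * y) ∂gaussianReal 0 (stepVar σ δ)
        = Real.exp (stepVar σ δ * c ^ 2 / 2) := by
      intro c
      have := congrFun (mgf_id_gaussianReal (μ := 0) (v := stepVar σ δ)) c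
      simpa [mgf] using this
    simp only [this, ← Real.exp_sum]
    congr 1
    rw [Equiv.sum_comp τ fun i : Fin n => (stepVar σ δ : ℝ) * (θ * (i : ℕ)) ^ 2 / 2, cmConst,
      Finset.mul_sum]
    exact Finset.sum_congr rfl fun _ _ => by ring
  have hint : ∀ τ : Equiv.Perm (Fin n), Integrable
      (fun y : Fin n → ℝ => ∏ i, Real.exp (θ * (τ i : ℕ) * y i))
      (gaussPi 0 (fun _ => stepVar σ δ)) := fun τ =>
    Integrable.fintype_prod (μ := fun _ : Fin n => gaussianReal 0 (stepVar σ δ))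
      (f := fun (i : Fin n) (y : ℝ) => Real.exp (θ * (τ i : ℕ) * y))
      fun i => integrable_exp_mul_gaussianReal _
  simp only [hdet]
  rw [integral_finsetSum _ fun τ _ => (hint τ).const_mul _]
  simp only [integral_const_mul, hI]
  rw [← Finset.sum_mul, mul_comm, mul_assoc, ← Real.exp_add, add_neg_cancel, Real.exp_zero, mul_one]
  refine Finset.sum_congr rfl fun τ _ => ?_
  simp [Matrix.vandermonde_apply, Units.smul_def]

end Weight

/-! ### Bounds for the noncrossing weight near a collision -/

section Bounds

open scoped NNReal

variable {n : ℕ}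

lemma abs_exp_sub_exp_le {p q B : ℝ} (hp : Real.exp p ≤ B) (hq : Real.exp q ≤ B) :
    |Real.exp p - Real.exp q| ≤ |p - q| * B := by
  wlog h : q ≤ p generalizing p q
  · rw [abs_sub_comm, abs_sub_comm p]
    exact this hq hp (le_of_not_ge h)
  rw [abs_of_nonneg (sub_nonneg.2 (Real.exp_le_exp.2 h)), abs_of_nonneg (sub_nonneg.2 h)]
  have h1 : Real.exp q = Real.exp p * Real.exp (q - p) := by rw [← Real.exp_add]; ring_nf
  have h2 := Real.add_one_le_exp (q - p)
  calc Real.exp p - Real.exp q = (1 - Real.exp (q - p)) * Real.exp p := by rw [h1]; ring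
    _ ≤ (p - q) * Real.exp p :=
        mul_le_mul_of_nonneg_right (by linarith) (Real.exp_pos p).le
    _ ≤ (p - q) * B := mul_le_mul_of_nonneg_left hp (sub_nonneg.2 h)

lemma abs_prod_le_pow_card {ι : Type*} (s : Finset ι) {a : ι → ℝ} {B : ℝ}
    (ha : ∀ i ∈ s, |a i| ≤ B) : |∏ i ∈ s, a i| ≤ B ^ s.card := by
  rw [Finset.abs_prod, ← Finset.prod_const]
  exact Finset.prod_le_prod (fun _ _ => abs_nonneg _) ha

/-- Telescoping. Measuring closeness as `ε * B` keeps the exponent of `B` equal to the number of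
factors throughout the induction. -/
lemma abs_prod_sub_prod_le {ι : Type*} (s : Finset ι) {a b : ι → ℝ} {B ε : ℝ} (hB : 0 ≤ B)
    (ha : ∀ i ∈ s, |a i| ≤ B) (hb : ∀ i ∈ s, |b i| ≤ B) (hab : ∀ i ∈ s, |a i - b i| ≤ ε * B) :
    |∏ i ∈ s, a i - ∏ i ∈ s, b i| ≤ s.card * ε * B ^ s.card := by
  classical
  induction s using Finset.induction_on with
  | empty => simp
  | insert i s hi ih =>
    have ih' := ih (fun k hk => ha k (Finset.mem_insert_of_mem hk))
      (fun k hk => hb k (Finset.mem_insert_of_mem hk))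
      (fun k hk => hab k (Finset.mem_insert_of_mem hk))
    have hpb : |∏ k ∈ s, b k| ≤ B ^ s.card :=
      abs_prod_le_pow_card s fun k hk => hb k (Finset.mem_insert_of_mem hk)
    have hεB : 0 ≤ ε * B := (abs_nonneg _).trans (hab i (Finset.mem_insert_self i s))
    have hai := ha i (Finset.mem_insert_self i s)
    have habi := hab i (Finset.mem_insert_self i s)
    rw [Finset.prod_insert hi, Finset.prod_insert hi, Finset.card_insert_of_notMem hi]
    have e : a i * ∏ k ∈ s, a k - b i * ∏ k ∈ s, b k
        = a i * (∏ k ∈ s, a k - ∏ k ∈ s, b k) + (a i - b i) * ∏ k ∈ s, b k := by ring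
    rw [e]
    refine (abs_add_le _ _).trans ?_
    rw [abs_mul, abs_mul]
    calc |a i| * |∏ k ∈ s, a k - ∏ k ∈ s, b k| + |a i - b i| * |∏ k ∈ s, b k|
        ≤ B * (s.card * ε * B ^ s.card) + ε * B * B ^ s.card := by gcongr
      _ = _ := by push_cast; ring

/-- A bound for the factors of the noncrossing weight at `x + y`, for `x` almost ordered. -/
noncomputable def stepBd (θ : ℝ) (y : Fin n → ℝ) : ℝ := 2 * Real.exp (θ * (1 + 2 * ∑ i, |y i|))

lemma stepBd_nonneg (θ : ℝ) (y : Fin n → ℝ) : 0 ≤ stepBd θ y := by unfold stepBd; positivity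

lemma abs_le_l1 (y : Fin n → ℝ) (i : Fin n) : |y i| ≤ ∑ i, |y i| :=
  Finset.single_le_sum (f := fun i => |y i|) (fun _ _ => abs_nonneg _) (Finset.mem_univ i)

/-- A disorder of up to `1` is allowed because the bound is also applied after one particle has been
moved onto another, possibly past its neighbours. -/
lemma exp_factor_le {θ : ℝ} (hθ : 0 ≤ θ) {x : Fin n → ℝ} {i j : Fin n} (hx : x i - x j ≤ 1)
    (y : Fin n → ℝ) :
    Real.exp (-(θ * ((x + y) j - (x + y) i))) ≤ Real.exp (θ * (1 + 2 * ∑ i, |y i|)) := by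
  have h1 := (abs_le.1 (abs_le_l1 y i)).2
  have h2 := (abs_le.1 (abs_le_l1 y j)).1
  rw [Real.exp_le_exp, ← mul_neg]
  refine mul_le_mul_of_nonneg_left ?_ hθ
  simp only [Pi.add_apply]
  linarith

lemma abs_factor_le {θ : ℝ} (hθ : 0 ≤ θ) {x : Fin n → ℝ} {i j : Fin n} (hx : x i - x j ≤ 1)
    (y : Fin n → ℝ) :
    |1 - Real.exp (-(θ * ((x + y) j - (x + y) i)))| ≤ stepBd θ y := by
  have h1 := exp_factor_le hθ hx y
  have h2 : 1 ≤ Real.exp (θ * (1 + 2 * ∑ i, |y i|)) := Real.one_le_exp (by positivity)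
  have h3 := Real.exp_pos (-(θ * ((x + y) j - (x + y) i)))
  rw [stepBd, abs_le]
  constructor <;> linarith

lemma abs_noncross_le {θ : ℝ} (hθ : 0 ≤ θ) {x : Fin n → ℝ} (hx : ∀ i j, i < j → x i - x j ≤ 1)
    (y : Fin n → ℝ) : |noncross θ (x + y)| ≤ stepBd θ y ^ (ltPairs n).card :=
  abs_prod_le_pow_card _ fun _ hp =>
    abs_factor_le hθ (hx _ _ (mem_ltPairs.1 hp)) y

lemma abs_noncross_sub_le {θ η : ℝ} (hθ : 0 ≤ θ) {x x' : Fin n → ℝ}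
    (hx : ∀ i j, i < j → x i - x j ≤ 1) (hx' : ∀ i j, i < j → x' i - x' j ≤ 1)
    (hd : ∀ i j, i < j → |(x i - x j) - (x' i - x' j)| ≤ η) (y : Fin n → ℝ) :
    |noncross θ (x + y) - noncross θ (x' + y)|
      ≤ (ltPairs n).card * (θ * η) * stepBd θ y ^ (ltPairs n).card := by
  refine abs_prod_sub_prod_le _ (stepBd_nonneg θ y)
    (fun p hp => abs_factor_le hθ (hx _ _ (mem_ltPairs.1 hp)) y)
    (fun p hp => abs_factor_le hθ (hx' _ _ (mem_ltPairs.1 hp)) y) fun p hp => ?_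
  have hp := mem_ltPairs.1 hp
  have hB : Real.exp (θ * (1 + 2 * ∑ i, |y i|)) ≤ stepBd θ y := by
    rw [stepBd]; linarith [Real.exp_pos (θ * (1 + 2 * ∑ i, |y i|))]
  have h := abs_exp_sub_exp_le ((exp_factor_le hθ (hx _ _ hp) y).trans hB)
    ((exp_factor_le hθ (hx' _ _ hp) y).trans hB)
  rw [sub_sub_sub_cancel_left, abs_sub_comm]
  refine h.trans (mul_le_mul_of_nonneg_right ?_ (stepBd_nonneg θ y))
  have e : -(θ * ((x + y) p.2 - (x + y) p.1)) - -(θ * ((x' + y) p.2 - (x' + y) p.1))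
      = θ * ((x p.1 - x p.2) - (x' p.1 - x' p.2)) := by simp only [Pi.add_apply]; ring
  rw [e, abs_mul, abs_of_nonneg hθ]
  exact mul_le_mul_of_nonneg_left (hd _ _ hp) hθ

lemma measurable_noncross (θ : ℝ) : Measurable (noncross θ : (Fin n → ℝ) → ℝ) := by
  unfold noncross; fun_prop

lemma stepBd_pow (θ : ℝ) (y : Fin n → ℝ) (N : ℕ) :
    stepBd θ y ^ N = 2 ^ N * Real.exp (N * θ) * Real.exp (2 * N * θ * ∑ i, |y i|) := by
  rw [stepBd, mul_pow, ← Real.exp_nat_mul, mul_assoc, ← Real.exp_add]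
  ring_nf

lemma integrable_stepBd_pow (σ : ℝ) (b : Fin n → ℝ) (δ : ℝ≥0) (θ : ℝ) (N : ℕ) :
    Integrable (fun y => stepBd θ y ^ N) (stepLaw σ b δ) := by
  simp only [stepBd_pow]
  exact (integrable_exp_l1_gaussPi _ _ _).const_mul _

lemma stepLaw_eq_map (σ : ℝ) (b : Fin n → ℝ) (δ : ℝ≥0) :
    stepLaw σ b δ
      = (gaussPi 0 fun _ => 1).map fun z i => b i * δ + √(σ ^ 2 * δ) * z i := by
  rw [gaussPi_map_affine, stepLaw]
  congr 1
  · simp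
  · funext _
    ext
    have h := Real.sq_sqrt (show 0 ≤ σ ^ 2 * (δ : ℝ) by positivity)
    simp only [NNReal.coe_mul, NNReal.coe_mk, mul_one, h]

/-- Steps of every length are affine images of one standard Gaussian, with coefficients increasing
in `δ`; this makes the bound uniform up to `S`. -/
lemma exists_integral_exp_l1_le (σ : ℝ) (b : Fin n → ℝ) (S : ℝ≥0) {c : ℝ} (hc : 0 ≤ c) :
    ∃ C : ℝ, 0 ≤ C ∧ ∀ δ : ℝ≥0, δ ≤ S →
      ∫ y, Real.exp (c * ∑ i, |y i|) ∂stepLaw σ b δ ≤ C := by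
  set A : ℝ := c * ∑ i, |b i| * S with hA
  set r : ℝ := c * √(σ ^ 2 * S) with hr
  refine ⟨∫ z : Fin n → ℝ, Real.exp A * Real.exp (r * ∑ i, |z i|) ∂gaussPi 0 fun _ => 1,
    integral_nonneg fun _ => by positivity, fun δ hδ => ?_⟩
  have hδ' : (δ : ℝ) ≤ S := hδ
  have hm : Measurable fun (z : Fin n → ℝ) i => b i * (δ : ℝ) + √(σ ^ 2 * δ) * z i := by fun_prop
  have hm' : Measurable fun y : Fin n → ℝ => Real.exp (c * ∑ i, |y i|) := by fun_prop
  rw [stepLaw_eq_map, integral_map hm.aemeasurable hm'.aestronglyMeasurable]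
  refine integral_mono_of_nonneg (Eventually.of_forall fun _ => (Real.exp_pos _).le)
    ((integrable_exp_l1_gaussPi _ _ _).const_mul _) (Eventually.of_forall fun z => ?_)
  simp only
  rw [← Real.exp_add, Real.exp_le_exp, hA, hr, mul_assoc, ← mul_add]
  refine mul_le_mul_of_nonneg_left ?_ hc
  rw [Finset.mul_sum, ← Finset.sum_add_distrib]
  refine Finset.sum_le_sum fun i _ => (abs_add_le _ _).trans ?_
  rw [abs_mul, abs_mul, abs_of_nonneg (NNReal.coe_nonneg δ), abs_of_nonneg (Real.sqrt_nonneg _)]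
  gcongr

/-- Symmetric bounded Lipschitz functions. -/
structure SymLip (K : ℝ) (f : (Fin n → ℝ) → ℝ) : Prop where
  cont : Continuous f
  symm : ∀ x (τ : Equiv.Perm (Fin n)), f (x ∘ τ) = f x
  bdd : ∀ x, |f x| ≤ K
  lip : ∀ x y, |f x - f y| ≤ K * ∑ i, |x i - y i|

lemma SymLip.nonneg {K : ℝ} {f : (Fin n → ℝ) → ℝ} (hf : SymLip K f) : 0 ≤ K :=
  (abs_nonneg _).trans (hf.bdd 0)

lemma SymLip.one : SymLip 1 fun _ : Fin n → ℝ => (1 : ℝ) :=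
  ⟨continuous_const, fun _ _ => rfl, fun _ => by simp, fun x y => by simp; positivity⟩

lemma SymLip.comp_mul {K : ℝ} {f : (Fin n → ℝ) → ℝ} (hf : SymLip K f) {r : ℝ} (hr0 : 0 ≤ r)
    (hr1 : r ≤ 1) : SymLip K fun x : Fin n → ℝ => f fun i => r * x i where
  cont := hf.cont.comp (by fun_prop)
  symm x τ := hf.symm (fun i => r * x i) τ
  bdd x := hf.bdd _
  lip x y := by
    refine (hf.lip _ _).trans (mul_le_mul_of_nonneg_left (Finset.sum_le_sum fun i _ => ?_) hf.nonneg)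
    rw [← mul_sub, abs_mul, abs_of_nonneg hr0]
    exact mul_le_of_le_one_left (abs_nonneg _) hr1

lemma integrable_mul_noncross {θ K : ℝ} (hθ : 0 ≤ θ) {f : (Fin n → ℝ) → ℝ} (hf : SymLip K f)
    {x : Fin n → ℝ} (hx : ∀ i j, i < j → x i - x j ≤ 1) (σ : ℝ) (b : Fin n → ℝ) (δ : ℝ≥0) :
    Integrable (fun y => f (x + y) * noncross θ (x + y)) (stepLaw σ b δ) := by
  have hm : Measurable fun y => f (x + y) * noncross θ (x + y) :=
    (hf.cont.measurable.comp (by fun_prop)).mul ((measurable_noncross θ).comp (by fun_prop))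
  refine ((integrable_stepBd_pow σ b δ θ (ltPairs n).card).const_mul K).mono'
    hm.aestronglyMeasurable (Eventually.of_forall fun y => ?_)
  rw [Real.norm_eq_abs, abs_mul]
  exact mul_le_mul (hf.bdd _) (abs_noncross_le hθ hx y) (abs_nonneg _) hf.nonneg

/-- Propagating a symmetric function times the noncrossing weight gives a function that is small
near collisions. -/
lemma exists_abs_integral_le (σ : ℝ) {θ K : ℝ} (hθ : 0 ≤ θ) {f : (Fin n → ℝ) → ℝ}
    (hf : SymLip K f) (S : ℝ≥0) :
    ∃ C : ℝ, 0 ≤ C ∧ ∀ δ : ℝ≥0, δ ≤ S → ∀ x : Fin n → ℝ, Monotone x → ∀ η : ℝ, η ≤ 1 →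
      ∀ i j, i < j → x j - x i ≤ η →
        |∫ y, f (x + y) * noncross θ (x + y) ∂stepLaw σ (levelDrift σ θ) δ| ≤ C * η := by
  set N := (ltPairs n).card with hN
  obtain ⟨C, hC0, hC⟩ := exists_integral_exp_l1_le σ (levelDrift (n := n) σ θ) S
    (show 0 ≤ 2 * (N : ℝ) * θ by positivity)
  have hK := hf.nonneg
  refine ⟨K * (1 + N * θ) * (2 ^ N * Real.exp (N * θ) * C), by positivity,
    fun δ hδ x hx η hη1 i j hij hgap => ?_⟩
  have hη0 : 0 ≤ η := (sub_nonneg.2 (hx hij.le)).trans hgap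
  -- Particle `j` is moved onto particle `i`. At `x'` the integral vanishes by antisymmetry, so only
  -- the Lipschitz cost of a displacement of at most `η` remains.
  set x' := Function.update x j (x i) with hx'
  have hx'j : x' j = x i := by simp [hx']
  have hx'k : ∀ k, k ≠ j → x' k = x k := fun k hk => by simp [hx', hk]
  have hle : ∀ k, x' k ≤ x k ∧ x k ≤ x' k + η := by
    intro k
    rcases eq_or_ne k j with rfl | hk
    · rw [hx'j]; exact ⟨hx hij.le, by linarith⟩
    · rw [hx'k k hk]; exact ⟨le_rfl, by linarith⟩
  have hmon : ∀ k l, k < l → x k - x l ≤ 0 := fun k l hkl => sub_nonpos.2 (hx hkl.le)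
  have h1 : ∀ k l, k < l → x k - x l ≤ 1 := fun k l hkl => (hmon k l hkl).trans zero_le_one
  have h2 : ∀ k l, k < l → x' k - x' l ≤ 1 := fun k l hkl => by
    linarith [hmon k l hkl, (hle k).1, (hle l).2]
  have h3 : ∀ k l, k < l → |(x k - x l) - (x' k - x' l)| ≤ η := fun k l _ => by
    rw [abs_le]; constructor <;> linarith [(hle k).1, (hle l).2, (hle k).2, (hle l).1]
  have hzero := integral_noncross_eq_zero σ θ δ hf.symm (x := x') hij.ne
    (by rw [hx'j, hx'k i hij.ne])
  have hl1 : ∑ k, |x k - x' k| ≤ η := by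
    rw [Finset.sum_eq_single j (fun k _ hk => by rw [hx'k k hk]; simp) (by simp), hx'j,
      abs_of_nonneg (sub_nonneg.2 (hx hij.le))]
    exact hgap
  have hpt : ∀ y, |f (x + y) * noncross θ (x + y) - f (x' + y) * noncross θ (x' + y)|
      ≤ η * (K * (1 + N * θ)) * stepBd θ y ^ N := by
    intro y
    have hB := pow_nonneg (stepBd_nonneg θ y) N
    have e : f (x + y) * noncross θ (x + y) - f (x' + y) * noncross θ (x' + y)
        = (f (x + y) - f (x' + y)) * noncross θ (x + y)
          + f (x' + y) * (noncross θ (x + y) - noncross θ (x' + y)) := by ring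
    have hlip : |f (x + y) - f (x' + y)| ≤ K * η := by
      refine (hf.lip _ _).trans (mul_le_mul_of_nonneg_left ?_ hK)
      simpa using hl1
    rw [e]
    refine (abs_add_le _ _).trans ?_
    rw [abs_mul, abs_mul]
    calc |f (x + y) - f (x' + y)| * |noncross θ (x + y)|
          + |f (x' + y)| * |noncross θ (x + y) - noncross θ (x' + y)|
        ≤ K * η * stepBd θ y ^ N + K * (N * (θ * η) * stepBd θ y ^ N) := by
          gcongr
          · exact abs_noncross_le hθ h1 y
          · exact hf.bdd _
          · exact abs_noncross_sub_le hθ h1 h2 h3 y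
      _ = _ := by ring
  calc |∫ y, f (x + y) * noncross θ (x + y) ∂stepLaw σ (levelDrift σ θ) δ|
      = |∫ y, (f (x + y) * noncross θ (x + y) - f (x' + y) * noncross θ (x' + y))
          ∂stepLaw σ (levelDrift σ θ) δ| := by
        rw [integral_sub (integrable_mul_noncross hθ hf h1 _ _ _)
          (integrable_mul_noncross hθ hf h2 _ _ _), hzero, sub_zero]
    _ ≤ ∫ y, η * (K * (1 + N * θ)) * stepBd θ y ^ N ∂stepLaw σ (levelDrift (n := n) σ θ) δ := by
        rw [← Real.norm_eq_abs]
        exact norm_integral_le_of_norm_le ((integrable_stepBd_pow _ _ _ _ _).const_mul _)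
          (Eventually.of_forall hpt)
    _ = η * (K * (1 + N * θ)) * (2 ^ N * Real.exp (N * θ)
          * ∫ y, Real.exp (2 * N * θ * ∑ i, |y i|) ∂stepLaw σ (levelDrift (n := n) σ θ) δ) := by
        simp only [stepBd_pow, integral_const_mul]
    _ ≤ η * (K * (1 + N * θ)) * (2 ^ N * Real.exp (N * θ) * C) := by
        gcongr
        exact hC δ hδ
    _ = _ := by ring

lemma noncross_nonneg {θ : ℝ} (hθ : 0 ≤ θ) {x : Fin n → ℝ} (hx : Monotone x) :
    0 ≤ noncross θ x :=
  Finset.prod_nonneg fun _ hp => sub_nonneg.2 (Real.exp_le_one_iff.2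
    (neg_nonpos.2 (mul_nonneg hθ (sub_nonneg.2 (hx (mem_ltPairs.1 hp).le)))))

lemma noncross_pos {θ : ℝ} (hθ : 0 < θ) {x : Fin n → ℝ} (hx : StrictMono x) :
    0 < noncross θ x :=
  Finset.prod_pos fun _ hp => sub_pos.2 (Real.exp_lt_one_iff.2
    (neg_neg_of_pos (mul_pos hθ (sub_pos.2 (hx (mem_ltPairs.1 hp))))))

lemma noncross_le_one {θ : ℝ} (hθ : 0 ≤ θ) {x : Fin n → ℝ} (hx : Monotone x) :
    noncross θ x ≤ 1 :=
  Finset.prod_le_one (fun _ hp => sub_nonneg.2 (Real.exp_le_one_iff.2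
    (neg_nonpos.2 (mul_nonneg hθ (sub_nonneg.2 (hx (mem_ltPairs.1 hp).le))))))
    fun _ _ => sub_le_self _ (Real.exp_pos _).le

end Bounds

/-! ### Collisions of the bridges -/

section Collision

open scoped NNReal

variable {n : ℕ}

/-- The paths that have two particles `i < j` with `x_j - x_i ≤ η` at some time in `D`. -/
def hitSet (D : Set unitInterval) (η : ℝ) : Set (PathSpace n) :=
  {f | ∃ u ∈ D, ∃ p ∈ ltPairs n, f u p.2 - f u p.1 ≤ η}

/-- A projection along the compact time interval of a closed set of pairs (path, time). -/
lemma isClosed_hitSet {D : Set unitInterval} (hD : IsClosed D) (η : ℝ) :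
    IsClosed (hitSet D η : Set (PathSpace n)) := by
  have h1 : IsClosed {z : PathSpace n × unitInterval |
      z.2 ∈ D ∧ ∃ p ∈ ltPairs n, z.1 z.2 p.2 - z.1 z.2 p.1 ≤ η} := by
    refine (hD.preimage continuous_snd).inter ?_
    have : {z : PathSpace n × unitInterval | ∃ p ∈ ltPairs n, z.1 z.2 p.2 - z.1 z.2 p.1 ≤ η}
        = ⋃ p ∈ ltPairs n, {z | z.1 z.2 p.2 - z.1 z.2 p.1 ≤ η} := by
      ext; simp
    change IsClosed {z : PathSpace n × unitInterval |
      ∃ p ∈ ltPairs n, z.1 z.2 p.2 - z.1 z.2 p.1 ≤ η}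
    rw [this]
    exact isClosed_biUnion_finset fun p _ => isClosed_le (by fun_prop) continuous_const
  have h2 := isClosedMap_fst_of_compactSpace _ h1
  convert h2 using 1
  ext f
  simp [hitSet]

lemma measurableSet_hitSet {D : Set unitInterval} (hD : IsClosed D) (η : ℝ) :
    MeasurableSet (hitSet D η : Set (PathSpace n)) := (isClosed_hitSet hD η).measurableSet

lemma strictMono_iff_ltPairs {x : Fin n → ℝ} : StrictMono x ↔ ∀ p ∈ ltPairs n, 0 < x p.2 - x p.1 :=
  ⟨fun h _ hp => sub_pos.2 (h (mem_ltPairs.1 hp)),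
    fun h i j hij => sub_pos.1 (h (i, j) (mem_ltPairs.2 hij))⟩

lemma notMem_hitSet_zero {D : Set unitInterval} {f : PathSpace n} :
    f ∉ hitSet D 0 ↔ ∀ u ∈ D, StrictMono (f u) := by
  simp only [hitSet, Set.mem_ofPred_eq, strictMono_iff_ltPairs]
  push Not
  rfl

lemma nonintersecting_eq : nonintersecting n = (hitSet Set.univ 0)ᶜ := by
  ext f
  rw [Set.mem_compl_iff, notMem_hitSet_zero]
  simp [nonintersecting]

lemma measurableSet_nonintersecting : MeasurableSet (nonintersecting n) := by
  rw [nonintersecting_eq]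
  exact (measurableSet_hitSet isClosed_univ 0).compl

/-- The events that depend on the path up to time `t`. -/
abbrev past (t : unitInterval) : MeasurableSpace (PathSpace n) :=
  MeasurableSpace.comap (pastMap t) inferInstance

lemma past_le (t : unitInterval) : past t ≤ instMeasurableSpacePathSpace n :=
  (measurable_pastMap t).comap_le

lemma measurable_past_eval {u t : unitInterval} (hut : u ≤ t) (j : Fin n) :
    Measurable[past t] fun f : PathSpace n => f u j :=
  (measurable_pi_apply (j, (⟨u, hut⟩ : {u : unitInterval // u ≤ t}))).comp
    (comap_measurable (pastMap t))

lemma past_mono {t t' : unitInterval} (h : t ≤ t') :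
    (past t : MeasurableSpace (PathSpace n)) ≤ past t' := by
  refine Measurable.comap_le ?_
  refine @measurable_pi_lambda _ _ _ (past t') _ _ fun p => ?_
  exact measurable_past_eval (p.2.2.trans h) p.1

lemma measurable_past_scaled {u t : unitInterval} (hut : u ≤ t) :
    Measurable[past t] (scaled u : PathSpace n → Fin n → ℝ) :=
  @measurable_pi_lambda _ _ _ (past t) _ _ fun j => (measurable_past_eval hut j).div_const _

lemma measurableSet_past_hitSet {u t : unitInterval} (hut : u ≤ t) (η : ℝ) :
    MeasurableSet[past t] (hitSet {u} η : Set (PathSpace n)) := by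
  have : (hitSet {u} η : Set (PathSpace n))
      = ⋃ p ∈ ltPairs n, {f | f u p.2 - f u p.1 ≤ η} := by
    ext; simp [hitSet]
  rw [this]
  refine Finset.measurableSet_biUnion _ fun p _ => ?_
  exact ((measurable_past_eval hut p.2).sub (measurable_past_eval hut p.1)) measurableSet_Iic

lemma measurableSet_past_monotone (t : unitInterval) :
    MeasurableSet[past t] {f : PathSpace n | Monotone (f t)} := by
  have : {f : PathSpace n | Monotone (f t)}
      = ⋂ p ∈ ltPairs n, {f | 0 ≤ f t p.2 - f t p.1} := by
    ext f
    simp only [Set.mem_ofPred_eq, Set.mem_iInter, sub_nonneg]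
    exact ⟨fun h p hp => h (mem_ltPairs.1 hp).le, fun h i j hij => by
      rcases hij.eq_or_lt with rfl | hij
      · exact le_rfl
      · exact h (i, j) (mem_ltPairs.2 hij)⟩
  rw [this]
  refine Finset.measurableSet_biInter _ fun p _ => ?_
  exact ((measurable_past_eval le_rfl p.2).sub (measurable_past_eval le_rfl p.1)) measurableSet_Ici

variable {σ : ℝ} {a b : Fin n → ℝ} {μ : Measure (PathSpace n)}

lemma IsBrownianBridgesLaw.markov_past (h : IsBrownianBridgesLaw σ a b μ) {t t' : unitInterval}
    (htt' : t ≤ t') (ht' : t' < 1) {ζ : PathSpace n → ℝ} (hζ : Measurable[past t] ζ)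
    {g : (Fin n → ℝ) → ℝ} (hg : Measurable g)
    (hint : Integrable (fun f => ζ f * g (scaled t' f)) μ) :
    ∫ f, ζ f * g (scaled t' f) ∂μ
      = ∫ f, ζ f * ∫ y, g (scaled t f + y)
          ∂stepLaw σ b (Real.toNNReal (clock t' - clock t)) ∂μ := by
  obtain ⟨ζ', hζ', rfl⟩ := hζ.exists_eq_measurable_comp
  exact h.markov htt' ht' hζ' hg hint

lemma scaled_zero (f : PathSpace n) : scaled 0 f = f 0 := by
  funext j; simp [scaled]

lemma clock_zero : clock 0 = 0 := by simp [clock]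

/-- The law of the rescaled path at a fixed time. -/
lemma IsBrownianBridgesLaw.map_scaled (h : IsBrownianBridgesLaw σ a b μ) {t : unitInterval}
    (ht : t < 1) :
    μ.map (scaled t) = (stepLaw σ b (Real.toNNReal (clock t))).map fun y => a + y := by
  have h1 := h.map_increment (show (0 : unitInterval) ≤ t from t.2.1) ht
  rw [clock_zero, sub_zero] at h1
  have hm : Measurable fun (f : PathSpace n) j => scaled t f j - scaled 0 f j :=
    (measurable_scaled t).sub (measurable_scaled 0)
  rw [← h1, Measure.map_map (by fun_prop) hm]
  refine Measure.map_congr ?_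
  filter_upwards [h.ae_start] with f hf
  funext j
  simp [scaled_zero, hf]

variable {θ K : ℝ}

lemma IsBrownianBridgesLaw.integrable_noncross (h : IsBrownianBridgesLaw σ a b μ) (hθ : 0 ≤ θ)
    (ha : Monotone a) {t : unitInterval} (ht : t < 1) :
    Integrable (fun f => noncross θ (scaled t f)) μ := by
  have hm := measurable_noncross (n := n) θ
  rw [← Function.comp_def, ← integrable_map_measure hm.aestronglyMeasurable
    (measurable_scaled t).aemeasurable, h.map_scaled ht,
    integrable_map_measure hm.aestronglyMeasurable (by fun_prop)]
  have := integrable_mul_noncross hθ (SymLip.one (n := n)) (x := a)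
    (fun i j hij => (sub_nonpos.2 (ha hij.le)).trans zero_le_one) σ b (Real.toNNReal (clock t))
  simpa [Function.comp_def] using this

lemma IsBrownianBridgesLaw.integrable_mul_noncross (h : IsBrownianBridgesLaw σ a b μ) (hθ : 0 ≤ θ)
    (ha : Monotone a) {t : unitInterval} (ht : t < 1) {ζ : PathSpace n → ℝ} (hζ : Measurable ζ)
    (hK : ∀ f, |ζ f| ≤ K) :
    Integrable (fun f => ζ f * noncross θ (scaled t f)) μ :=
  (h.integrable_noncross hθ ha ht).bdd_mul hζ.aestronglyMeasurable (Eventually.of_forall hK)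

lemma abs_integral_indicator_mul_le [IsFiniteMeasure μ] {E : Set (PathSpace n)} (hE : MeasurableSet E)
    {F : PathSpace n → ℝ} {c : ℝ} (hF : ∀ f ∈ E, |F f| ≤ c) :
    |∫ f, E.indicator (fun _ => (1 : ℝ)) f * F f ∂μ| ≤ c * μ.real E := by
  have : ∀ f, E.indicator (fun _ => (1 : ℝ)) f * F f = E.indicator F f := fun f => by
    by_cases hf : f ∈ E <;> simp [hf]
  simp only [this]
  rw [integral_indicator hE, ← Real.norm_eq_abs]
  exact norm_setIntegral_le_of_norm_le_const (measure_lt_top _ _) hF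

/-- Conditioning at time `u` leaves an expectation started from a configuration with a small gap,
which is small by `exists_abs_integral_le`. The factor `μ.real E` allows summation over disjoint
first-hitting events. -/
lemma IsBrownianBridgesLaw.exists_collision_bound (h : IsBrownianBridgesLaw σ a (levelDrift σ θ) μ)
    (hθ : 0 ≤ θ) (ha : Monotone a) {f : (Fin n → ℝ) → ℝ} (hf : SymLip K f) {t T : unitInterval}
    (htT : t ≤ T) (hT : T < 1) :
    ∃ C : ℝ, 0 ≤ C ∧ ∀ u ≤ T, ∀ E, MeasurableSet[past u] E → ∀ η : ℝ, η ≤ 1 - T →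
      (∀ ω ∈ E, Monotone (ω u)) → E ⊆ hitSet {u} η →
      |∫ ω in E, f (scaled t ω) * noncross θ (scaled T ω) ∂μ| ≤ C * η * μ.real E := by
  have := h.isProbabilityMeasure
  obtain ⟨C₁, hC₁, hb₁⟩ := exists_abs_integral_le σ hθ hf (Real.toNNReal (clock T))
  -- With the constant function `1` and zero elapsed time, this bounds `noncross` itself near a
  -- collision.
  obtain ⟨C₂, hC₂, hb₂⟩ := exists_abs_integral_le σ hθ (SymLip.one (n := n)) 0
  have hT0 := one_sub_pos_of_lt hT
  have hK := hf.nonneg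
  refine ⟨(C₁ + K * C₂) / (1 - T), by positivity, fun u hu E hE η hη hmono hhit => ?_⟩
  have hE' : MeasurableSet E := past_le u E hE
  set η' := η / (1 - T) with hη'
  have hη'1 : η' ≤ 1 := (div_le_one hT0).2 hη
  have hu0 := one_sub_pos_of_lt (hu.trans_lt hT)
  have hsm : ∀ ω ∈ E, Monotone (scaled u ω) := fun ω hω i j hij =>
    div_le_div_of_nonneg_right (hmono ω hω hij) hu0.le
  have hgap : ∀ ω ∈ E, ∃ i j, i < j ∧ scaled u ω j - scaled u ω i ≤ η' := by
    intro ω hω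
    obtain ⟨w, hw, p, hp, hg⟩ := hhit hω
    rw [Set.mem_singleton_iff] at hw
    subst hw
    have hp' := mem_ltPairs.1 hp
    refine ⟨p.1, p.2, hp', ?_⟩
    have h0 : 0 ≤ ω w p.2 - ω w p.1 := sub_nonneg.2 (hmono ω hω hp'.le)
    have hle : (w : ℝ) ≤ T := hu
    rw [scaled, scaled, ← sub_div]
    exact div_le_div₀ (h0.trans hg) hg hT0 (by linarith)
  have hη0 : ∀ ω ∈ E, 0 ≤ η' := fun ω hω => by
    obtain ⟨i, j, hij, hg⟩ := hgap ω hω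
    exact (sub_nonneg.2 (hsm ω hω hij.le)).trans hg
  set χ : PathSpace n → ℝ := E.indicator fun _ => 1 with hχ
  have hχm : Measurable[past u] χ := by
    rw [hχ]
    exact Measurable.indicator (@measurable_const ℝ (PathSpace n) _ (past u) 1) hE
  have hχb : ∀ ω, |χ ω| ≤ 1 := fun ω => by
    by_cases hω : ω ∈ E <;> simp [hχ, hω]
  have hstart : ∫ ω in E, f (scaled t ω) * noncross θ (scaled T ω) ∂μ
      = ∫ ω, (χ ω * f (scaled t ω)) * noncross θ (scaled T ω) ∂μ := by
    rw [← integral_indicator hE']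
    refine integral_congr_ae (Eventually.of_forall fun ω => ?_)
    by_cases hω : ω ∈ E <;> simp [hχ, hω]
  have hχfb : ∀ ω, |χ ω * f (scaled t ω)| ≤ K := fun ω => by
    rw [abs_mul]
    exact (mul_le_mul (hχb ω) (hf.bdd _) (abs_nonneg _) zero_le_one).trans (one_mul K).le
  have hfm : ∀ s, t ≤ s → Measurable[past s] fun ω : PathSpace n => f (scaled t ω) := fun s hs =>
    hf.cont.measurable.comp (measurable_past_scaled hs)
  -- Nothing forces `η` to be nonnegative unless `E` contains an ordered path, so the empty event is
  -- treated apart.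
  have hfin : C₁ * η' * μ.real E ≤ (C₁ + K * C₂) / (1 - T) * η * μ.real E
      ∧ K * (C₂ * η') * μ.real E ≤ (C₁ + K * C₂) / (1 - T) * η * μ.real E := by
    have e : (C₁ + K * C₂) / (1 - T) * η = (C₁ + K * C₂) * η' := by rw [hη']; ring
    rw [e]
    rcases E.eq_empty_or_nonempty with rfl | ⟨ω, hω⟩
    · simp
    · have h0 := hη0 ω hω
      have hE0 : 0 ≤ μ.real E := measureReal_nonneg
      refine ⟨mul_le_mul_of_nonneg_right ?_ hE0, mul_le_mul_of_nonneg_right ?_ hE0⟩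
      · nlinarith [mul_nonneg (mul_nonneg hK hC₂) h0]
      · nlinarith [mul_nonneg hC₁ h0]
  rw [hstart]
  rcases le_total u t with hut | htu
  -- The near-collision precedes `t`: harmonicity brings the weight from `T` back to `t`, and the
  -- Markov property at `u` then applies to `f * noncross`.
  · have ht := htT.trans_lt hT
    have hζm : Measurable[past t] fun ω => χ ω * f (scaled t ω) :=
      (hχm.mono (past_mono hut) le_rfl).mul (hfm t le_rfl)
    rw [h.markov_past htT hT hζm (measurable_noncross θ)
      (h.integrable_mul_noncross hθ ha hT (hζm.mono (past_le t) le_rfl) hχfb)]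
    simp only [integral_noncross]
    have hint : Integrable (fun ω => χ ω * (f (scaled t ω) * noncross θ (scaled t ω))) μ := by
      simpa only [mul_assoc] using
        h.integrable_mul_noncross hθ ha ht (hζm.mono (past_le t) le_rfl) hχfb
    
    have hmk := h.markov_past hut ht hχm (g := fun x => f x * noncross θ x)
      (hf.cont.measurable.mul (measurable_noncross θ)) hint
    simp only [mul_assoc]
    rw [hmk]
    refine (abs_integral_indicator_mul_le hE' (c := C₁ * η') fun ω hω => ?_).trans
      (hfin.1.trans_eq (mul_assoc _ _ _))
    obtain ⟨i, j, hij, hg⟩ := hgap ω hω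
    refine hb₁ _ (Real.toNNReal_le_toNNReal ?_) _ (hsm ω hω) η' hη'1 i j hij hg
    linarith [clock_nonneg u, clock_mono htT hT]
  -- Here `f` is already determined at time `u`. Harmonicity brings the weight back to `u`, where it
  -- is small.
  · have hζm : Measurable[past u] fun ω => χ ω * f (scaled t ω) := hχm.mul (hfm u htu)
    rw [h.markov_past hu hT hζm (measurable_noncross θ)
      (h.integrable_mul_noncross hθ ha hT (hζm.mono (past_le u) le_rfl) hχfb)]
    simp only [integral_noncross, mul_assoc]
    refine (abs_integral_indicator_mul_le hE' (c := K * (C₂ * η')) fun ω hω => ?_).trans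
      (hfin.2.trans_eq (mul_assoc _ _ _))
    obtain ⟨i, j, hij, hg⟩ := hgap ω hω
    have := hb₂ 0 le_rfl _ (hsm ω hω) η' hη'1 i j hij hg
    simp only [one_mul, integral_noncross] at this
    rw [abs_mul]
    exact mul_le_mul (hf.bdd _) this (abs_nonneg _) hK

end Collision

/-! ### The stopping argument along a grid -/

section Grid

open scoped NNReal

variable {n : ℕ}

lemma tendsto_setIntegral_zero {α ι : Type*} [MeasurableSpace α] {μ : Measure α} {l : Filter ι}
    [l.IsCountablyGenerated] {A : ι → Set α} (hA : ∀ k, MeasurableSet (A k)) {F : α → ℝ}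
    (hF : Integrable F μ) (h : ∀ᵐ x ∂μ, ∀ᶠ k in l, x ∉ A k) :
    Tendsto (fun k => ∫ x in A k, F x ∂μ) l (𝓝 0) := by
  simp only [← integral_indicator (hA _)]
  rw [← integral_zero α ℝ (μ := μ)]
  refine tendsto_integral_filter_of_dominated_convergence (fun x => ‖F x‖)
    (Eventually.of_forall fun k => hF.1.indicator (hA k))
    (Eventually.of_forall fun k => Eventually.of_forall fun x => norm_indicator_le_norm_self _ _)
    hF.norm ?_
  filter_upwards [h] with x hx
  refine tendsto_const_nhds.congr' ?_
  filter_upwards [hx] with k hk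
  simp [hk]

/-- The grid of mesh `1 / (m + 1)` on `[0, T]`. -/
noncomputable def grid (T : unitInterval) (m k : ℕ) : unitInterval :=
  ⟨min T (k / (m + 1)), le_min T.2.1 (by positivity), (min_le_left _ _).trans T.2.2⟩

lemma grid_le (T : unitInterval) (m k : ℕ) : grid T m k ≤ T :=
  show min (T : ℝ) (k / (m + 1)) ≤ T from min_le_left _ _

lemma grid_zero (T : unitInterval) (m : ℕ) : grid T m 0 = 0 := by
  ext
  simp [grid, T.2.1]

lemma grid_mono (T : unitInterval) (m : ℕ) : Monotone (grid T m) := fun k l hkl =>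
  show min (T : ℝ) (k / (m + 1)) ≤ min (T : ℝ) (l / (m + 1)) by gcongr

lemma dist_grid_succ (T : unitInterval) (m k : ℕ) :
    dist (grid T m (k + 1)) (grid T m k) ≤ 1 / ((m : ℝ) + 1) := by
  have h1 : (grid T m (k + 1) : ℝ) = min (T : ℝ) ((k + 1 : ℕ) / (m + 1)) := rfl
  have h2 : (grid T m k : ℝ) = min (T : ℝ) (k / (m + 1)) := rfl
  rw [Subtype.dist_eq, Real.dist_eq, h1, h2]
  refine (abs_min_sub_min_le_max _ _ _ _).trans ?_
  have : ((k + 1 : ℕ) / ((m : ℝ) + 1)) - k / (m + 1) = 1 / (m + 1) := by push_cast; ring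
  rw [this, sub_self, abs_zero, abs_of_nonneg (by positivity)]
  exact max_le (by positivity) le_rfl

lemma exists_dist_grid_le {T u : unitInterval} (hu : u ≤ T) (m : ℕ) :
    ∃ k ≤ m + 1, dist u (grid T m k) ≤ 1 / ((m : ℝ) + 1) := by
  have hm : (0 : ℝ) < m + 1 := by positivity
  have hu0 : 0 ≤ (u : ℝ) * (m + 1) := mul_nonneg u.2.1 hm.le
  set k := ⌊(u : ℝ) * (m + 1)⌋₊ with hk
  have h1 : (k : ℝ) ≤ u * (m + 1) := Nat.floor_le hu0
  have h2 : (u : ℝ) * (m + 1) < k + 1 := Nat.lt_floor_add_one _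
  have h3 : (k : ℝ) / (m + 1) ≤ u := (div_le_iff₀ hm).2 h1
  have hu' : (u : ℝ) ≤ T := hu
  refine ⟨k, ?_, ?_⟩
  · have : (k : ℝ) ≤ m + 1 := h1.trans (mul_le_of_le_one_left hm.le u.2.2)
    exact_mod_cast this
  · have h4 : (grid T m k : ℝ) = k / (m + 1) := min_eq_right (h3.trans hu')
    rw [Subtype.dist_eq, Real.dist_eq, h4, abs_of_nonneg (sub_nonneg.2 h3), sub_le_iff_le_add,
      ← add_div, le_div_iff₀ hm]
    linarith

/-- The first grid time with a gap of at most `η` is the `k`-th one, and the particles are still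
ordered at that time. -/
def firstHit (T : unitInterval) (η : ℝ) (m k : ℕ) : Set (PathSpace n) :=
  hitSet {grid T m k} η ∩ (⋂ l ∈ Finset.range k, (hitSet {grid T m l} η)ᶜ)
    ∩ {f | Monotone (f (grid T m k))}

lemma measurableSet_firstHit (T : unitInterval) (η : ℝ) (m k : ℕ) :
    MeasurableSet[past (grid T m k)] (firstHit T η m k : Set (PathSpace n)) :=
  @MeasurableSet.inter _ (past _) _ _ (@MeasurableSet.inter _ (past _) _ _
    (measurableSet_past_hitSet le_rfl η)
    (Finset.measurableSet_biInter _ fun _ hl => MeasurableSet.compl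
      (measurableSet_past_hitSet (grid_mono T m (Finset.mem_range.1 hl).le) η)))
    (measurableSet_past_monotone _)

lemma disjoint_firstHit (T : unitInterval) (η : ℝ) (m : ℕ) {k l : ℕ} (hkl : k < l) :
    Disjoint (firstHit T η m k : Set (PathSpace n)) (firstHit T η m l) := by
  rw [Set.disjoint_left]
  rintro f ⟨⟨h1, -⟩, -⟩ ⟨⟨-, h2⟩, -⟩
  exact Set.mem_iInter₂.1 h2 k (Finset.mem_range.2 hkl) h1

/-- Some grid time has a gap of at most `η`, and the particles are still ordered at the first such
time. -/
def gridHit (T : unitInterval) (η : ℝ) (m : ℕ) : Set (PathSpace n) :=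
  ⋃ k ∈ Finset.range (m + 2), firstHit T η m k

lemma measurableSet_gridHit (T : unitInterval) (η : ℝ) (m : ℕ) :
    MeasurableSet (gridHit T η m : Set (PathSpace n)) :=
  Finset.measurableSet_biUnion _ fun k _ => past_le _ _ (measurableSet_firstHit T η m k)

lemma gridHit_subset (T : unitInterval) (η : ℝ) (m : ℕ) :
    (gridHit T η m : Set (PathSpace n)) ⊆ hitSet (Set.Iic T) η := by
  refine Set.iUnion₂_subset fun k _ f hf => ?_
  obtain ⟨u, hu, h⟩ := hf.1.1
  rw [Set.mem_singleton_iff] at hu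
  exact ⟨u, hu ▸ grid_le T m k, h⟩

/-- On a fine grid gaps change by less than `η` per step. A collision therefore forces a grid time
with a gap of at most `η`; one step before the first such time all gaps exceed `η`, so the order has
not yet been lost. -/
lemma eventually_mem_gridHit {T : unitInterval} {η : ℝ} (hη : 0 < η) {f : PathSpace n}
    (h0 : StrictMono (f 0)) (hf : f ∈ hitSet (Set.Iic T) 0) :
    ∀ᶠ m in atTop, f ∈ gridHit T η m := by
  have huc : UniformContinuous f := CompactSpace.uniformContinuous_of_continuous f.continuous
  -- A gap involves two particles, each of which may move by `η / 2`.
  obtain ⟨ρ, hρ, hρf⟩ := Metric.uniformContinuous_iff.1 huc (η / 2) (by positivity)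
  have hgap : ∀ u w, dist u w < ρ → ∀ i j : Fin n, f u j - f u i < f w j - f w i + η := by
    intro u w huw i j
    have h1 := (dist_le_pi_dist (f u) (f w) i).trans_lt (hρf huw)
    have h2 := (dist_le_pi_dist (f u) (f w) j).trans_lt (hρf huw)
    rw [Real.dist_eq, abs_lt] at h1 h2
    linarith [h1.1, h2.2]
  have hmesh : ∀ᶠ m : ℕ in atTop, 1 / ((m : ℝ) + 1) < ρ :=
    (tendsto_order.1 tendsto_one_div_add_atTop_nhds_zero_nat).2 ρ hρ
  filter_upwards [hmesh] with m hm
  obtain ⟨u, hu, p, hp, hup⟩ := hf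
  obtain ⟨k, hk, hku⟩ := exists_dist_grid_le hu m
  have hex : ∃ k, f ∈ hitSet {grid T m k} η := by
    refine ⟨k, _, rfl, p, hp, ?_⟩
    have := hgap (grid T m k) u (by rw [dist_comm]; exact hku.trans_lt hm) p.1 p.2
    linarith
  classical
  have hmin : ∀ l, l < Nat.find hex → f ∉ hitSet {grid T m l} η := fun l hl => Nat.find_min hex hl
  have hle : Nat.find hex ≤ k := by
    refine Nat.find_le ?_
    refine ⟨_, rfl, p, hp, ?_⟩
    have := hgap (grid T m k) u (by rw [dist_comm]; exact hku.trans_lt hm) p.1 p.2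
    linarith
  refine Set.mem_iUnion₂.2 ⟨Nat.find hex, Finset.mem_range.2 (by omega),
    ⟨Nat.find_spec hex, Set.mem_iInter₂.2 fun l hl => hmin l (Finset.mem_range.1 hl)⟩, ?_⟩
  change Monotone (f (grid T m (Nat.find hex)))
  rcases hcase : Nat.find hex with _ | l
  · rw [grid_zero]
    exact h0.monotone
  · refine StrictMono.monotone (strictMono_iff_ltPairs.2 fun q hq => ?_)
    have h1 : η < f (grid T m l) q.2 - f (grid T m l) q.1 := by
      by_contra hcon
      exact hmin l (by omega) ⟨_, rfl, q, hq, not_lt.1 hcon⟩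
    have := hgap (grid T m l) (grid T m (l + 1))
      (by rw [dist_comm]; exact (dist_grid_succ T m l).trans_lt hm) q.1 q.2
    linarith

/-- Along a path without collisions on the compact interval `[0, T]` each gap attains a positive
minimum. -/
lemma eventually_notMem_hitSet {T : unitInterval} {f : PathSpace n}
    (hf : f ∉ hitSet (Set.Iic T) 0) : ∀ᶠ η : ℝ in 𝓝 0, f ∉ hitSet (Set.Iic T) η := by
  rw [notMem_hitSet_zero] at hf
  have h : ∀ p ∈ ltPairs n, ∀ᶠ η : ℝ in 𝓝 0, ∀ u ∈ Set.Iic T, η < f u p.2 - f u p.1 := by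
    intro p hp
    obtain ⟨w, hw, hmin⟩ := (isClosed_Iic (a := T)).isCompact.exists_isMinOn ⟨T, Set.mem_Iic.2 le_rfl⟩
      (f := fun u => f u p.2 - f u p.1) (by fun_prop)
    have hpos := strictMono_iff_ltPairs.1 (hf w hw) p hp
    filter_upwards [eventually_lt_nhds hpos] with η hη u hu
    exact hη.trans_le (hmin hu)
  filter_upwards [(Finset.eventually_all _).2 h] with η hη
  rintro ⟨u, hu, p, hp, hle⟩
  exact absurd (hη p hp u hu) (not_lt.2 hle)

variable {σ : ℝ} {a : Fin n → ℝ} {μ : Measure (PathSpace n)} {θ K : ℝ}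

/-- A discretized optional stopping argument: the collision event is approximated by `gridHit`, on
which the integral is of order `η`. For fixed `η` the mesh tends to `0` first, then `η` does. -/
lemma IsBrownianBridgesLaw.setIntegral_collision
    (h : IsBrownianBridgesLaw σ a (levelDrift σ θ) μ) (hθ : 0 ≤ θ) (ha : StrictMono a)
    {f : (Fin n → ℝ) → ℝ} (hf : SymLip K f) {t T : unitInterval} (htT : t ≤ T) (hT : T < 1) :
    ∫ ω in hitSet (Set.Iic T) 0, f (scaled t ω) * noncross θ (scaled T ω) ∂μ = 0 := by
  have := h.isProbabilityMeasure
  obtain ⟨C, hC, hb⟩ := h.exists_collision_bound hθ ha.monotone hf htT hT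
  set Ψ : PathSpace n → ℝ := fun ω => f (scaled t ω) * noncross θ (scaled T ω) with hΨ
  set D : Set (PathSpace n) := hitSet (Set.Iic T) 0 with hD
  have hDm : MeasurableSet D := measurableSet_hitSet isClosed_Iic 0
  have hΨi : Integrable Ψ μ := h.integrable_mul_noncross hθ ha.monotone hT
    (hf.cont.measurable.comp (measurable_scaled t)) fun ω => hf.bdd _
  have hT0 := one_sub_pos_of_lt hT
  have hgrid : ∀ η : ℝ, η ≤ 1 - T → 0 < η → ∀ m, |∫ ω in gridHit T η m, Ψ ω ∂μ| ≤ C * η := by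
    intro η hη hη0 m
    have hdisj : Set.Pairwise (↑(Finset.range (m + 2)))
        (Function.onFun Disjoint fun k => (firstHit T η m k : Set (PathSpace n))) := by
      intro k _ l _ hkl
      rcases lt_or_gt_of_ne hkl with h | h
      · exact disjoint_firstHit T η m h
      · exact (disjoint_firstHit T η m h).symm
    have hm : ∀ k ∈ Finset.range (m + 2), MeasurableSet (firstHit T η m k : Set (PathSpace n)) :=
      fun k _ => past_le _ _ (measurableSet_firstHit T η m k)
    rw [gridHit, integral_biUnion_finset _ hm hdisj fun k _ => hΨi.integrableOn]
    calc |∑ k ∈ Finset.range (m + 2), ∫ ω in firstHit T η m k, Ψ ω ∂μ|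
        ≤ ∑ k ∈ Finset.range (m + 2), C * η * μ.real (firstHit T η m k) :=
          (Finset.abs_sum_le_sum_abs _ _).trans (Finset.sum_le_sum fun k _ =>
            hb _ (grid_le T m k) _ (measurableSet_firstHit T η m k) η hη (fun ω hω => hω.2)
              fun ω hω => hω.1.1)
      _ = C * η * μ.real (⋃ k ∈ Finset.range (m + 2), firstHit T η m k) := by
          rw [← Finset.mul_sum, measureReal_biUnion_finset hdisj hm]
      _ ≤ C * η := mul_le_of_le_one_right (by positivity) measureReal_le_one
  have hη : ∀ η : ℝ, η ≤ 1 - T → 0 < η →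
      |∫ ω in D, Ψ ω ∂μ| ≤ C * η + ∫ ω in hitSet (Set.Iic T) η \ D, |Ψ ω| ∂μ := by
    intro η hη hη0
    have hlim : Tendsto (fun m => ∫ ω in D \ gridHit T η m, |Ψ ω| ∂μ) atTop (𝓝 0) := by
      refine tendsto_setIntegral_zero (fun m => hDm.diff (measurableSet_gridHit T η m)) hΨi.abs ?_
      filter_upwards [h.ae_start] with ω hω
      by_cases hωD : ω ∈ D
      · filter_upwards [eventually_mem_gridHit hη0 (hω ▸ ha) hωD] with m hm h'
        exact h'.2 hm
      · exact Eventually.of_forall fun m h' => hωD h'.1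
    have hlim' := (hlim.const_add (C * η + ∫ ω in hitSet (Set.Iic T) η \ D, |Ψ ω| ∂μ))
    rw [add_zero] at hlim'
    refine ge_of_tendsto' hlim' fun m => ?_
    set E : Set (PathSpace n) := gridHit T η m with hE
    have hEm : MeasurableSet E := measurableSet_gridHit T η m
    have e1 := integral_inter_add_sdiff (f := Ψ) (μ := μ) (s := D) hEm hΨi.integrableOn
    have e2 := integral_inter_add_sdiff (f := Ψ) (μ := μ) (s := E) hDm hΨi.integrableOn
    rw [Set.inter_comm] at e2
    have b1 : |∫ ω in D \ E, Ψ ω ∂μ| ≤ ∫ ω in D \ E, |Ψ ω| ∂μ := abs_integral_le_integral_abs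
    have b2 : |∫ ω in E \ D, Ψ ω ∂μ| ≤ ∫ ω in hitSet (Set.Iic T) η \ D, |Ψ ω| ∂μ :=
      abs_integral_le_integral_abs.trans (setIntegral_mono_set hΨi.abs.integrableOn
        (Eventually.of_forall fun _ => abs_nonneg _)
        (Set.sdiff_subset_sdiff_left (gridHit_subset T η m)).eventuallyLE)
    have b3 := hgrid η hη hη0 m
    -- Of the two errors, `D \ E` disappears as the mesh is refined, while `E \ D` lies among the
    -- paths that come `η`-close without colliding and disappears with `η`.
    have e3 : ∫ ω in D, Ψ ω ∂μ
        = ∫ ω in E, Ψ ω ∂μ - ∫ ω in E \ D, Ψ ω ∂μ + ∫ ω in D \ E, Ψ ω ∂μ := by linarith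
    rw [e3]
    refine (abs_add_le _ _).trans (add_le_add ((abs_sub _ _).trans (add_le_add b3 b2)) b1)
  have hlim : Tendsto (fun η : ℝ => C * η + ∫ ω in hitSet (Set.Iic T) η \ D, |Ψ ω| ∂μ)
      (𝓝[>] 0) (𝓝 0) := by
    have h1 : Tendsto (fun η : ℝ => ∫ ω in hitSet (Set.Iic T) η \ D, |Ψ ω| ∂μ) (𝓝[>] 0) (𝓝 0) := by
      refine tendsto_setIntegral_zero (fun η => (measurableSet_hitSet isClosed_Iic η).diff hDm)
        hΨi.abs (Eventually.of_forall fun ω => ?_)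
      by_cases hωD : ω ∈ D
      · exact Eventually.of_forall fun η h' => h'.2 hωD
      · filter_upwards [(eventually_notMem_hitSet hωD).filter_mono nhdsWithin_le_nhds] with η hη h'
        exact hη h'.1
    have h2 : Tendsto (fun η : ℝ => C * η) (𝓝[>] 0) (𝓝 0) := by
      have : Tendsto (fun η : ℝ => C * η) (𝓝 0) (𝓝 (C * 0)) := tendsto_id.const_mul C
      rw [mul_zero] at this
      exact this.mono_left nhdsWithin_le_nhds
    simpa using h2.add h1
  refine abs_nonpos_iff.1 (ge_of_tendsto hlim ?_)
  filter_upwards [self_mem_nhdsWithin, (eventually_lt_nhds hT0).filter_mono nhdsWithin_le_nhds]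
    with η h1 h2
  exact hη η h2.le h1

end Grid

/-! ### The law of the nonintersecting bridges at a fixed time -/

section Conditioned

open scoped NNReal

variable {n : ℕ} {σ : ℝ} {a : Fin n → ℝ} {μ : Measure (PathSpace n)} {θ K : ℝ}

lemma strictMono_levelDrift (hσ : 0 < σ) (hθ : 0 < θ) :
    StrictMono (levelDrift σ θ : Fin n → ℝ) := fun i j hij =>
  mul_lt_mul_of_pos_left (by exact_mod_cast hij) (by positivity)

/-- A sequence of times increasing to `1`. -/
noncomputable def lateTime (k : ℕ) : unitInterval :=
  ⟨1 - 1 / ((k : ℝ) + 1), sub_nonneg.2 (by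
    rw [div_le_one (by positivity)]; linarith [(Nat.cast_nonneg k : (0 : ℝ) ≤ k)]),
    sub_le_self _ (by positivity)⟩

lemma one_sub_lateTime (k : ℕ) : 1 - (lateTime k : ℝ) = 1 / ((k : ℝ) + 1) := by
  simp [lateTime]

lemma lateTime_lt_one (k : ℕ) : lateTime k < 1 := by
  have h : (lateTime k : ℝ) < 1 := by
    have : 0 < 1 / ((k : ℝ) + 1) := by positivity
    linarith [one_sub_lateTime k]
  exact_mod_cast h

lemma tendsto_lateTime : Tendsto lateTime atTop (𝓝 1) := by
  rw [tendsto_subtype_rng]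
  have := (tendsto_const_nhds (x := (1 : ℝ))).sub (tendsto_one_div_add_atTop_nhds_zero_nat (𝕜 := ℝ))
  simpa [lateTime] using this

/-- If the end points are distinct and ordered, the rescaled gaps tend to infinity as time tends to
`1`, so every exponential in the product dies. -/
lemma tendsto_noncross_lateTime (hθ : 0 < θ) {f : PathSpace n} (hf : StrictMono (f 1)) :
    Tendsto (fun k => noncross θ (scaled (lateTime k) f)) atTop (𝓝 1) := by
  have h : ∀ p ∈ ltPairs n, Tendsto (fun k => 1 - Real.exp
      (-(θ * (scaled (lateTime k) f p.2 - scaled (lateTime k) f p.1)))) atTop (𝓝 1) := by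
    intro p hp
    have h1 : Tendsto (fun k => f (lateTime k) p.2 - f (lateTime k) p.1) atTop
        (𝓝 (f 1 p.2 - f 1 p.1)) := by
      have hc : Continuous fun u => f u p.2 - f u p.1 := by fun_prop
      exact (hc.tendsto 1).comp tendsto_lateTime
    have h2 : Tendsto (fun k : ℕ => (k : ℝ) + 1) atTop atTop :=
      tendsto_atTop_add_const_right _ _ tendsto_natCast_atTop_atTop
    have h3 : Tendsto (fun k : ℕ => scaled (lateTime k) f p.2 - scaled (lateTime k) f p.1)
        atTop atTop := by
      refine (h1.pos_mul_atTop (strictMono_iff_ltPairs.1 hf p hp) h2).congr fun k => ?_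
      simp only [scaled, one_sub_lateTime]
      have : (k : ℝ) + 1 ≠ 0 := by positivity
      field_simp
    have h4 := Real.tendsto_exp_neg_atTop_nhds_zero.comp (h3.const_mul_atTop hθ)
    simpa using h4.const_sub 1
  have := tendsto_finsetProd (ltPairs n) h
  simpa [noncross] using this

/-- The weight `noncross` is the conditional probability of not colliding. -/
lemma IsBrownianBridgesLaw.setIntegral_nonintersecting
    (h : IsBrownianBridgesLaw σ a (levelDrift σ θ) μ) (hσ : 0 < σ) (hθ : 0 < θ) (ha : StrictMono a)
    {f : (Fin n → ℝ) → ℝ} (hf : SymLip K f) {t : unitInterval} (ht : t < 1) :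
    ∫ ω in nonintersecting n, f (scaled t ω) ∂μ
      = ∫ y, f (a + y) * noncross θ (a + y)
          ∂stepLaw σ (levelDrift σ θ) (Real.toNNReal (clock t)) := by
  have := h.isProbabilityMeasure
  have hfm : Measurable fun ω : PathSpace n => f (scaled t ω) :=
    hf.cont.measurable.comp (measurable_scaled t)
  have hlate : ∀ᶠ k in atTop, t ≤ lateTime k :=
    (tendsto_lateTime.eventually (lt_mem_nhds ht)).mono fun k hk => hk.le
  have hDm : ∀ T, MeasurableSet (hitSet (Set.Iic T) 0 : Set (PathSpace n)) := fun T =>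
    measurableSet_hitSet isClosed_Iic 0
  -- The colliding paths contribute zero, so the restriction to noncolliding ones can be dropped;
  -- harmonicity then returns the weight to time `t`, whatever the late time.
  have hconst : ∀ᶠ k in atTop, ∫ ω, (hitSet (Set.Iic (lateTime k)) 0)ᶜ.indicator
        (fun ω => f (scaled t ω) * noncross θ (scaled (lateTime k) ω)) ω ∂μ
      = ∫ y, f (a + y) * noncross θ (a + y)
          ∂stepLaw σ (levelDrift σ θ) (Real.toNNReal (clock t)) := by
    filter_upwards [hlate] with k hk
    have hi := h.integrable_mul_noncross hθ.le ha.monotone (lateTime_lt_one k) hfm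
      fun ω => hf.bdd _
    have h1 := h.setIntegral_collision hθ.le ha hf hk (lateTime_lt_one k)
    have h2 := integral_add_compl (hDm (lateTime k)) hi
    rw [h1, zero_add] at h2
    have hmk := h.markov_past hk (lateTime_lt_one k) (ζ := fun ω => f (scaled t ω))
      (hf.cont.measurable.comp (measurable_past_scaled le_rfl)) (measurable_noncross θ) hi
    simp only [integral_noncross] at hmk
    have hm : Measurable fun x => f x * noncross θ x :=
      hf.cont.measurable.mul (measurable_noncross θ)
    rw [integral_indicator (hDm _).compl, h2, hmk,
      ← integral_map (φ := scaled t) (f := fun x => f x * noncross θ x)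
        (measurable_scaled t).aemeasurable hm.aestronglyMeasurable,
      h.map_scaled ht, integral_map (by fun_prop) hm.aestronglyMeasurable]
  have hlim : Tendsto (fun k => ∫ ω, (hitSet (Set.Iic (lateTime k)) 0)ᶜ.indicator
        (fun ω => f (scaled t ω) * noncross θ (scaled (lateTime k) ω)) ω ∂μ) atTop
      (𝓝 (∫ ω, (nonintersecting n).indicator (fun ω => f (scaled t ω)) ω ∂μ)) := by
    refine tendsto_integral_filter_of_dominated_convergence (fun _ => K)
      (Eventually.of_forall fun k => ?_) (Eventually.of_forall fun k => Eventually.of_forall ?_)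
      (integrable_const K) ?_
    · exact ((hfm.mul ((measurable_noncross θ).comp (measurable_scaled _))).indicator
        (hDm _).compl).aestronglyMeasurable
    · intro ω
      by_cases hω : ω ∈ hitSet (Set.Iic (lateTime k)) 0
      · simpa [hω] using hf.nonneg
      -- Without a collision the configuration is ordered at the late time, so the weight lies in
      -- `[0, 1]` and the constant `K` dominates.
      · rw [Set.indicator_of_mem (by exact hω), Real.norm_eq_abs, abs_mul]
        have hmono : Monotone (scaled (lateTime k) ω) := fun i j hij =>
          div_le_div_of_nonneg_right
            ((notMem_hitSet_zero.1 hω _ (Set.mem_Iic.2 le_rfl)).monotone hij)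
            (one_sub_pos_of_lt (lateTime_lt_one k)).le
        rw [abs_of_nonneg (noncross_nonneg hθ.le hmono)]
        exact (mul_le_mul (hf.bdd _) (noncross_le_one hθ.le hmono)
          (noncross_nonneg hθ.le hmono) hf.nonneg).trans (mul_one K).le
    · filter_upwards [h.ae_end] with ω hω
      have h1 : StrictMono (ω 1) := hω ▸ strictMono_levelDrift hσ hθ
      by_cases hN : ω ∈ nonintersecting n
      · rw [Set.indicator_of_mem hN]
        have := (tendsto_noncross_lateTime hθ h1).const_mul (f (scaled t ω))
        rw [mul_one] at this
        refine this.congr fun k => ?_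
        rw [Set.indicator_of_mem]
        exact notMem_hitSet_zero.2 fun u _ => hN u
      · rw [Set.indicator_of_notMem hN]
        have hN' : ∃ u, ¬ StrictMono (ω u) := by
          by_contra hcon
          push Not at hcon
          exact hN hcon
        obtain ⟨u, hu⟩ := hN'
        -- The end configuration is strictly ordered almost surely, so an intersection happens
        -- before time `1` and is seen by all later cutoffs.
        have hu1 : u < 1 := lt_of_le_of_ne u.2.2 fun h => hu (h ▸ h1)
        refine tendsto_const_nhds.congr' ?_
        filter_upwards [tendsto_lateTime.eventually (lt_mem_nhds hu1)] with k hk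
        rw [Set.indicator_of_notMem]
        exact fun hmem => hu (notMem_hitSet_zero.1 hmem u hk.le)
  rw [← integral_indicator measurableSet_nonintersecting]
  exact tendsto_nhds_unique hlim (tendsto_const_nhds.congr' (hconst.mono fun k hk => hk.symm))

/-- The case of the constant function at time `0`, where the clock has not started. -/
lemma IsBrownianBridgesLaw.measureReal_nonintersecting
    (h : IsBrownianBridgesLaw σ a (levelDrift σ θ) μ) (hσ : 0 < σ) (hθ : 0 < θ)
    (ha : StrictMono a) : μ.real (nonintersecting n) = noncross θ a := by
  have := h.setIntegral_nonintersecting hσ hθ ha SymLip.one (t := 0) (by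
    rw [← Subtype.coe_lt_coe]; simp)
  simp only [one_mul, integral_noncross] at this
  simpa using this

/-- The expectation of a symmetric function of the conditioned bridges at a fixed time. -/
lemma IsBrownianBridgesLaw.integral_cond
    (h : IsBrownianBridgesLaw σ a (levelDrift σ θ) μ) (hσ : 0 < σ) (hθ : 0 < θ) (ha : StrictMono a)
    {f : (Fin n → ℝ) → ℝ} (hf : SymLip K f) {t : unitInterval} (ht : t < 1) :
    ∫ ω, f (scaled t ω) ∂(ProbabilityTheory.cond μ (nonintersecting n))
      = (noncross θ a)⁻¹ * ∫ y, f (a + y) * noncross θ (a + y)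
          ∂stepLaw σ (levelDrift σ θ) (Real.toNNReal (clock t)) := by
  rw [ProbabilityTheory.cond, integral_smul_measure, h.setIntegral_nonintersecting hσ hθ ha hf ht,
    ← h.measureReal_nonintersecting hσ hθ ha, ENNReal.toReal_inv, smul_eq_mul, Measure.real]

end Conditioned

/-! ### The confluent limit -/

section Confluent

open scoped NNReal

variable {n : ℕ}

/-- The Vandermonde product `∏_{i<j} (x_j - x_i)`. -/
def gapProd (x : Fin n → ℝ) : ℝ := ∏ p ∈ ltPairs n, (x p.2 - x p.1)

lemma gapProd_pos {x : Fin n → ℝ} (hx : StrictMono x) : 0 < gapProd x :=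
  Finset.prod_pos fun p hp => strictMono_iff_ltPairs.1 hx p hp

lemma tendsto_noncross_div (x : Fin n → ℝ) :
    Tendsto (fun θ : ℝ => noncross θ x / θ ^ (ltPairs n).card) (𝓝[>] 0) (𝓝 (gapProd x)) := by
  have h : ∀ p ∈ ltPairs n, Tendsto (fun θ : ℝ => (1 - Real.exp (-(θ * (x p.2 - x p.1)))) / θ)
      (𝓝[>] 0) (𝓝 (x p.2 - x p.1)) := by
    intro p _
    set d := x p.2 - x p.1
    have hd : HasDerivAt (fun θ : ℝ => 1 - Real.exp (-(θ * d))) d 0 := by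
      have := (((hasDerivAt_id (0 : ℝ)).mul_const d).neg.exp).const_sub 1
      simpa using this
    have := hd.tendsto_slope_zero_right
    refine this.congr fun θ => ?_
    simp [div_eq_inv_mul]
  refine (tendsto_finsetProd (ltPairs n) h).congr fun θ => ?_
  rw [Finset.prod_div_distrib, Finset.prod_const, noncross]

/-- From `|1 - exp (-θ d)| ≤ θ |d| exp |d|` in each factor: a bound uniform in `0 < θ ≤ 1`, for
dominated convergence. -/
lemma abs_noncross_div_le {θ : ℝ} (hθ : 0 < θ) (hθ1 : θ ≤ 1) (x y : Fin n → ℝ) :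
    |noncross θ (x + y) / θ ^ (ltPairs n).card|
      ≤ Real.exp (2 * ((ltPairs n).card * (2 * ∑ i, |x i|)))
        * Real.exp (4 * (ltPairs n).card * ∑ i, |y i|) := by
  set N := (ltPairs n).card
  have hd : ∀ p : Fin n × Fin n, |(x + y) p.2 - (x + y) p.1| ≤ 2 * ∑ i, |x i| + 2 * ∑ i, |y i| := by
    intro p
    have h1 := abs_le_l1 x p.1
    have h2 := abs_le_l1 x p.2
    have h3 := abs_le_l1 y p.1
    have h4 := abs_le_l1 y p.2
    rw [abs_le] at h1 h2 h3 h4 ⊢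
    simp only [Pi.add_apply]
    constructor <;> linarith [h1.1, h1.2, h2.1, h2.2, h3.1, h3.2, h4.1, h4.2]
  rw [noncross, ← Finset.prod_const, ← Finset.prod_div_distrib]
  refine (abs_prod_le_pow_card _ (B := Real.exp (2 * (2 * ∑ i, |x i| + 2 * ∑ i, |y i|)))
    fun p _ => ?_).trans_eq ?_
  · set d := (x + y) p.2 - (x + y) p.1 with hdd
    have h1 : |Real.exp 0 - Real.exp (-(θ * d))| ≤ |0 - -(θ * d)| * Real.exp |d| :=
      abs_exp_sub_exp_le (Real.exp_le_exp.2 (abs_nonneg _)) (Real.exp_le_exp.2 (by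
        refine (le_abs_self _).trans ?_
        rw [abs_neg, abs_mul, abs_of_pos hθ]
        exact mul_le_of_le_one_left (abs_nonneg _) hθ1))
    rw [Real.exp_zero, zero_sub, neg_neg, abs_mul, abs_of_pos hθ] at h1
    rw [abs_div, abs_of_pos hθ, div_le_iff₀ hθ]
    have h2 : |d| ≤ Real.exp |d| := (by linarith [Real.add_one_le_exp |d|])
    calc |1 - Real.exp (-(θ * d))| ≤ θ * |d| * Real.exp |d| := h1
      _ ≤ θ * Real.exp |d| * Real.exp |d| := by gcongr
      _ = Real.exp (2 * |d|) * θ := by rw [mul_assoc, ← Real.exp_add]; ring_nf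
      _ ≤ _ := by
        gcongr
        exact hd p
  · rw [← Real.exp_nat_mul, ← Real.exp_add]
    congr 1
    ring

lemma measurable_gapProd : Measurable (gapProd : (Fin n → ℝ) → ℝ) := by
  unfold gapProd; fun_prop

variable {σ : ℝ} {a : Fin n → ℝ} {Q : Measure (PathSpace n)} {K : ℝ}

/-- After Cameron–Martin the reference Gaussian no longer depends on `θ`, so the limit can be taken
under the integral; the tilt and its constant tend to `1`. -/
lemma tendsto_integral_step {f : (Fin n → ℝ) → ℝ} (hf : SymLip K f) (σ : ℝ) (a : Fin n → ℝ)
    (δ : ℝ≥0) :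
    Tendsto (fun θ : ℝ => ∫ y, f (a + y) * (noncross θ (a + y) / θ ^ (ltPairs n).card)
        ∂stepLaw σ (levelDrift σ θ) δ) (𝓝[>] 0)
      (𝓝 (∫ y, f (a + y) * gapProd (a + y) ∂gaussPi 0 fun _ => stepVar σ δ)) := by
  simp only [integral_stepLaw]
  have hc : Tendsto (fun θ : ℝ => Real.exp (-cmConst n σ θ δ)) (𝓝[>] 0) (𝓝 1) := by
    have : Continuous fun θ : ℝ => Real.exp (-cmConst n σ θ δ) := by unfold cmConst; fun_prop
    have h := this.tendsto 0
    simp only [cmConst] at h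
    exact (by simpa [cmConst] using h : Tendsto _ _ _).mono_left nhdsWithin_le_nhds
  rw [← one_mul (∫ y, f (a + y) * gapProd (a + y) ∂gaussPi 0 fun _ => stepVar σ δ)]
  refine hc.mul ?_
  set N := (ltPairs n).card
  have hlev : ∀ y : Fin n → ℝ, |levelSum y| ≤ n * ∑ i, |y i| := by
    intro y
    rw [levelSum, Finset.mul_sum]
    refine (Finset.abs_sum_le_sum_abs _ _).trans (Finset.sum_le_sum fun i _ => ?_)
    rw [abs_mul, Nat.abs_cast]
    gcongr
    exact i.2.le
  refine tendsto_integral_filter_of_dominated_convergence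
    (fun y => K * Real.exp (2 * (N * (2 * ∑ i, |a i|)))
      * Real.exp ((4 * N + n) * ∑ i, |y i|)) (Eventually.of_forall fun θ => ?_) ?_
    ((integrable_exp_l1_gaussPi _ _ _).const_mul _) (Eventually.of_forall fun y => ?_)
  · have h1 : Measurable fun y : Fin n → ℝ => f (a + y) := hf.cont.measurable.comp (by fun_prop)
    have h2 : Measurable fun y : Fin n → ℝ => noncross θ (a + y) :=
      (measurable_noncross θ).comp (by fun_prop)
    have h3 : Measurable fun y : Fin n → ℝ => Real.exp (θ * levelSum y) := by
      unfold levelSum; fun_prop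
    exact ((h1.mul (h2.div_const _)).mul h3).aestronglyMeasurable
  · filter_upwards [self_mem_nhdsWithin,
      (eventually_lt_nhds (zero_lt_one' ℝ)).filter_mono nhdsWithin_le_nhds] with θ hθ hθ1
    refine Eventually.of_forall fun y => ?_
    have hθ : 0 < θ := hθ
    rw [Real.norm_eq_abs, abs_mul, abs_mul, abs_of_pos (Real.exp_pos _)]
    have h1 : θ * levelSum y ≤ n * ∑ i, |y i| := by
      refine (le_abs_self _).trans ?_
      rw [abs_mul, abs_of_pos hθ]
      exact (mul_le_of_le_one_left (abs_nonneg _) hθ1.le).trans (hlev y)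
    calc |f (a + y)| * |noncross θ (a + y) / θ ^ N| * Real.exp (θ * levelSum y)
        ≤ K * (Real.exp (2 * (N * (2 * ∑ i, |a i|))) * Real.exp (4 * N * ∑ i, |y i|))
          * Real.exp (n * ∑ i, |y i|) := by
          gcongr
          · exact mul_nonneg hf.nonneg (by positivity)
          · exact hf.nonneg
          · exact hf.bdd _
          · exact abs_noncross_div_le hθ hθ1.le a y
      _ = _ := by
          rw [add_mul, Real.exp_add]; ring
  · have h1 : Tendsto (fun θ : ℝ => Real.exp (θ * levelSum y)) (𝓝[>] 0) (𝓝 1) := by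
      have : Continuous fun θ : ℝ => Real.exp (θ * levelSum y) := by fun_prop
      have h := this.tendsto 0
      rw [zero_mul, Real.exp_zero] at h
      exact h.mono_left nhdsWithin_le_nhds
    simpa using ((tendsto_noncross_div (a + y)).const_mul (f (a + y))).mul h1

/-- A bounded continuous function of the position at time `t`. -/
noncomputable def evalBCF (t : unitInterval) (f : (Fin n → ℝ) → ℝ) (hf : Continuous f)
    (hK : ∀ x, |f x| ≤ K) : PathSpace n →ᵇ ℝ :=
  BoundedContinuousFunction.ofNormedAddCommGroup (fun ω => f (ω t))
    (hf.comp (continuous_eval_const t)) K fun _ => hK _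

lemma tendsto_levelDrift (hσ : 0 < σ) :
    Tendsto (fun θ : ℝ => (levelDrift σ θ : Fin n → ℝ)) (𝓝[>] 0)
      (𝓝[{b : Fin n → ℝ | StrictMono b}] 0) := by
  refine tendsto_nhdsWithin_iff.2 ⟨?_, ?_⟩
  · have : Continuous fun θ : ℝ => (levelDrift σ θ : Fin n → ℝ) := by
      unfold levelDrift; fun_prop
    have h := this.tendsto 0
    have h0 : (levelDrift σ 0 : Fin n → ℝ) = 0 := by funext j; simp [levelDrift]
    rw [h0] at h
    exact h.mono_left nhdsWithin_le_nhds
  · filter_upwards [self_mem_nhdsWithin] with θ hθ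
    exact strictMono_levelDrift hσ hθ

/-- The expectation of a symmetric function of the confluent paths at a fixed time. -/
theorem IsConfluentLaw.integral_symm (h : IsConfluentLaw σ a Q) (hσ : 0 < σ) (ha : StrictMono a)
    {f : (Fin n → ℝ) → ℝ} (hf : SymLip K f) {t : unitInterval} (ht : t < 1) :
    gapProd a * ∫ ω, f (ω t) ∂Q
      = ∫ y, f (fun i => (1 - t) * (a + y) i) * gapProd (a + y)
          ∂gaussPi 0 fun _ => stepVar σ (Real.toNNReal (clock t)) := by
  obtain ⟨-, R, hR, hlim⟩ := h
  have ht0 := one_sub_pos_of_lt ht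
  have hF := hf.comp_mul ht0.le (sub_le_self 1 t.2.1)
  -- The limit over all ordered end points is specialized to the equally spaced ones, for which the
  -- noncrossing probability is explicit.
  have h1 := (hlim (evalBCF t f hf.cont hf.bdd)).comp (tendsto_levelDrift (n := n) hσ)
  have h2 := (tendsto_noncross_div a).mul h1
  have h3 := tendsto_integral_step hF σ a (Real.toNNReal (clock t))
  refine tendsto_nhds_unique (h2.congr' ?_) h3
  filter_upwards [self_mem_nhdsWithin] with θ hθ
  have hθ : 0 < θ := hθ
  have h4 := (hR _ (strictMono_levelDrift hσ hθ)).integral_cond hσ hθ ha hF ht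
  have h5 : ∀ ω : PathSpace n, (fun i => (1 - (t : ℝ)) * scaled t ω i) = ω t := fun ω => by
    funext i
    rw [scaled]
    field_simp
  simp only [h5] at h4
  have hv := (noncross_pos hθ ha).ne'
  change noncross θ a / θ ^ (ltPairs n).card
    * ∫ ω, f (ω t) ∂(ProbabilityTheory.cond (R (levelDrift σ θ)) (nonintersecting n)) = _
  rw [h4, ← mul_assoc, div_mul_eq_mul_div, mul_inv_cancel₀ hv, one_div, ← integral_const_mul]
  refine integral_congr_ae (Eventually.of_forall fun y => ?_)
  simp only
  ring

/-- Weak order is a closed condition on the position at time `t` and so survives the weak limit. -/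
lemma IsConfluentLaw.ae_monotone (h : IsConfluentLaw σ a Q) (hσ : 0 < σ) (t : unitInterval) :
    ∀ᵐ ω ∂Q, Monotone (ω t) := by
  obtain ⟨hQ, R, hR, hlim⟩ := h
  -- A bounded continuous nonnegative function whose zeros are exactly the weakly increasing
  -- vectors.
  set φ : (Fin n → ℝ) → ℝ := fun x => min 1 (∑ p ∈ ltPairs n, max 0 (x p.1 - x p.2)) with hφ
  have hφc : Continuous φ := by fun_prop
  have hφ0 : ∀ x, 0 ≤ φ x := fun x =>
    le_min zero_le_one (Finset.sum_nonneg fun _ _ => le_max_left _ _)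
  have hφ1 : ∀ x, |φ x| ≤ 1 := fun x => by
    rw [abs_of_nonneg (hφ0 x)]; exact min_le_left _ _
  have hφmono : ∀ x, φ x = 0 ↔ Monotone x := by
    intro x
    constructor
    · intro hx i j hij
      rcases hij.eq_or_lt with rfl | hij
      · exact le_rfl
      have hs : ∑ p ∈ ltPairs n, max 0 (x p.1 - x p.2) = 0 := by
        rcases min_choice 1 (∑ p ∈ ltPairs n, max 0 (x p.1 - x p.2)) with h | h
        · exact absurd (h.symm.trans hx) one_ne_zero
        · exact h.symm.trans hx
      have := (Finset.sum_eq_zero_iff_of_nonneg fun _ _ => le_max_left _ _).1 hs (i, j)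
        (mem_ltPairs.2 hij)
      have h2 : x i - x j ≤ 0 := max_eq_left_iff.1 this
      linarith
    · intro hx
      have : ∑ p ∈ ltPairs n, max 0 (x p.1 - x p.2) = 0 := Finset.sum_eq_zero fun p hp =>
        max_eq_left (sub_nonpos.2 (hx (mem_ltPairs.1 hp).le))
      simp [hφ, this]
  have h1 := (hlim (evalBCF t φ hφc hφ1)).comp (tendsto_levelDrift (n := n) hσ)
  have h2 : ∫ ω, φ (ω t) ∂Q = 0 := by
    refine tendsto_nhds_unique h1 (tendsto_const_nhds.congr fun θ => ?_)
    symm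
    refine integral_eq_zero_of_ae ?_
    filter_upwards [ae_cond_mem (μ := R (levelDrift σ θ)) measurableSet_nonintersecting] with ω hω
    exact (hφmono _).2 (hω t).monotone
  have hm : Measurable fun ω : PathSpace n => φ (ω t) :=
    hφc.measurable.comp (measurable_eval_path t)
  rw [integral_eq_zero_iff_of_nonneg (fun ω => hφ0 _)
    ((integrable_const (1 : ℝ)).mono' hm.aestronglyMeasurable
      (Eventually.of_forall fun ω => hφ1 _))] at h2
  filter_upwards [h2] with ω hω
  exact (hφmono _).1 hω

end Confluent

/-! ### Symmetrized characters determine laws of ordered vectors -/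

section Symmetrization

open scoped NNReal

variable {n : ℕ}

lemma symChar_comp_perm (ξ x : Fin n → ℝ) (τ : Equiv.Perm (Fin n)) :
    symChar ξ (x ∘ τ) = symChar ξ x :=
  Fintype.sum_equiv (Equiv.mulLeft τ) _ _ fun _ => rfl

lemma continuous_symChar (ξ : Fin n → ℝ) : Continuous (symChar ξ) := by
  unfold symChar; fun_prop

lemma norm_symChar_le (ξ x : Fin n → ℝ) : ‖symChar ξ x‖ ≤ n.factorial := by
  refine (norm_sum_le _ _).trans ?_
  simp only [Complex.norm_exp_I_mul_ofReal]
  simp [Fintype.card_perm]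

lemma norm_exp_I_sub_le (p q : ℝ) :
    ‖Complex.exp (Complex.I * p) - Complex.exp (Complex.I * q)‖ ≤ |p - q| := by
  have h := Real.norm_exp_I_mul_ofReal_sub_one_le (x := p - q)
  have e : Complex.exp (Complex.I * p) - Complex.exp (Complex.I * q)
      = Complex.exp (Complex.I * q) * (Complex.exp (Complex.I * ((p - q : ℝ) : ℂ)) - 1) := by
    rw [mul_sub, ← Complex.exp_add]
    push_cast
    ring_nf
  rw [e, norm_mul, Complex.norm_exp_I_mul_ofReal, one_mul]
  simpa using h

lemma norm_symChar_sub_le (ξ x y : Fin n → ℝ) :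
    ‖symChar ξ x - symChar ξ y‖ ≤ n.factorial * (∑ j, |ξ j|) * ∑ j, |x j - y j| := by
  rw [symChar, symChar, ← Finset.sum_sub_distrib]
  refine (norm_sum_le _ _).trans ((Finset.sum_le_card_nsmul _ _
    ((∑ j, |ξ j|) * ∑ j, |x j - y j|) fun σ _ => ?_).trans_eq ?_)
  · refine (norm_exp_I_sub_le _ _).trans ?_
    rw [← Finset.sum_sub_distrib]
    simp only [← mul_sub]
    exact abs_linear_perm_le ξ (fun j => x j - y j) σ
  · simp [Fintype.card_perm, mul_assoc]

/-- For `φ` the real or imaginary part, this makes the characters admissible test functions on the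
path side. -/
lemma symLip_symChar (ξ : Fin n → ℝ) {φ : ℂ → ℝ} (hφc : Continuous φ) (hφ : ∀ z, |φ z| ≤ ‖z‖)
    (hφs : ∀ z w, φ z - φ w = φ (z - w)) :
    SymLip (n.factorial * (1 + ∑ j, |ξ j|)) fun x : Fin n → ℝ => φ (symChar ξ x) where
  cont := hφc.comp (continuous_symChar ξ)
  symm x τ := by rw [symChar_comp_perm]
  bdd x := by
    refine ((hφ _).trans (norm_symChar_le ξ x)).trans (le_mul_of_one_le_right (by positivity) ?_)
    linarith [Finset.sum_nonneg fun (j : Fin n) (_ : j ∈ Finset.univ) => abs_nonneg (ξ j)]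
  lip x y := by
    rw [hφs]
    refine ((hφ _).trans (norm_symChar_sub_le ξ x y)).trans ?_
    gcongr
    linarith

/-- The sum of the images of a measure under all permutations of the coordinates. -/
noncomputable def symmetrize (μ : Measure (Fin n → ℝ)) : Measure (Fin n → ℝ) :=
  ∑ σ : Equiv.Perm (Fin n), μ.map fun x => x ∘ σ

lemma measurable_comp_perm (σ : Equiv.Perm (Fin n)) : Measurable fun x : Fin n → ℝ => x ∘ σ :=
  measurable_pi_lambda _ fun i => measurable_pi_apply (σ i)

instance (μ : Measure (Fin n → ℝ)) [IsFiniteMeasure μ] : IsFiniteMeasure (symmetrize μ) := by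
  unfold symmetrize; infer_instance

/-- The characteristic function of the symmetrized measure is the integral of `symChar` against the
original one. -/
lemma symmetrize_eq_of_integral_symChar {μ ν : Measure (Fin n → ℝ)} [IsFiniteMeasure μ]
    [IsFiniteMeasure ν] (h : ∀ ξ, ∫ x, symChar ξ x ∂μ = ∫ x, symChar ξ x ∂ν) :
    symmetrize μ = symmetrize ν := by
  have key : ∀ (ρ : Measure (Fin n → ℝ)) [IsFiniteMeasure ρ] (L : StrongDual ℝ (Fin n → ℝ)),
      charFunDual (symmetrize ρ) L = ∫ x, symChar (fun j => L (Pi.single j 1)) x ∂ρ := by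
    intro ρ _ L
    have hL : ∀ y, L y = ∑ j, L (Pi.single j 1) * y j := by
      intro y
      conv_lhs => rw [pi_eq_sum_univ' y, map_sum]
      refine Finset.sum_congr rfl fun j _ => ?_
      rw [map_smul, smul_eq_mul, mul_comm]
    have hb : ∀ (ρ' : Measure (Fin n → ℝ)) [IsFiniteMeasure ρ'],
        Integrable (fun x => Complex.exp (L x * Complex.I)) ρ' := fun ρ' _ =>
      (integrable_const (1 : ℝ)).mono' (by fun_prop) (Eventually.of_forall fun x => by
        rw [Complex.norm_exp_ofReal_mul_I])
    rw [charFunDual_apply, symmetrize, integral_finsetSum_measure fun σ _ => hb _]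
    simp only [symChar]
    rw [integral_finsetSum]
    · refine Finset.sum_congr rfl fun σ _ => ?_
      rw [integral_map (measurable_comp_perm σ).aemeasurable (hb _).1]
      refine integral_congr_ae (Eventually.of_forall fun x => ?_)
      simp only
      rw [hL, mul_comm]
      rfl
    · intro σ _
      have hc : Continuous fun x : Fin n → ℝ => Complex.exp
          (Complex.I * ((∑ j, L (Pi.single j 1) * x (σ j) : ℝ) : ℂ)) := by fun_prop
      refine (integrable_const (1 : ℝ)).mono' hc.aestronglyMeasurable
        (Eventually.of_forall fun x => ?_)
      rw [Complex.norm_exp_I_mul_ofReal]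
  exact Measure.ext_of_charFunDual (funext fun L => by rw [key, key, h])

lemma symmetrize_apply_of_symm {μ : Measure (Fin n → ℝ)} {U : Set (Fin n → ℝ)}
    (hU : MeasurableSet U) (hs : ∀ (σ : Equiv.Perm (Fin n)) x, x ∘ σ ∈ U ↔ x ∈ U) :
    symmetrize μ U = n.factorial * μ U := by
  rw [symmetrize, Measure.finsetSum_apply]
  have : ∀ σ : Equiv.Perm (Fin n), μ.map (fun x => x ∘ σ) U = μ U := fun σ => by
    rw [Measure.map_apply (measurable_comp_perm σ) hU]
    congr 1
    ext x
    exact hs σ x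
  simp [this, Fintype.card_perm]

lemma measurableSet_monotone : MeasurableSet {x : Fin n → ℝ | Monotone x} :=
  isClosed_monotone.measurableSet

/-- On ordered vectors a Borel set coincides with the permutation saturation of its ordered part,
and on invariant sets `symmetrize` is `n!` times the measure. Ties are harmless, since the sorted
rearrangement is unique as a vector. -/
lemma eq_of_symmetrize_eq {μ ν : Measure (Fin n → ℝ)} (hμ : ∀ᵐ x ∂μ, Monotone x)
    (hν : ∀ᵐ x ∂ν, Monotone x) (h : symmetrize μ = symmetrize ν) : μ = ν := by
  ext B hB
  set B' := B ∩ {x | Monotone x} with hB'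
  have hB'm : MeasurableSet B' := hB.inter measurableSet_monotone
  set U : Set (Fin n → ℝ) := ⋃ σ : Equiv.Perm (Fin n), (fun x => x ∘ σ) ⁻¹' B' with hU
  have hUm : MeasurableSet U := MeasurableSet.iUnion fun σ => measurable_comp_perm σ hB'm
  have hUs : ∀ (σ : Equiv.Perm (Fin n)) x, x ∘ σ ∈ U ↔ x ∈ U := by
    intro σ x
    simp only [hU, Set.mem_iUnion, Set.mem_preimage]
    refine ⟨fun ⟨τ, hτ⟩ => ⟨σ * τ, hτ⟩, fun ⟨τ, hτ⟩ => ⟨σ⁻¹ * τ, ?_⟩⟩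
    convert hτ using 1
    funext i
    simp
  have hmem : ∀ x, Monotone x → (x ∈ U ↔ x ∈ B) := by
    intro x hx
    simp only [hU, Set.mem_iUnion, Set.mem_preimage]
    constructor
    · rintro ⟨τ, hτ⟩
      have := Tuple.unique_monotone (f := x) (σ := τ) (τ := 1) hτ.2 hx
      rw [this] at hτ
      exact hτ.1
    · exact fun hxB => ⟨1, hxB, hx⟩
  have key : ∀ {ρ : Measure (Fin n → ℝ)}, (∀ᵐ x ∂ρ, Monotone x) → ρ B = ρ U := by
    intro ρ hρ
    refine measure_congr ?_
    filter_upwards [hρ] with x hx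
    exact propext (hmem x hx).symm
  have h1 : (n.factorial : ℝ≥0∞) * μ U = n.factorial * ν U := by
    rw [← symmetrize_apply_of_symm hUm hUs, ← symmetrize_apply_of_symm hUm hUs, h]
  rw [key hμ, key hν]
  refine (ENNReal.mul_right_inj ?_ (ENNReal.natCast_ne_top _)).1 h1
  exact_mod_cast n.factorial_ne_zero

lemma symmetrize_absolutelyContinuous {μ : Measure (Fin n → ℝ)} (hμ : μ ≪ volume) :
    symmetrize μ ≪ volume := by
  refine Measure.AbsolutelyContinuous.mk fun s hs h0 => ?_
  rw [symmetrize, Measure.finsetSum_apply]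
  refine Finset.sum_eq_zero fun σ _ => ?_
  have hmp : MeasurePreserving (fun x : Fin n → ℝ => x ∘ σ) volume volume := by
    have h := volume_measurePreserving_piCongrLeft (fun _ : Fin n => ℝ) σ.symm
    convert h using 1
    funext y i
    have := Equiv.piCongrLeft_apply_apply (fun _ : Fin n => ℝ) σ.symm y (σ i)
    simpa [MeasurableEquiv.coe_piCongrLeft] using this.symm
  rw [Measure.map_apply (measurable_comp_perm σ) hs]
  exact hμ (by rw [hmp.measure_preimage hs.nullMeasurableSet, h0])

/-- The identity permutation contributes the measure itself; absolute continuity can thus be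
inherited from the symmetrization. -/
lemma le_symmetrize (μ : Measure (Fin n → ℝ)) : μ ≤ symmetrize μ := by
  refine Measure.le_intro fun s _ _ => ?_
  rw [symmetrize, Measure.finsetSum_apply]
  refine le_trans (le_of_eq ?_) (Finset.single_le_sum
    (f := fun σ : Equiv.Perm (Fin n) => μ.map (fun x => x ∘ σ) s) (fun _ _ => zero_le)
    (Finset.mem_univ 1))
  simp

end Symmetrization

/-! ### Comparison for a fixed starting configuration -/

section FixedStart

open scoped NNReal

variable {n : ℕ}

lemma evalR_vand (x : Fin n → ℝ) : evalR x (vand n) = (gapProd x : ℂ) := by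
  have h : evalR x (vand n) = (Matrix.vandermonde fun i => (x i : ℂ)).det := by
    rw [evalR, vand, RingHom.map_det]
    congr 1
    ext i j
    simp [Matrix.vandermonde_apply]
  rw [h, Matrix.det_vandermonde, ← prod_ltPairs fun i j => (x j : ℂ) - x i, gapProd]
  push_cast
  rfl

lemma integrable_gapProd (m : Fin n → ℝ) (w : Fin n → ℝ≥0) : Integrable gapProd (gaussPi m w) := by
  have := (integrable_evalR m w (vand n)).re
  simpa [evalR_vand] using this

lemma gapProd_smul (r : ℝ) (x : Fin n → ℝ) :
    gapProd (r • x) = r ^ (ltPairs n).card * gapProd x := by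
  simp only [gapProd, Pi.smul_apply, smul_eq_mul, ← mul_sub, Finset.prod_mul_distrib,
    Finset.prod_const]

variable {σ : ℝ} {a : Fin n → ℝ} {Q : Measure (PathSpace n)} {K : ℝ}

/-- The variance at time `t` of a bridge with diffusion parameter `σ`. -/
noncomputable def bridgeVar (σ : ℝ) (t : unitInterval) : ℝ≥0 := Real.toNNReal (σ ^ 2 * (t * (1 - t)))

/-- Undoing the rescaling by `1 - t` turns the variance `σ² t / (1 - t)` into `σ² t (1 - t)`; the
powers of `1 - t` from both Vandermonde products balance. -/
lemma IsConfluentLaw.gapProd_mul_integral (h : IsConfluentLaw σ a Q) (hσ : 0 < σ)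
    (ha : StrictMono a) {f : (Fin n → ℝ) → ℝ} (hf : SymLip K f) {t : unitInterval} (ht : t < 1) :
    gapProd ((1 - t : ℝ) • a) * ∫ ω, f (ω t) ∂Q
      = ∫ y, f y * gapProd y ∂gaussPi ((1 - t : ℝ) • a) fun _ => bridgeVar σ t := by
  have ht0 := one_sub_pos_of_lt ht
  have hmap := gaussPi_map_affine (0 : Fin n → ℝ) ((1 - t : ℝ) • a)
    (fun _ => stepVar σ (Real.toNNReal (clock t))) (1 - t)
  have hvar : NNReal.mk ((1 - (t : ℝ)) ^ 2) (sq_nonneg _) * stepVar σ (Real.toNNReal (clock t))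
      = bridgeVar σ t := by
    ext
    rw [NNReal.coe_mul, coe_stepVar, Real.coe_toNNReal _ (clock_nonneg t), bridgeVar,
      Real.coe_toNNReal _ (mul_nonneg (sq_nonneg σ) (mul_nonneg t.2.1 ht0.le)), clock,
      NNReal.coe_mk]
    field_simp
  have hm : Measurable fun y : Fin n → ℝ => f y * gapProd y :=
    hf.cont.measurable.mul measurable_gapProd
  simp only [hvar, Pi.zero_apply, mul_zero, add_zero] at hmap
  have hmm : Measurable fun (p : Fin n → ℝ) i => ((1 - t : ℝ) • a) i + (1 - (t : ℝ)) * p i := by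
    fun_prop
  have hI := integral_map (μ := gaussPi 0 fun _ => stepVar σ (Real.toNNReal (clock t)))
    hmm.aemeasurable hm.aestronglyMeasurable
  rw [hmap] at hI
  rw [hI, gapProd_smul, mul_assoc, h.integral_symm hσ ha hf ht, ← integral_const_mul]
  refine integral_congr_ae (Eventually.of_forall fun y => ?_)
  have e : (fun i => ((1 - t : ℝ) • a) i + (1 - t) * y i) = (1 - t : ℝ) • (a + y) := by
    funext i; simp [mul_add]
  simp only
  rw [e, gapProd_smul]
  change _ * (f ((1 - t : ℝ) • (a + y)) * _) = _
  ring

lemma integrable_symChar {μ : Measure (Fin n → ℝ)} [IsFiniteMeasure μ] (ξ : Fin n → ℝ) :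
    Integrable (symChar ξ) μ :=
  (integrable_const (n.factorial : ℝ)).mono' (continuous_symChar ξ).aestronglyMeasurable
    (Eventually.of_forall fun x => norm_symChar_le ξ x)

lemma integrable_symChar_mul_gapProd (ξ m : Fin n → ℝ) (w : Fin n → ℝ≥0) :
    Integrable (fun y => symChar ξ y * (gapProd y : ℂ)) (gaussPi m w) :=
  (integrable_gapProd m w).ofReal.bdd_mul (continuous_symChar ξ).aestronglyMeasurable
    (Eventually.of_forall fun x => norm_symChar_le ξ x)

lemma IsConfluentLaw.gapProd_mul_integral_symChar (h : IsConfluentLaw σ a Q) (hσ : 0 < σ)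
    (ha : StrictMono a) {t : unitInterval} (ht : t < 1) (ξ : Fin n → ℝ) :
    (gapProd ((1 - t : ℝ) • a) : ℂ) * ∫ x, symChar ξ x ∂Q.map (fun ω => ω t)
      = ∫ y, symChar ξ y * gapProd y ∂gaussPi ((1 - t : ℝ) • a) fun _ => bridgeVar σ t := by
  have := h.1
  have := Measure.isProbabilityMeasure_map (μ := Q) (measurable_eval_path (n := n) t).aemeasurable
  have hint := integrable_symChar (μ := Q.map fun ω => ω t) ξ
  have hint2 := integrable_symChar_mul_gapProd ξ ((1 - t : ℝ) • a) fun _ => bridgeVar σ t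
  have key : ∀ φ : ℂ →L[ℝ] ℝ, (∀ z, |φ z| ≤ ‖z‖) →
      φ ((gapProd ((1 - t : ℝ) • a) : ℂ) * ∫ x, symChar ξ x ∂Q.map (fun ω => ω t))
        = φ (∫ y, symChar ξ y * gapProd y ∂gaussPi ((1 - t : ℝ) • a) fun _ => bridgeVar σ t) := by
    intro φ hφ
    have hf := symLip_symChar ξ φ.continuous hφ fun z w => (map_sub φ z w).symm
    rw [← Complex.real_smul, map_smul, ← φ.integral_comp_comm hint, ← φ.integral_comp_comm hint2,
      integral_map (measurable_eval_path t).aemeasurable (by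
        exact (φ.continuous.comp (continuous_symChar ξ)).aestronglyMeasurable),
      smul_eq_mul, h.gapProd_mul_integral hσ ha hf ht]
    refine integral_congr_ae (Eventually.of_forall fun y => ?_)
    simp only
    rw [mul_comm (symChar ξ y), ← Complex.real_smul, map_smul, smul_eq_mul, mul_comm]
  exact Complex.ext (key Complex.reCLM Complex.abs_re_le_norm)
    (key Complex.imCLM Complex.abs_im_le_norm)

lemma gue_isProbabilityMeasure (hn : 0 < n) : IsProbabilityMeasure (gue n) := by
  rw [gue_eq_map hn]
  exact Measure.isProbabilityMeasure_map (measurable_hermOf n).aemeasurable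

lemma measurable_add_smul (r ρ : ℝ) : Measurable
    fun z : Matrix (Fin n) (Fin n) ℂ × Matrix (Fin n) (Fin n) ℂ => r • z.1 + ρ • z.2 := by
  refine measurable_pi_lambda _ fun i => measurable_pi_lambda _ fun j => ?_
  have h : ∀ {W : Type} [MeasurableSpace W] (g : W → Matrix (Fin n) (Fin n) ℂ), Measurable g →
      Measurable fun w => g w i j := fun g hg =>
    (measurable_pi_apply j).comp
      ((measurable_pi_apply (X := fun _ : Fin n => Fin n → ℂ) i).comp hg)
  exact ((h _ measurable_fst).const_smul r).add ((h _ measurable_snd).const_smul ρ)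

/-- In real coordinates `A + ρ H` is a Gaussian vector centred at the coordinates of `A`, so
`integral_symChar_eigenvalues` applies. The right side has the form found for the paths. -/
lemma integral_symChar_gue (hn : 0 < n) {A : Matrix (Fin n) (Fin n) ℂ} (hA : A.IsHermitian) (ρ : ℝ)
    (ξ : Fin n → ℝ) :
    (gapProd (orderedEigenvalues A) : ℂ)
        * ∫ x, symChar ξ x ∂(gue n).map (fun H => orderedEigenvalues (A + ρ • H))
      = ∫ y, symChar ξ y * gapProd y
          ∂gaussPi (orderedEigenvalues A) fun _ => .mk (ρ ^ 2) (sq_nonneg ρ) * (n : ℝ≥0)⁻¹ := by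
  have h := integral_symChar_eigenvalues ξ (coordsOf A) (.mk (ρ ^ 2) (sq_nonneg ρ) * (n : ℝ≥0)⁻¹)
  rw [hermOf_coordsOf hA] at h
  simp only [evalR_vand] at h
  have hmap := gaussPi_map_affine (0 : Fin n × Fin n → ℝ) (coordsOf A) (coordVar (n : ℝ≥0)⁻¹) ρ
  have hvar : (fun i : Fin n × Fin n => NNReal.mk (ρ ^ 2) (sq_nonneg ρ) * coordVar (n : ℝ≥0)⁻¹ i)
      = coordVar (.mk (ρ ^ 2) (sq_nonneg ρ) * (n : ℝ≥0)⁻¹) := by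
    funext i
    simp only [coordVar]
    split_ifs <;> ring
  rw [hvar] at hmap
  simp only [Pi.zero_apply, mul_zero, add_zero] at hmap
  have hadd : Measurable fun H : Matrix (Fin n) (Fin n) ℂ => A + ρ • H := by
    have := (measurable_add_smul (n := n) 1 ρ).comp (measurable_prodMk_left (x := A))
    simpa [Function.comp_def] using this
  have hsym := (continuous_symChar ξ).measurable
  have hoe : Measurable fun H : Matrix (Fin n) (Fin n) ℂ => orderedEigenvalues (A + ρ • H) :=
    measurable_orderedEigenvalues.comp hadd
  have hL : ∫ x, symChar ξ (orderedEigenvalues (hermOf x))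
        ∂gaussPi (coordsOf A) (coordVar (.mk (ρ ^ 2) (sq_nonneg ρ) * (n : ℝ≥0)⁻¹))
      = ∫ x, symChar ξ x ∂(gue n).map (fun H => orderedEigenvalues (A + ρ • H)) := by
    have hmm : Measurable fun (q : Fin n × Fin n → ℝ) α => coordsOf A α + ρ * q α := by fun_prop
    have hφ : Measurable fun x : Fin n × Fin n → ℝ => symChar ξ (orderedEigenvalues (hermOf x)) :=
      hsym.comp (measurable_orderedEigenvalues.comp (measurable_hermOf n))
    have hI := integral_map (μ := gaussPi 0 (coordVar (n : ℝ≥0)⁻¹)) hmm.aemeasurable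
      hφ.aestronglyMeasurable
    rw [hmap] at hI
    have hψ : Measurable fun H : Matrix (Fin n) (Fin n) ℂ =>
        symChar ξ (orderedEigenvalues (A + ρ • H)) := hsym.comp hoe
    rw [integral_map hoe.aemeasurable hsym.aestronglyMeasurable, gue_eq_map hn,
      integral_map (measurable_hermOf n).aemeasurable hψ.aestronglyMeasurable]
    refine hI.trans ?_
    simp only [hermOf_add_smul, hermOf_coordsOf hA]
  rw [← hL, h]
  simp only [mul_comm]

/-- For a fixed starting configuration the confluent paths and the eigenvalues have the same law. -/
theorem IsConfluentLaw.map_eq (h : IsConfluentLaw σ a Q) (hn : 0 < n) (hσ : 0 < σ)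
    (hσn : σ ^ 2 = (n : ℝ)⁻¹) (ha : StrictMono a) {t : unitInterval} (ht : t < 1)
    {A : Matrix (Fin n) (Fin n) ℂ} (hA : A.IsHermitian) (hAa : orderedEigenvalues A = a) :
    Q.map (fun ω => ω t) = (gue n).map fun H =>
      orderedEigenvalues ((1 - (t : ℝ)) • A + √((t : ℝ) * (1 - t)) • H) := by
  have ht0 := one_sub_pos_of_lt ht
  have hQ := h.1
  have hgue := gue_isProbabilityMeasure hn
  have hA' : ((1 - (t : ℝ)) • A).IsHermitian := by
    rw [Matrix.IsHermitian, Matrix.conjTranspose_smul, hA.eq]; simp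
  have hoe : orderedEigenvalues ((1 - (t : ℝ)) • A) = (1 - (t : ℝ)) • a := by
    rw [orderedEigenvalues_smul hA ht0, hAa]
  have hmeas : Measurable fun H : Matrix (Fin n) (Fin n) ℂ =>
      orderedEigenvalues ((1 - (t : ℝ)) • A + √((t : ℝ) * (1 - t)) • H) :=
    measurable_orderedEigenvalues.comp
      ((measurable_add_smul _ _).comp (measurable_prodMk_left (x := A)))
  have := Measure.isProbabilityMeasure_map (μ := Q) (measurable_eval_path (n := n) t).aemeasurable
  have := Measure.isProbabilityMeasure_map (μ := gue n) hmeas.aemeasurable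
  refine eq_of_symmetrize_eq ?_ ?_ (symmetrize_eq_of_integral_symChar fun ξ => ?_)
  · rw [ae_map_iff (measurable_eval_path t).aemeasurable measurableSet_monotone]
    exact h.ae_monotone hσ t
  · rw [ae_map_iff hmeas.aemeasurable measurableSet_monotone]
    exact Eventually.of_forall fun H => monotone_orderedEigenvalues _
  · have h1 := h.gapProd_mul_integral_symChar hσ ha ht ξ
    have h2 := integral_symChar_gue hn hA' (√((t : ℝ) * (1 - t))) ξ
    have hvar : NNReal.mk (√((t : ℝ) * (1 - t)) ^ 2) (sq_nonneg _) * (n : ℝ≥0)⁻¹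
        = bridgeVar σ t := by
      have h0 : 0 ≤ (t : ℝ) * (1 - t) := mul_nonneg t.2.1 ht0.le
      ext
      rw [NNReal.coe_mul, NNReal.coe_mk, Real.sq_sqrt h0, bridgeVar,
        Real.coe_toNNReal _ (mul_nonneg (sq_nonneg σ) h0), hσn]
      push_cast
      ring
    rw [hoe, hvar, ← h1] at h2
    have hpos : (gapProd ((1 - (t : ℝ)) • a) : ℂ) ≠ 0 := by
      have : 0 < gapProd ((1 - (t : ℝ)) • a) :=
        gapProd_pos fun i j hij => mul_lt_mul_of_pos_left (ha hij) ht0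
      exact_mod_cast this.ne'
    exact (mul_left_cancel₀ hpos h2).symm

/-- At positive times the positions of the confluent paths have a density. -/
theorem IsConfluentLaw.map_absolutelyContinuous (h : IsConfluentLaw σ a Q) (hσ : 0 < σ)
    (ha : StrictMono a) {t : unitInterval} (ht0 : 0 < t) (ht : t < 1) :
    Q.map (fun ω => ω t) ≪ volume := by
  have ht1 := one_sub_pos_of_lt ht
  have ht0' : 0 < (t : ℝ) := ht0
  have hQ := h.1
  have := Measure.isProbabilityMeasure_map (μ := Q) (measurable_eval_path (n := n) t).aemeasurable
  set ν := gaussPi ((1 - t : ℝ) • a) fun _ => bridgeVar σ t with hν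
  set g := gapProd ((1 - t : ℝ) • a) with hg
  have hgpos : 0 < g := gapProd_pos fun i j hij => mul_lt_mul_of_pos_left (ha hij) ht1
  have hνac : ν ≪ volume := gaussPi_absolutelyContinuous _ _ fun _ => by
    rw [bridgeVar]
    exact (Real.toNNReal_pos.2 (by positivity)).ne'
  have hi : Integrable gapProd ν := integrable_gapProd _ _
  -- The density `gapProd` is signed, so its negative part is moved to the side of the path law
  -- before symmetrizing.
  set νp := ν.withDensity fun y => ENNReal.ofReal (gapProd y) with hνp
  set νm := ν.withDensity fun y => ENNReal.ofReal (-gapProd y) with hνm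
  have : IsFiniteMeasure νp := isFiniteMeasure_withDensity_ofReal hi.2
  have : IsFiniteMeasure νm := isFiniteMeasure_withDensity_ofReal hi.neg.2
  have hsym : ∀ ξ, ∫ x, symChar ξ x ∂(ENNReal.ofReal g • Q.map (fun ω => ω t) + νm)
      = ∫ x, symChar ξ x ∂νp := by
    intro ξ
    have hfin : IsFiniteMeasure (ENNReal.ofReal g • Q.map (fun ω => ω t)) :=
      Measure.smul_finite _ ENNReal.ofReal_ne_top
    have h1 := h.gapProd_mul_integral_symChar hσ ha ht ξ
    have hmg := measurable_gapProd (n := n)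
    rw [integral_add_measure (integrable_symChar ξ) (integrable_symChar ξ), integral_smul_measure,
      ENNReal.toReal_ofReal hgpos.le, Complex.real_smul, h1,
      integral_withDensity_eq_integral_toReal_smul (by fun_prop)
        (Eventually.of_forall fun _ => ENNReal.ofReal_lt_top),
      integral_withDensity_eq_integral_toReal_smul (by fun_prop)
        (Eventually.of_forall fun _ => ENNReal.ofReal_lt_top), ← integral_add]
    · refine integral_congr_ae (Eventually.of_forall fun y => ?_)
      simp only [ENNReal.toReal_ofReal', Complex.real_smul]
      rcases le_total 0 (gapProd y) with h0 | h0
      · rw [max_eq_left h0, max_eq_right (neg_nonpos.2 h0)]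
        push_cast
        ring
      · rw [max_eq_right h0, max_eq_left (neg_nonneg.2 h0)]
        push_cast
        ring
    · exact integrable_symChar_mul_gapProd _ _ _
    · have h2 : Integrable (fun y => (((ENNReal.ofReal (-gapProd y)).toReal : ℝ) : ℂ)) ν := by
        simp only [ENNReal.toReal_ofReal']
        exact (hi.neg.pos_part).ofReal
      simp only [Complex.real_smul]
      exact h2.mul_bdd (c := n.factorial) (continuous_symChar ξ).aestronglyMeasurable
        (Eventually.of_forall fun x => norm_symChar_le ξ x)
  have hfin : IsFiniteMeasure (ENNReal.ofReal g • Q.map (fun ω => ω t)) :=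
    Measure.smul_finite _ ENNReal.ofReal_ne_top
  have heq := symmetrize_eq_of_integral_symChar hsym
  have hp : symmetrize νp ≪ volume :=
    symmetrize_absolutelyContinuous ((withDensity_absolutelyContinuous _ _).trans hνac)
  -- A positive multiple of the law is one summand of a measure whose symmetrization is that of
  -- `νp`.
  have hle : ENNReal.ofReal g • Q.map (fun ω => ω t) ≤ symmetrize νp := by
    rw [← heq]
    exact (Measure.le_add_right le_rfl).trans (le_symmetrize _)
  refine (Measure.absolutelyContinuous_smul ?_).trans
    ((Measure.absolutelyContinuous_of_le hle).trans hp)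
  simpa using hgpos

end FixedStart

end NIBM

/-- Let `X` be `n` nonintersecting Brownian paths with diffusion parameter `n^(-1/2)`, confluent
ending point `0` at time `1`, and initial positions distributed as the (ordered) eigenvalues of a
random Hermitian matrix `M` (deterministic if `M` is constant), and let `H` be a GUE matrix
independent of `M`. For every `t ∈ [0, 1)` the positions at time `t` have the same joint law as the
ordered eigenvalues of `(1 - t) M + √(t (1 - t)) H`; for `0 < t` both have a joint density with
respect to Lebesgue measure, and the two densities agree. -/
theorem propositionA1 (n : ℕ) (hn : 0 < n)
    {Ω : Type*} [MeasurableSpace Ω] (P : Measure Ω) [IsProbabilityMeasure P]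
    {Ω' : Type*} [MeasurableSpace Ω'] (P' : Measure Ω') [IsProbabilityMeasure P']
    (X : Ω → NIBM.PathSpace n) (hX : NIBM.IsConfluentPaths ((n : ℝ) ^ (-(1 / 2) : ℝ)) X P)
    (M H : Ω' → Matrix (Fin n) (Fin n) ℂ)
    (hM : AEMeasurable M P') (hMherm : ∀ᵐ ω ∂P', (M ω).IsHermitian)
    (hH : HasLaw H (NIBM.gue n) P') (hMH : IndepFun M H P')
    (hstart : P.map (fun ω => X ω 0) = P'.map (fun ω => NIBM.orderedEigenvalues (M ω)))
    (t : unitInterval) (ht : t < 1) :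
    P.map (fun ω => X ω t) =
        P'.map (fun ω => NIBM.orderedEigenvalues
          ((1 - (t : ℝ)) • M ω + √((t : ℝ) * (1 - (t : ℝ))) • H ω)) ∧
      (0 < t →
        HasPDF (fun ω => X ω t) P volume ∧
        HasPDF (fun ω => NIBM.orderedEigenvalues
          ((1 - (t : ℝ)) • M ω + √((t : ℝ) * (1 - (t : ℝ))) • H ω)) P' volume ∧
        pdf (fun ω => X ω t) P volume =ᵐ[volume]
          pdf (fun ω => NIBM.orderedEigenvalues
            ((1 - (t : ℝ)) • M ω + √((t : ℝ) * (1 - (t : ℝ))) • H ω)) P' volume) := by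
  obtain ⟨κ, hκ, hlaw⟩ := hX.law
  have hn' : (0 : ℝ) < n := by exact_mod_cast hn
  have hσ : 0 < (n : ℝ) ^ (-(1 / 2) : ℝ) := Real.rpow_pos_of_pos hn' _
  have hσn : ((n : ℝ) ^ (-(1 / 2) : ℝ)) ^ 2 = (n : ℝ)⁻¹ := by
    rw [← Real.rpow_natCast, ← Real.rpow_mul hn'.le, ← Real.rpow_neg_one]
    norm_num
  have hgue := NIBM.gue_isProbabilityMeasure hn
  set Φ : Matrix (Fin n) (Fin n) ℂ × Matrix (Fin n) (Fin n) ℂ → Fin n → ℝ := fun z =>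
    NIBM.orderedEigenvalues ((1 - (t : ℝ)) • z.1 + √((t : ℝ) * (1 - (t : ℝ))) • z.2) with hΦ
  have hΦm : Measurable Φ :=
    NIBM.measurable_orderedEigenvalues.comp (NIBM.measurable_add_smul _ _)
  have hXt : ∀ s, AEMeasurable (fun ω => X ω s) P := fun s =>
    (NIBM.measurable_eval_path s).comp_aemeasurable hX.aemeasurable
  have hMo : AEMeasurable (fun ω => NIBM.orderedEigenvalues (M ω)) P' :=
    NIBM.measurable_orderedEigenvalues.comp_aemeasurable hM
  have hZ : AEMeasurable (fun ω => Φ (M ω, H ω)) P' :=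
    hΦm.comp_aemeasurable (hM.prodMk hH.aemeasurable)
  have hsm : MeasurableSet {x : Fin n → ℝ | StrictMono x} := by
    have : {x : Fin n → ℝ | StrictMono x} = ⋂ p ∈ NIBM.ltPairs n, {x | 0 < x p.2 - x p.1} := by
      ext x
      simp [NIBM.strictMono_iff_ltPairs]
    rw [this]
    exact Finset.measurableSet_biInter _ fun p _ => measurableSet_lt measurable_const
      (by fun_prop)
  have hstrict : ∀ᵐ ω ∂P', StrictMono (NIBM.orderedEigenvalues (M ω)) := by
    rw [← ae_map_iff hMo hsm, ← hstart, ae_map_iff (hXt 0) hsm]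
    exact hX.strictMono_start
  -- Both laws are disintegrated over the matrix `M`: here the starting law is replaced by that of
  -- the eigenvalues of `M`, and in `hmat` independence and Fubini freeze `M`.
  have hpath : ∀ B, MeasurableSet B → P.map (fun ω => X ω t) B
      = ∫⁻ ω, (κ (NIBM.orderedEigenvalues (M ω))).map (fun f => f t) B ∂P' := by
    intro B hB
    have hBt := NIBM.measurable_eval_path (n := n) t hB
    have h1 : P.map (fun ω => X ω t) = (P.map X).map fun f => f t :=
      (AEMeasurable.map_map_of_aemeasurable
        (NIBM.measurable_eval_path t).aemeasurable hX.aemeasurable).symm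
    rw [h1, Measure.map_apply (NIBM.measurable_eval_path t) hB, hlaw,
      Measure.bind_apply hBt κ.aemeasurable, hstart,
      lintegral_map' (κ.measurable_coe hBt).aemeasurable hMo]
    simp only [Measure.map_apply (NIBM.measurable_eval_path t) hB]
  have hmat : ∀ B, MeasurableSet B → P'.map (fun ω => Φ (M ω, H ω)) B
      = ∫⁻ ω, (NIBM.gue n).map (fun A => Φ (M ω, A)) B ∂P' := by
    intro B hB
    have h1 : P'.map (fun ω => Φ (M ω, H ω)) = (P'.map fun ω => (M ω, H ω)).map Φ :=
      (AEMeasurable.map_map_of_aemeasurable hΦm.aemeasurable (hM.prodMk hH.aemeasurable)).symm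
    rw [h1, (indepFun_iff_map_prod_eq_prod_map_map hM hH.aemeasurable).1 hMH, hH.map_eq,
      Measure.map_apply hΦm hB, Measure.prod_apply (hΦm hB),
      lintegral_map' (measurable_measure_prodMk_left (hΦm hB)).aemeasurable hM]
    refine lintegral_congr fun ω => ?_
    have hω : Measurable fun A => Φ (M ω, A) := hΦm.comp measurable_prodMk_left
    rw [Measure.map_apply hω hB]
    rfl
  have heq : P.map (fun ω => X ω t) = P'.map (fun ω => Φ (M ω, H ω)) := by
    ext B hB
    rw [hpath B hB, hmat B hB]
    refine lintegral_congr_ae ?_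
    filter_upwards [hMherm, hstrict] with ω h1 h2
    rw [(hκ _ h2).map_eq hn hσ hσn h2 ht h1 rfl]
  refine ⟨heq, fun ht0 => ?_⟩
  have hac : P.map (fun ω => X ω t) ≪ volume := by
    refine Measure.AbsolutelyContinuous.mk fun B hB h0 => ?_
    rw [hpath B hB]
    refine lintegral_eq_zero_of_ae_eq_zero ?_
    filter_upwards [hstrict] with ω h2
    exact (hκ _ h2).map_absolutelyContinuous hσ h2 ht0 ht h0
  have := Measure.isProbabilityMeasure_map (μ := P) (hXt t)
  -- Having a density, and the density itself, depend only on the law, so the matrix side inherits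
  -- both from the path side.
  refine ⟨⟨hXt t, inferInstance, hac⟩, ⟨hZ, ?_, heq ▸ hac⟩, ?_⟩
  · change (P'.map (fun ω => Φ (M ω, H ω))).HaveLebesgueDecomposition volume
    rw [← heq]
    infer_instance
  · change (P.map fun ω => X ω t).rnDeriv volume =ᵐ[volume]
      (P'.map fun ω => Φ (M ω, H ω)).rnDeriv volume
    rw [heq]
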